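/- Let $\mathbb R_+=(0,\infty)$, $\bar{\mathbb R}_+=[0,\infty)$, and let $\mathcal H=L_2(\mathbb R_+)$ be the Hilbert space of complex-valued square integrable functions. Let $q\in C^\infty(\bar{\mathbb R}_+)$ be real-valued, and let $L_0$ be the operator in $\mathcal H$ given by $L_0y=-y''+qy$ on $$\mathrm{Dom}\,L_0=\{y\in\mathcal H\cap H^2_{\rm loc}(\bar{\mathbb R}_+)\ :\ y(0)=y'(0)=0,\ -y''+qy\in\mathcal H\}.$$ Assume that the limit point case takes place at infinity (that is, it is not the case that for every $z\in\mathbb C$ all solutions of $-u''+qu=zu$ on $[0,\infty)$ belong to $L_2(\mathbb R_+)$) and that $L_0$ is positive definite, i.e. for some $\varkappa>0$ one has $(L_0y,y)\ge\varkappa\|y\|^2$ for all $y\in\mathrm{Dom}\,L_0$. Let $L$ be the Friedrichs extension of $L_0$. For a closed subspace $\mathcal G\subseteq\mathcal H$ and $T>0$ put $$I^T\mathcal G=\overline{\Big\{\int_0^T L^{-1/2}\sin\big[(T-s)L^{1/2}\big]g(s)\,ds\ :\ g\in L_2^{\rm loc}([0,\infty);\mathcal G)\Big\}},$$ the closure of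 the set of the states at time $T$ of the solutions of $v_{tt}+Lv=g$, $v|_{t=0}=v_t|_{t=0}=0$ ($I^0=\mathrm{id}$; the family $I=\{I^t\}_{t\ge 0}$ is called the wave isotony). For a measurable set $E\subseteq\bar{\mathbb R}_+$ let $L_2(E)$ be the subspace of the functions in $\mathcal H$ that vanish almost everywhere outside of $E$, and for $T>0$ let $E^T=\{x\in\bar{\mathbb R}_+ : \mathrm{dist}(x,E)<T\}$ (with $\emptyset^T=\emptyset$). Then the following holds. 1. If $0\le a<b\le\infty$, $T>0$ and $\Delta_{a,b}$ is one of the intervals $(a,b)$, $[a,b)$, $(a,b]$, $[a,b]$ (understood as subsets of $\bar{\mathbb R}_+$ when $b=\infty$), then $I^TL_2(\Delta_{a,b})=L_2(\Delta_{a,b}^T)$. 2. More generally, if $E=\bigcup_{j=1}^n\Delta_{a_j,b_j}$ is an elementary set, that is, a finite union of such intervals with $0\le a_1<b_1<a_2<b_2<\dots<a_n<b_n\le\infty$, and $T>0$, then $I^TL_2(E)=L_2(E^T)$. -/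

import Mathlib

open Set Filter Topology MeasureTheory
open scoped ContDiff ComplexOrder LinearPMap

noncomputable section

namespace WaveIsotony

/-! ### Abstract part: Friedrichs extension and the wave isotony in a Hilbert space -/

section Abstract

variable {H : Type*} [NormedAddCommGroup H] [InnerProductSpace ℂ H]

/-- `(A y, y) ≥ κ ‖y‖²` on the domain of `A`, for some `κ > 0`. The order is the one of `ℂ`, so
that the inequality includes that `(A y, y)` is real (that is, that `A` is symmetric). -/
def IsPositiveDefinite (A : H →ₗ.[ℂ] H) : Prop :=
  ∃ κ : ℝ, 0 < κ ∧ ∀ y : A.domain, ((κ * ‖(y : H)‖ ^ 2 : ℝ) : ℂ) ≤ inner ℂ (A y) (y : H)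

/-- The quadratic form `y ↦ Re (A y, y)` of an operator. -/
def quadForm (A : H →ₗ.[ℂ] H) (y : A.domain) : ℝ := (inner ℂ (A y) (y : H)).re

theorem quadForm_nonneg {A : H →ₗ.[ℂ] H} (hA : IsPositiveDefinite A) (y : A.domain) :
    0 ≤ quadForm A y := by
  obtain ⟨κ, hκ, h⟩ := hA
  have h1 := (Complex.le_def.1 (h y)).1
  rw [Complex.ofReal_re] at h1
  exact le_trans (by positivity) h1

theorem quadForm_add_le {A : H →ₗ.[ℂ] H} (hA : IsPositiveDefinite A) (x y : A.domain) :
    quadForm A (x + y) ≤ 2 * quadForm A x + 2 * quadForm A y := by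
  have h := quadForm_nonneg hA (x - y)
  have e : quadForm A (x + y) + quadForm A (x - y) = 2 * quadForm A x + 2 * quadForm A y := by
    simp only [quadForm, LinearPMap.map_add, LinearPMap.map_sub, Submodule.coe_add,
      Submodule.coe_sub, inner_add_left, inner_add_right, inner_sub_left, inner_sub_right,
      Complex.add_re, Complex.sub_re]
    ring
  linarith

theorem quadForm_smul (A : H →ₗ.[ℂ] H) (c : ℂ) (y : A.domain) :
    quadForm A (c • y) = ‖c‖ ^ 2 * quadForm A y := by
  simp only [quadForm, LinearPMap.map_smul, Submodule.coe_smul, inner_smul_left, inner_smul_right]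
  rw [mul_left_comm, ← mul_assoc, mul_comm _ c, Complex.mul_conj, Complex.re_ofReal_mul, Complex.normSq_eq_norm_sq]

/-- The domain of the closure of the quadratic form of a positive definite operator `A`:
the vectors that are limits of sequences from the domain of `A` which are Cauchy in the form. -/
def formDomain (A : H →ₗ.[ℂ] H) (hA : IsPositiveDefinite A) : Submodule ℂ H where
  carrier := {y | ∃ s : ℕ → A.domain, Tendsto (fun n => (s n : H)) atTop (𝓝 y) ∧
    Tendsto (fun p : ℕ × ℕ => quadForm A (s p.1 - s p.2)) atTop (𝓝 0)}
  zero_mem' := ⟨fun _ => 0, by simp, by simp [quadForm]⟩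
  add_mem' := by
    rintro x y ⟨s, hs, hs'⟩ ⟨r, hr, hr'⟩
    refine ⟨fun n => s n + r n, by simpa using hs.add hr, ?_⟩
    refine squeeze_zero (fun p => quadForm_nonneg hA _) (fun p => ?_)
      (by simpa using (hs'.const_mul 2).add (hr'.const_mul 2))
    rw [add_sub_add_comm]
    exact quadForm_add_le hA _ _
  smul_mem' := by
    rintro c y ⟨s, hs, hs'⟩
    refine ⟨fun n => c • s n, by simpa using hs.const_smul c, ?_⟩
    simp only [← smul_sub, quadForm_smul]
    simpa using hs'.const_mul (‖c‖ ^ 2)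

variable [CompleteSpace H]

/-- The Friedrichs extension of a densely defined positive definite operator `A`: the restriction
of the adjoint of `A` to those elements of its domain that lie in the form domain of `A`. -/
def friedrichs (A : H →ₗ.[ℂ] H) (hA : IsPositiveDefinite A) : H →ₗ.[ℂ] H :=
  A†.domRestrict (formDomain A hA)

/-- `B` is the bounded everywhere defined inverse of the operator `L`. -/
def IsBoundedInverse (L : H →ₗ.[ℂ] H) (B : H →L[ℂ] H) : Prop :=
  ∀ f y : H, B f = y ↔ (y, f) ∈ L.graph

open Classical in
/-- The bounded everywhere defined inverse `L⁻¹` of `L` (and `0` if there is none). -/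
def boundedInverse (L : H →ₗ.[ℂ] H) : H →L[ℂ] H :=
  if h : ∃ B : H →L[ℂ] H, IsBoundedInverse L B then h.choose else 0

/-- The function `λ ↦ λ^(-1/2) sin (t λ^(1/2))` in terms of the variable `μ = 1 / λ`. -/
def sineFun (t μ : ℝ) : ℝ := √μ * Real.sin (t / √μ)

theorem continuous_sineFun (t : ℝ) : Continuous (sineFun t) := by
  rw [continuous_iff_continuousAt]
  intro x
  rcases lt_or_ge 0 x with hx | hx
  · have h : √x ≠ 0 := (Real.sqrt_pos.2 hx).ne'
    unfold sineFun
    fun_prop (disch := assumption)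
  · have h0 : √x = 0 := Real.sqrt_eq_zero_of_nonpos hx
    have h1 : sineFun t x = 0 := by simp [sineFun, h0]
    rw [ContinuousAt, h1]
    refine squeeze_zero_norm (a := fun y => √y) (fun y => ?_) ?_
    · rw [sineFun, norm_mul, Real.norm_of_nonneg (Real.sqrt_nonneg y)]
      exact mul_le_of_le_one_right (Real.sqrt_nonneg y) (Real.abs_sin_le_one _)
    · simpa [h0] using (Real.continuous_sqrt.tendsto x)

theorem abs_sineFun_sub_le (t s μ : ℝ) : |sineFun t μ - sineFun s μ| ≤ |t - s| := by
  rcases (Real.sqrt_nonneg μ).eq_or_lt' with h | h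
  · simp [sineFun, h]
  · have h1 : |Real.sin (t / √μ) - Real.sin (s / √μ)| ≤ |t / √μ - s / √μ| := by
      have := Real.lipschitzWith_sin.dist_le_mul (t / √μ) (s / √μ)
      simpa [Real.dist_eq] using this
    rw [sineFun, sineFun, ← mul_sub, abs_mul, abs_of_pos h]
    refine (mul_le_mul_of_nonneg_left h1 h.le).trans_eq ?_
    rw [← sub_div, abs_div, abs_of_pos h]
    field_simp

/-- The bounded operator `L^(-1/2) sin (t L^(1/2))` for a positive definite self-adjoint
operator `L`, through the continuous functional calculus of `L⁻¹`. -/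
def sineOp (L : H →ₗ.[ℂ] H) (t : ℝ) : H →L[ℂ] H :=
  cfc (sineFun t) (boundedInverse L)

theorem norm_sineOp_sub_le (L : H →ₗ.[ℂ] H) (t s : ℝ) :
    ‖sineOp L t - sineOp L s‖ ≤ |t - s| := by
  unfold sineOp
  rw [← cfc_sub (sineFun t) (sineFun s) (boundedInverse L) (continuous_sineFun t).continuousOn
    (continuous_sineFun s).continuousOn]
  exact norm_cfc_le (abs_nonneg _) (fun x _ => abs_sineFun_sub_le t s x)

theorem norm_sineOp_le (L : H →ₗ.[ℂ] H) (t : ℝ) : ‖sineOp L t‖ ≤ |t| :=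
  norm_cfc_le (abs_nonneg _) (fun x _ => by
    simpa [sineFun] using abs_sineFun_sub_le t 0 x)

theorem continuous_sineOp (L : H →ₗ.[ℂ] H) : Continuous (sineOp L) := by
  refine (LipschitzWith.of_dist_le_mul (K := 1) fun t s => ?_).continuous
  simpa [dist_eq_norm] using norm_sineOp_sub_le L t s

/-- `g ∈ L₂^loc([0, ∞); G)` for a closed subspace `G`. -/
def IsControl (G : ClosedSubmodule ℂ H) (g : ℝ → H) : Prop :=
  (∀ R : ℝ, MemLp g 2 (volume.restrict (Ioc 0 R))) ∧ ∀ᵐ s ∂(volume.restrict (Ioi (0 : ℝ))), g s ∈ G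

/-- The (generalized) solution at time `t ≥ 0` of `v'' + L v = g`, `v(0) = v'(0) = 0`, that is
`v^g(t) = ∫₀ᵗ L^(-1/2) sin ((t - s) L^(1/2)) g(s) ds`. -/
def wave (L : H →ₗ.[ℂ] H) (g : ℝ → H) (t : ℝ) : H :=
  ∫ s in Ioc 0 t, sineOp L (t - s) (g s)

theorem integrable_wave (L : H →ₗ.[ℂ] H) {g : ℝ → H}
    (hg : ∀ R : ℝ, MemLp g 2 (volume.restrict (Ioc 0 R))) (t : ℝ) :
    Integrable (fun s => sineOp L (t - s) (g s)) (volume.restrict (Ioc 0 t)) := by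
  have hi : Integrable g (volume.restrict (Ioc 0 t)) := (hg t).integrable one_le_two
  have hc : Continuous fun s : ℝ => sineOp L (t - s) :=
    (continuous_sineOp L).comp (by fun_prop)
  refine Integrable.mono' (hi.norm.const_mul |t|) ?_ ?_
  · exact (ContinuousLinearMap.id ℂ (H →L[ℂ] H)).aestronglyMeasurable_comp₂
      hc.aestronglyMeasurable hi.aestronglyMeasurable
  · refine (ae_restrict_iff' measurableSet_Ioc).2 (Eventually.of_forall fun s hs => ?_)
    refine (ContinuousLinearMap.le_opNorm _ _).trans ?_
    refine mul_le_mul_of_nonneg_right ((norm_sineOp_le L _).trans ?_) (norm_nonneg _)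
    rw [abs_of_nonneg (by linarith [hs.2]), abs_of_nonneg (by linarith [hs.1, hs.2])]
    linarith [hs.1]

/-- The set of the states `v^g(t)` reachable at time `t` by means of the `G`-valued controls. -/
def reachable (L : H →ₗ.[ℂ] H) (t : ℝ) (G : ClosedSubmodule ℂ H) : Submodule ℂ H where
  carrier := {v | ∃ g : ℝ → H, IsControl G g ∧ v = wave L g t}
  zero_mem' := ⟨fun _ => 0, ⟨fun _ => MemLp.zero', by simp⟩, by simp [wave]⟩
  add_mem' := by
    rintro _ _ ⟨g, hg, rfl⟩ ⟨k, hk, rfl⟩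
    refine ⟨fun s => g s + k s, ⟨fun R => (hg.1 R).add (hk.1 R), ?_⟩, ?_⟩
    · filter_upwards [hg.2, hk.2] with s h1 h2 using add_mem h1 h2
    · simp only [wave, map_add]
      rw [integral_add (integrable_wave L hg.1 t) (integrable_wave L hk.1 t)]
  smul_mem' := by
    rintro c _ ⟨g, hg, rfl⟩
    refine ⟨fun s => c • g s, ⟨fun R => (hg.1 R).const_smul c, ?_⟩, ?_⟩
    · filter_upwards [hg.2] with s h1 using G.toSubmodule.smul_mem c h1
    · simp only [wave, map_smul]
      rw [integral_smul]

/-- The wave isotony `I^t` (`t ≥ 0`) determined by the operator `L`: `I^0 = id`, and for `t > 0`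
`I^t G` is the closure of the set of states reachable at time `t` by `G`-valued controls. -/
def waveIsotony (L : H →ₗ.[ℂ] H) (t : ℝ) (G : ClosedSubmodule ℂ H) : ClosedSubmodule ℂ H :=
  if t = 0 then G else (reachable L t G).closure

end Abstract

/-! ### The Sturm–Liouville operator on the half-line -/

/-- Lebesgue measure on the half-line `(0, ∞)`. -/
abbrev halfLine : Measure ℝ := volume.restrict (Ioi (0 : ℝ))

/-- The Hilbert space `L₂(0, ∞)` of complex functions. -/
abbrev L2HalfLine : Type := Lp ℂ 2 halfLine

/-- `u ∈ H²_loc([0, ∞))` with derivatives `u' = u₁`, `u'' = u₂`: the function `u` is an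
indefinite integral of `u₁` and `u₁` is an indefinite integral of `u₂ ∈ L₂^loc([0, ∞))`. -/
structure IsH2Loc (u u₁ u₂ : ℝ → ℂ) : Prop where
  memLp : ∀ R : ℝ, MemLp u₂ 2 (volume.restrict (Ioc 0 R))
  eq_integral : ∀ x : ℝ, 0 ≤ x → u x = u 0 + ∫ s in (0 : ℝ)..x, u₁ s
  deriv_eq_integral : ∀ x : ℝ, 0 ≤ x → u₁ x = u₁ 0 + ∫ s in (0 : ℝ)..x, u₂ s

theorem continuousOn_of_eq_integral {f g : ℝ → ℂ}
    (hg : ∀ x : ℝ, 0 ≤ x → IntervalIntegrable g volume 0 x)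
    (h : ∀ x : ℝ, 0 ≤ x → f x = f 0 + ∫ s in (0 : ℝ)..x, g s) : ContinuousOn f (Ici 0) := by
  intro x hx
  have hx0 : (0 : ℝ) ≤ x := hx
  have hx1 : (0 : ℝ) ≤ x + 1 := by linarith
  have hI : ContinuousOn (fun y => f 0 + ∫ s in (0 : ℝ)..y, g s) (Icc 0 (x + 1)) := by
    refine continuousOn_const.add ?_
    have := intervalIntegral.continuousOn_primitive_interval' (hg (x + 1) hx1)
      (left_mem_uIcc)
    rwa [uIcc_of_le hx1] at this
  have hf : ContinuousOn f (Icc 0 (x + 1)) := hI.congr fun y hy => h y hy.1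
  refine (hf x ⟨hx0, by linarith⟩).mono_of_mem_nhdsWithin ?_
  rw [← Ici_inter_Iic]
  exact inter_mem self_mem_nhdsWithin (mem_nhdsWithin_of_mem_nhds (Iic_mem_nhds (by linarith)))

theorem IsH2Loc.intervalIntegrable₂ {u u₁ u₂ : ℝ → ℂ} (h : IsH2Loc u u₁ u₂) {x : ℝ}
    (hx : 0 ≤ x) : IntervalIntegrable u₂ volume 0 x :=
  (intervalIntegrable_iff_integrableOn_Ioc_of_le hx).2 ((h.memLp x).integrable one_le_two)

theorem IsH2Loc.continuousOn₁ {u u₁ u₂ : ℝ → ℂ} (h : IsH2Loc u u₁ u₂) :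
    ContinuousOn u₁ (Ici 0) :=
  continuousOn_of_eq_integral (fun _ hx => h.intervalIntegrable₂ hx) h.deriv_eq_integral

theorem IsH2Loc.intervalIntegrable₁ {u u₁ u₂ : ℝ → ℂ} (h : IsH2Loc u u₁ u₂) {x : ℝ}
    (hx : 0 ≤ x) : IntervalIntegrable u₁ volume 0 x := by
  refine (h.continuousOn₁.mono ?_).intervalIntegrable
  rw [uIcc_of_le hx]
  exact Icc_subset_Ici_self

theorem IsH2Loc.continuousOn {u u₁ u₂ : ℝ → ℂ} (h : IsH2Loc u u₁ u₂) : ContinuousOn u (Ici 0) :=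
  continuousOn_of_eq_integral (fun _ hx => h.intervalIntegrable₁ hx) h.eq_integral

theorem IsH2Loc.add {u u₁ u₂ v v₁ v₂ : ℝ → ℂ} (hu : IsH2Loc u u₁ u₂) (hv : IsH2Loc v v₁ v₂) :
    IsH2Loc (u + v) (u₁ + v₁) (u₂ + v₂) where
  memLp R := (hu.memLp R).add (hv.memLp R)
  eq_integral x hx := by
    simp only [Pi.add_apply]
    rw [intervalIntegral.integral_add (hu.intervalIntegrable₁ hx) (hv.intervalIntegrable₁ hx),
      hu.eq_integral x hx, hv.eq_integral x hx]
    ring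
  deriv_eq_integral x hx := by
    simp only [Pi.add_apply]
    rw [intervalIntegral.integral_add (hu.intervalIntegrable₂ hx) (hv.intervalIntegrable₂ hx),
      hu.deriv_eq_integral x hx, hv.deriv_eq_integral x hx]
    ring

theorem IsH2Loc.smul {u u₁ u₂ : ℝ → ℂ} (c : ℂ) (hu : IsH2Loc u u₁ u₂) :
    IsH2Loc (c • u) (c • u₁) (c • u₂) where
  memLp R := (hu.memLp R).const_smul c
  eq_integral x hx := by
    simp only [Pi.smul_apply]
    rw [intervalIntegral.integral_smul, hu.eq_integral x hx, smul_add]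
  deriv_eq_integral x hx := by
    simp only [Pi.smul_apply]
    rw [intervalIntegral.integral_smul, hu.deriv_eq_integral x hx, smul_add]

/-- If a function that is integrable on all intervals `[0, x]` has zero integrals over them, then
it vanishes almost everywhere on the half-line. -/
theorem ae_eq_zero_of_integral_eq_zero {f : ℝ → ℂ}
    (hf : ∀ x : ℝ, 0 ≤ x → IntervalIntegrable f volume 0 x)
    (h : ∀ x : ℝ, 0 ≤ x → ∫ s in (0 : ℝ)..x, f s = 0) : f =ᵐ[halfLine] 0 := by
  have key : ∀ n : ℕ, ∀ᵐ x, x ∈ Ioo (0 : ℝ) n → f x = 0 := by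
    intro n
    have hn : (0 : ℝ) ≤ n := Nat.cast_nonneg n
    filter_upwards [(hf n hn).ae_hasDerivAt_integral] with x hx hx'
    have hu : uIcc (0 : ℝ) (n : ℝ) = Icc (0 : ℝ) (n : ℝ) := uIcc_of_le hn
    have h1 := hx (by rw [hu]; exact ⟨hx'.1.le, hx'.2.le⟩) 0 (by rw [hu]; exact ⟨le_rfl, hn⟩)
    have h2 : HasDerivAt (fun y => ∫ s in (0 : ℝ)..y, f s) 0 x :=
      (hasDerivAt_const x (0 : ℂ)).congr_of_eventuallyEq (by
        filter_upwards [Ioi_mem_nhds hx'.1] with y hy using h y (le_of_lt hy))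
    exact h1.unique h2
  refine (ae_restrict_iff' measurableSet_Ioi).2 ?_
  filter_upwards [ae_all_iff.2 key] with x hx hx0
  obtain ⟨n, hn⟩ := exists_nat_gt x
  exact hx n ⟨hx0, hn⟩

/-- The graph of the operator `L₀ y = -y'' + q y` in `L₂(0, ∞)` with the domain
`{y ∈ L₂ ∩ H²_loc([0, ∞)) | y(0) = y'(0) = 0, -y'' + q y ∈ L₂}`. -/
def minimalGraph (q : ℝ → ℝ) : Submodule ℂ (L2HalfLine × L2HalfLine) where
  carrier := {p | ∃ u u₁ u₂ : ℝ → ℂ, IsH2Loc u u₁ u₂ ∧ u 0 = 0 ∧ u₁ 0 = 0 ∧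
    p.1 =ᵐ[halfLine] u ∧ p.2 =ᵐ[halfLine] fun x => -u₂ x + q x * u x}
  zero_mem' := by
    refine ⟨0, 0, 0, ⟨fun _ => MemLp.zero', by simp, by simp⟩, rfl, rfl, Lp.coeFn_zero _ _ _, ?_⟩
    filter_upwards [Lp.coeFn_zero ℂ 2 halfLine] with x hx
    simpa using hx
  add_mem' := by
    rintro ⟨y, z⟩ ⟨y', z'⟩ ⟨u, u₁, u₂, hu, h0, h1, hy, hz⟩ ⟨v, v₁, v₂, hv, k0, k1, hy', hz'⟩
    refine ⟨_, _, _, hu.add hv, by simp [h0, k0], by simp [h1, k1], ?_, ?_⟩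
    · exact (Lp.coeFn_add y y').trans (hy.add hy')
    · refine (Lp.coeFn_add z z').trans ?_
      filter_upwards [hz, hz'] with x e e'
      simp only [Pi.add_apply] at *
      rw [e, e']
      ring
  smul_mem' := by
    rintro c ⟨y, z⟩ ⟨u, u₁, u₂, hu, h0, h1, hy, hz⟩
    refine ⟨_, _, _, hu.smul c, by simp [h0], by simp [h1], ?_, ?_⟩
    · refine (Lp.coeFn_smul c y).trans ?_
      filter_upwards [hy] with x e
      simp only [Pi.smul_apply] at *
      rw [e]
    · refine (Lp.coeFn_smul c z).trans ?_
      filter_upwards [hz] with x e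
      simp only [Pi.smul_apply, smul_eq_mul] at *
      rw [e]
      ring

theorem minimalGraph_functional (q : ℝ → ℝ) :
    ∀ p ∈ minimalGraph q, p.1 = 0 → p.2 = 0 := by
  rintro ⟨y, z⟩ ⟨u, u₁, u₂, hu, h0, h1, hy, hz⟩ (rfl : y = 0)
  have hu0 : u =ᵐ[halfLine] 0 := hy.symm.trans (Lp.coeFn_zero _ _ _)
  have hu' : EqOn u 0 (Ioi 0) :=
    Measure.eqOn_open_of_ae_eq hu0 isOpen_Ioi (hu.continuousOn.mono Ioi_subset_Ici_self)
      continuousOn_const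
  have hu₁0 : u₁ =ᵐ[halfLine] 0 := by
    refine ae_eq_zero_of_integral_eq_zero (fun x hx => hu.intervalIntegrable₁ hx) fun x hx => ?_
    have e := hu.eq_integral x hx
    rw [h0, zero_add] at e
    rw [← e]
    rcases hx.eq_or_lt with rfl | hx
    · exact h0
    · exact hu' hx
  have hu₁' : EqOn u₁ 0 (Ioi 0) :=
    Measure.eqOn_open_of_ae_eq hu₁0 isOpen_Ioi (hu.continuousOn₁.mono Ioi_subset_Ici_self)
      continuousOn_const
  have hu₂0 : u₂ =ᵐ[halfLine] 0 := by
    refine ae_eq_zero_of_integral_eq_zero (fun x hx => hu.intervalIntegrable₂ hx) fun x hx => ?_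
    have e := hu.deriv_eq_integral x hx
    rw [h1, zero_add] at e
    rw [← e]
    rcases hx.eq_or_lt with rfl | hx
    · exact h1
    · exact hu₁' hx
  refine (Lp.eq_zero_iff_ae_eq_zero).2 ?_
  filter_upwards [hz, hu0, hu₂0] with x e e0 e2
  simp [e, e0, e2]

/-- The operator `L₀ y = -y'' + q y` in `L₂(0, ∞)` with the domain
`{y ∈ L₂ ∩ H²_loc([0, ∞)) | y(0) = y'(0) = 0, -y'' + q y ∈ L₂}`. -/
def minimalOperator (q : ℝ → ℝ) : L2HalfLine →ₗ.[ℂ] L2HalfLine :=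
  (minimalGraph q).toLinearPMap

theorem graph_minimalOperator (q : ℝ → ℝ) : (minimalOperator q).graph = minimalGraph q :=
  Submodule.toLinearPMap_graph_eq _ (minimalGraph_functional q)

/-- `u` (with `u' = u₁`) solves `-u'' + q u = z u` on `[0, ∞)`. -/
def IsSolution (q : ℝ → ℝ) (z : ℂ) (u u₁ : ℝ → ℂ) : Prop :=
  ∀ x : ℝ, 0 ≤ x → HasDerivWithinAt u (u₁ x) (Ici 0) x ∧
    HasDerivWithinAt u₁ ((q x - z) * u x) (Ici 0) x

/-- The limit circle case at infinity: for every `z ∈ ℂ` all the solutions of `-u'' + q u = z u`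
are square integrable. -/
def LimitCircleCase (q : ℝ → ℝ) : Prop :=
  ∀ (z : ℂ) (u u₁ : ℝ → ℂ), IsSolution q z u u₁ → MemLp u 2 halfLine

/-- The limit point case at infinity. -/
def LimitPointCase (q : ℝ → ℝ) : Prop := ¬ LimitCircleCase q

/-- The subspace `L₂(E)` of the functions in `L₂(0, ∞)` that vanish outside of `E`. -/
def L2On (E : Set ℝ) : ClosedSubmodule ℂ L2HalfLine where
  carrier := {y | ∀ᵐ x ∂halfLine, x ∉ E → y x = 0}
  zero_mem' := by
    filter_upwards [Lp.coeFn_zero ℂ 2 halfLine] with x hx _ using hx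
  add_mem' := by
    intro y z hy hz
    filter_upwards [hy, hz, Lp.coeFn_add y z] with x h1 h2 h3 hx
    refine h3.trans ?_
    rw [Pi.add_apply, h1 hx, h2 hx, add_zero]
  smul_mem' := by
    intro c y hy
    filter_upwards [hy, Lp.coeFn_smul c y] with x h1 h3 hx
    simp [h3, h1 hx]
  isClosed' := by
    refine isClosed_of_closure_subset fun y hy => ?_
    obtain ⟨s, hs, hsy⟩ := mem_closure_iff_seq_limit.1 hy
    obtain ⟨ns, -, hns⟩ := (tendstoInMeasure_of_tendsto_Lp hsy).exists_seq_tendsto_ae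
    filter_upwards [hns, ae_all_iff.2 hs] with x h1 h2 hx
    refine tendsto_nhds_unique h1 ?_
    simp [h2 _ hx]

/-- `Δ` is one of the intervals `(a, b)`, `[a, b)`, `(a, b]`, `[a, b]` of the real line, where the
right endpoint is allowed to be `∞`. -/
def IsInterval (a : ℝ) (b : EReal) (Δ : Set ℝ) : Prop :=
  Δ = {x : ℝ | a < x ∧ (x : EReal) < b} ∨ Δ = {x : ℝ | a ≤ x ∧ (x : EReal) < b} ∨
    Δ = {x : ℝ | a < x ∧ (x : EReal) ≤ b} ∨ Δ = {x : ℝ | a ≤ x ∧ (x : EReal) ≤ b}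

/-- The metric neighbourhood `{x ∈ [0, ∞) | dist (x, E) < r}` in the half-line. -/
def nbhd (r : ℝ) (E : Set ℝ) : Set ℝ := Ici 0 ∩ Metric.thickening r E

/-- Elementary sets: `E = Δ₁ ∪ ... ∪ Δₙ`, where the `Δⱼ` are intervals with endpoints `aⱼ`, `bⱼ`
and `0 ≤ a₁ < b₁ < a₂ < b₂ < ... < aₙ < bₙ ≤ ∞`. -/
def IsElementary (E : Set ℝ) : Prop :=
  ∃ (n : ℕ) (a : Fin n → ℝ) (b : Fin n → EReal) (Δ : Fin n → Set ℝ),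
    (∀ j, 0 ≤ a j) ∧ (∀ j, (a j : EReal) < b j) ∧ (∀ i j, i < j → b i < (a j : EReal)) ∧
    (∀ j, IsInterval (a j) (b j) (Δ j)) ∧ E = ⋃ j, Δ j

end WaveIsotony

end

/-!
Write `S(t) = L^(-1/2) sin (t L^(1/2))`. The statement has two halves, each a fact on the solution
`v(t) = S(t) y` of `v_tt - v_xx + q v = 0` with `v(0) = 0`, `v_t(0) = y` and the Dirichlet condition
at the origin.

* Finite speed of propagation (`sineOp_ae_eq_zero`): `S(t)` maps `L₂(E)` into `L₂(E^T)` for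
  `0 ≤ t < T`, so that the states reachable by `L₂(E)`-valued controls lie in `L₂(E^T)`.
* Unique continuation in the space variable (`ae_eq_zero_of_sineOp_ae_eq_zero`): if `S(t) y`
  vanishes near a point `c` for `|t| ≤ T`, then `y` vanishes in `(c - T, c + T)`. If
  `y ∈ L₂(E^T)` is orthogonal to the reachable states, then `S(t) y` vanishes on the interior of
  `E` for `|t| ≤ T` by the self-adjointness of `S(t)`. Hence `y` vanishes on `E^T`,
  provided that `E` lies in the closure of the interior of `E ∩ (0, ∞)`, and the reachable states are dense in `L₂(E^T)`.

In one space dimension the two variables of the wave equation play symmetric roles, and both facts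
are instances of a single uniqueness theorem for the Goursat problem `∂₁ ∂₂ w = P w` in a trapezoid
with zero data below the diagonal `ξ + η = 0`, where `ξ`, `η` are the characteristic coordinates
(`charCoord`): the sum `ξ + η` is proportional to `t` for the first fact and to `x - c` for the
second. Since `v` is a curve in `L₂` with no pointwise derivatives, the uniqueness is shown by
duality (`eq_zero_of_weak_solution`). The functional `ℓ θ = ∫ ⟨v, θ⟩` satisfies
`ℓ (∂₁ ∂₂ Φ) = ℓ (P Φ)` for all test functions. As `∂₁ ∂₂ Φ = θ` is solved by the integral of `θ`
over a quadrant, `ℓ θ` equals `ℓ (P Φ)`, and `θ ↦ P Φ` is a contraction in a sup norm with an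
exponential weight.

The weak equation comes from `S'' = -L S` (`integral_sineOp_duhamel`). It requires the test
functions to lie in the domain of `L`. The operator `L` enters through its bounded inverse, which is
nonnegative (`exists_isBoundedInverse_friedrichs`), and its domain contains the smooth functions
with compact support in `[0, ∞)` that vanish at the origin (`toL2_mem_graph_friedrichs`): their
derivative at the origin can be removed at a small cost in the energy form. A test function on the
plane is turned into one on the half-line by taking its odd part in `x` (`slice`), with `q` extended
evenly, so that no boundary appears in the Goursat problem.
-/

noncomputable section

namespace WaveIsotony

/-! ### The inverse of the Friedrichs extension -/

section FriedrichsInverse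

variable {H : Type*} [NormedAddCommGroup H] [InnerProductSpace ℂ H]

/-- Symmetry of a positive definite operator, by polarization. -/
theorem IsPositiveDefinite.conj_inner {A : H →ₗ.[ℂ] H} (hA : IsPositiveDefinite A)
    (x y : A.domain) : (starRingEnd ℂ) (inner ℂ (A y) (x : H)) = inner ℂ (A x) (y : H) := by
  obtain ⟨κ, hκ, h⟩ := hA
  have him : ∀ z : A.domain, (inner ℂ (A z) (z : H)).im = 0 := fun z => by
    have := (Complex.le_def.1 (h z)).2
    rw [Complex.ofReal_im] at this
    exact this.symm
  have h1 := him (x + y)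
  have h2 := him (x + (Complex.I : ℂ) • y)
  simp only [LinearPMap.map_add, LinearPMap.map_smul, Submodule.coe_add, Submodule.coe_smul,
    inner_add_left, inner_add_right, inner_smul_left, inner_smul_right, Complex.add_im,
    Complex.mul_im, Complex.mul_re, Complex.conj_I, Complex.I_re, Complex.I_im, Complex.neg_re,
    Complex.neg_im, Complex.add_re, him x, him y] at h1 h2
  apply Complex.ext
  · simp only [Complex.conj_re]
    linarith
  · simp only [Complex.conj_im]
    linarith

/-- The domain of a positive definite operator `A`, to be equipped with the energy inner product
`(A x, y)`. It is a separate type, since the domain already carries the inner product of `H`. -/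
def EnergySpace (A : H →ₗ.[ℂ] H) (_ : IsPositiveDefinite A) : Type _ := A.domain

namespace EnergySpace

variable {A : H →ₗ.[ℂ] H} {hA : IsPositiveDefinite A}

instance : AddCommGroup (EnergySpace A hA) := inferInstanceAs (AddCommGroup A.domain)

instance : Module ℂ (EnergySpace A hA) := inferInstanceAs (Module ℂ A.domain)

/-- The identification of the domain of `A` with the energy space. -/
def ofDomain (hA : IsPositiveDefinite A) : A.domain ≃ₗ[ℂ] EnergySpace A hA := LinearEquiv.refl ℂ _

/-- The energy inner product `(A x, y)`. -/
@[reducible] def core (A : H →ₗ.[ℂ] H) (hA : IsPositiveDefinite A) :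
    InnerProductSpace.Core ℂ (EnergySpace A hA) where
  inner x y := inner ℂ (A ((ofDomain hA).symm x)) ((ofDomain hA).symm y : H)
  conj_inner_symm x y := hA.conj_inner _ _
  re_inner_nonneg x := quadForm_nonneg hA _
  add_left x y z := by
    rw [map_add, LinearPMap.map_add, inner_add_left]
  smul_left x y c := by
    rw [map_smul, LinearPMap.map_smul, inner_smul_left]
  definite x hx := by
    obtain ⟨κ, hκ, h⟩ := id hA
    have h1 := (Complex.le_def.1 (h ((ofDomain hA).symm x))).1
    rw [Complex.ofReal_re] at h1
    have hx' : inner ℂ (A ((ofDomain hA).symm x)) ((ofDomain hA).symm x : H) = 0 := hx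
    rw [hx', Complex.zero_re] at h1
    have h2 : ‖((ofDomain hA).symm x : H)‖ ^ 2 = 0 := by nlinarith [sq_nonneg ‖((ofDomain hA).symm x : H)‖]
    have h3 : ((ofDomain hA).symm x : H) = 0 := by simpa using h2
    have h4 : (ofDomain hA).symm x = 0 := Subtype.ext h3
    simpa using h4

instance : NormedAddCommGroup (EnergySpace A hA) :=
  @InnerProductSpace.Core.toNormedAddCommGroup ℂ _ _ _ _ (core A hA)

instance : InnerProductSpace ℂ (EnergySpace A hA) := InnerProductSpace.ofCore (core A hA).toCore

theorem inner_ofDomain (x y : A.domain) :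
    inner ℂ (ofDomain hA x) (ofDomain hA y) = inner ℂ (A x) (y : H) := rfl

theorem norm_ofDomain_sq (x : A.domain) : ‖ofDomain hA x‖ ^ 2 = quadForm A x := by
  rw [← inner_self_eq_norm_sq (𝕜 := ℂ), inner_ofDomain]
  rfl

/-- The embedding of the energy space into `H`. -/
def embed (A : H →ₗ.[ℂ] H) (hA : IsPositiveDefinite A) : EnergySpace A hA →L[ℂ] H :=
  LinearMap.mkContinuousOfExistsBound (A.domain.subtype ∘ₗ (ofDomain hA).symm.toLinearMap) (by
    obtain ⟨κ, hκ, h⟩ := id hA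
    refine ⟨√(1 / κ), fun x => ?_⟩
    have h1 := (Complex.le_def.1 (h ((ofDomain hA).symm x))).1
    rw [Complex.ofReal_re] at h1
    have h2 : κ * ‖((ofDomain hA).symm x : H)‖ ^ 2 ≤ ‖x‖ ^ 2 := by
      have := norm_ofDomain_sq (hA := hA) ((ofDomain hA).symm x)
      rw [LinearEquiv.apply_symm_apply] at this
      rw [this]
      exact h1
    refine le_of_sq_le_sq ?_ (by positivity)
    rw [mul_pow, Real.sq_sqrt (by positivity), one_div, inv_mul_eq_div, le_div_iff₀ hκ, mul_comm]
    exact h2)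

theorem embed_ofDomain (x : A.domain) : embed A hA (ofDomain hA x) = x := rfl

variable [CompleteSpace H]

/-- The extension of the embedding to the completion of the energy space. -/
def extend (A : H →ₗ.[ℂ] H) (hA : IsPositiveDefinite A) :
    UniformSpace.Completion (EnergySpace A hA) →L[ℂ] H :=
  (embed A hA).extend UniformSpace.Completion.toComplL

theorem extend_coe (x : EnergySpace A hA) : extend A hA x = embed A hA x :=
  ContinuousLinearMap.extend_eq _ (UniformSpace.Completion.denseRange_coe)
    (UniformSpace.Completion.isUniformInducing_coe _) x

/-- The energy inner product with an element `x` of the domain of `A` is the inner product with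
`A x` in `H`. -/
theorem inner_coe_ofDomain (v : UniformSpace.Completion (EnergySpace A hA)) (x : A.domain) :
    inner ℂ v (ofDomain hA x : UniformSpace.Completion (EnergySpace A hA)) =
      inner ℂ (extend A hA v) (A x) := by
  induction v using UniformSpace.Completion.induction_on with
  | hp =>
    refine isClosed_eq ?_ ?_
    · fun_prop
    · fun_prop
  | ih a =>
    rw [UniformSpace.Completion.inner_coe, extend_coe]
    obtain ⟨z, rfl⟩ := (ofDomain hA).surjective a
    rw [inner_ofDomain, embed_ofDomain, ← hA.conj_inner, inner_conj_symm]

/-- The form domain is the image in `H` of the completion of the energy space. -/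
theorem mem_range_extend (y : H) : y ∈ (extend A hA).range ↔ y ∈ formDomain A hA := by
  constructor
  · rintro ⟨v, rfl⟩
    obtain ⟨s, hs, hv⟩ := mem_closure_iff_seq_limit.1 (UniformSpace.Completion.denseRange_coe v)
    choose r hr using hs
    refine ⟨fun n => (ofDomain hA).symm (r n), ?_, ?_⟩
    · have := ((extend A hA).continuous.tendsto v).comp hv
      refine this.congr fun n => ?_
      rw [Function.comp_apply, ← hr n, extend_coe]
      rfl
    · have h2 := (cauchySeq_iff_tendsto_dist_atTop_0.1 hv.cauchySeq).pow 2
      rw [zero_pow two_ne_zero] at h2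
      refine h2.congr fun p => ?_
      rw [← hr, ← hr, UniformSpace.Completion.dist_eq, dist_eq_norm,
        ← norm_ofDomain_sq (hA := hA), map_sub, LinearEquiv.apply_symm_apply,
        LinearEquiv.apply_symm_apply]
  · rintro ⟨s, hs, hs'⟩
    have h1 : CauchySeq (fun n => (ofDomain hA (s n) : UniformSpace.Completion (EnergySpace A hA))) := by
      rw [cauchySeq_iff_tendsto_dist_atTop_0]
      have := hs'.sqrt
      rw [Real.sqrt_zero] at this
      refine this.congr fun p => ?_
      rw [UniformSpace.Completion.dist_eq, dist_eq_norm, ← map_sub, ← norm_ofDomain_sq (hA := hA),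
        Real.sqrt_sq (norm_nonneg _)]
    obtain ⟨v, hv⟩ := cauchySeq_tendsto_of_complete h1
    refine ⟨v, tendsto_nhds_unique (((extend A hA).continuous.tendsto v).comp hv) ?_⟩
    refine hs.congr fun n => ?_
    rw [Function.comp_apply, extend_coe, embed_ofDomain]

end EnergySpace

variable [CompleteSpace H]

/-- The Friedrichs extension in weak form: `f = L y` if and only if `y` belongs to the form domain
and `(f, x) = (y, A x)` for all `x` in the domain of `A`. -/
theorem mem_graph_friedrichs {A : H →ₗ.[ℂ] H} (hA : IsPositiveDefinite A)
    (hd : Dense (A.domain : Set H)) {y f : H} :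
    (y, f) ∈ (friedrichs A hA).graph ↔
      y ∈ formDomain A hA ∧ ∀ x : A.domain, inner ℂ f (x : H) = inner ℂ y (A x) := by
  rw [LinearPMap.mem_graph_iff]
  constructor
  · rintro ⟨⟨z, hz⟩, rfl, rfl⟩
    refine ⟨hz.1, fun x => ?_⟩
    have h1 : friedrichs A hA ⟨z, hz⟩ = A† ⟨z, hz.2⟩ := LinearPMap.domRestrict_apply rfl
    simp only [h1]
    exact LinearPMap.adjoint_isFormalAdjoint hd ⟨z, hz.2⟩ x
  · rintro ⟨h1, h2⟩
    have h3 : y ∈ A†.domain := LinearPMap.mem_adjoint_domain_of_exists _ ⟨f, h2⟩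
    refine ⟨⟨y, h1, h3⟩, rfl, ?_⟩
    have h4 : friedrichs A hA ⟨y, h1, h3⟩ = A† ⟨y, h3⟩ := LinearPMap.domRestrict_apply rfl
    rw [h4]
    exact LinearPMap.adjoint_apply_eq hd ⟨y, h3⟩ h2

open EnergySpace in
/-- The inverse of the Friedrichs extension is `J J*`, where `J` is the embedding into `H` of the
completion of the domain in the energy norm. -/
theorem exists_isBoundedInverse_friedrichs {A : H →ₗ.[ℂ] H} (hA : IsPositiveDefinite A)
    (hd : Dense (A.domain : Set H)) :
    ∃ B : H →L[ℂ] H, IsBoundedInverse (friedrichs A hA) B ∧ 0 ≤ B := by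
  refine ⟨extend A hA ∘L (extend A hA).adjoint, fun f y => ?_,
    (ContinuousLinearMap.nonneg_iff_isPositive _).2 (ContinuousLinearMap.isPositive_self_comp_adjoint _)⟩
  rw [mem_graph_friedrichs hA hd]
  have key : ∀ x : A.domain, inner ℂ ((extend A hA).adjoint f)
      (ofDomain hA x : UniformSpace.Completion (EnergySpace A hA)) = inner ℂ f (x : H) := fun x => by
    rw [ContinuousLinearMap.adjoint_inner_left, extend_coe, embed_ofDomain]
  constructor
  · rintro rfl
    refine ⟨(mem_range_extend _).1 ⟨_, rfl⟩, fun x => ?_⟩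
    rw [← key, inner_coe_ofDomain]
    rfl
  · rintro ⟨h1, h2⟩
    obtain ⟨w, rfl⟩ := (mem_range_extend _).2 h1
    have h3 : (extend A hA).adjoint f = w := by
      refine ext_inner_right ℂ fun z => UniformSpace.Completion.denseRange_coe.induction_on
        (p := fun z => inner ℂ ((extend A hA).adjoint f) z = inner ℂ w z) z ?_ ?_
      · refine isClosed_eq ?_ ?_ <;> fun_prop
      · intro a
        obtain ⟨x, rfl⟩ := (ofDomain hA).surjective a
        rw [key, h2, inner_coe_ofDomain]
        rfl
    rw [ContinuousLinearMap.comp_apply, h3]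
    rfl

theorem isBoundedInverse_friedrichs {A : H →ₗ.[ℂ] H} (hA : IsPositiveDefinite A)
    (hd : Dense (A.domain : Set H)) :
    IsBoundedInverse (friedrichs A hA) (boundedInverse (friedrichs A hA)) := by
  obtain ⟨B, hB, -⟩ := exists_isBoundedInverse_friedrichs hA hd
  rw [boundedInverse, dif_pos ⟨B, hB⟩]
  exact Exists.choose_spec _

theorem boundedInverse_friedrichs_nonneg {A : H →ₗ.[ℂ] H} (hA : IsPositiveDefinite A)
    (hd : Dense (A.domain : Set H)) : 0 ≤ boundedInverse (friedrichs A hA) := by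
  obtain ⟨B, hB, h0⟩ := exists_isBoundedInverse_friedrichs hA hd
  have : boundedInverse (friedrichs A hA) = B := by
    ext f
    exact (isBoundedInverse_friedrichs hA hd f (B f)).2 ((hB f (B f)).1 rfl)
  rwa [this]

end FriedrichsInverse

/-! ### The sine and cosine functions of an operator -/

section Duhamel

theorem abs_sin_add_sub_sub_le (a h : ℝ) :
    |Real.sin (a + h) - Real.sin a - h * Real.cos a| ≤ h ^ 2 := by
  have hd : ∀ x ∈ uIcc 0 h, HasDerivWithinAt (fun x => Real.sin (a + x) - x * Real.cos a)
      (Real.cos (a + x) - Real.cos a) (uIcc 0 h) x := fun x _ => by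
    have h1 := ((Real.hasDerivAt_sin (a + x)).comp_const_add a x).fun_sub
      ((hasDerivAt_id' x).mul_const (Real.cos a))
    rw [one_mul] at h1
    exact h1.hasDerivWithinAt
  have hb : ∀ x ∈ uIcc 0 h, ‖Real.cos (a + x) - Real.cos a‖ ≤ |h| := fun x hx => by
    have h1 := Real.lipschitzWith_cos.dist_le_mul (a + x) a
    rw [Real.dist_eq, Real.dist_eq, NNReal.coe_one, one_mul, add_sub_cancel_left] at h1
    refine h1.trans ?_
    simpa using abs_sub_left_of_mem_uIcc hx
  have := (convex_uIcc 0 h).norm_image_sub_le_of_norm_hasDerivWithin_le hd hb left_mem_uIcc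
    right_mem_uIcc
  rw [Real.norm_eq_abs, Real.norm_eq_abs, sub_zero, abs_mul_abs_self, ← pow_two] at this
  refine le_of_eq_of_le ?_ this
  congr 1
  simp
  ring

theorem abs_cos_add_sub_add_le (a h : ℝ) :
    |Real.cos (a + h) - Real.cos a + h * Real.sin a| ≤ h ^ 2 := by
  have := abs_sin_add_sub_sub_le (a + Real.pi / 2) h
  rw [Real.cos_add_pi_div_two, Real.sin_add_pi_div_two, add_right_comm,
    Real.sin_add_pi_div_two] at this
  simpa using this

/-- The function `λ ↦ λ⁻¹ cos (t λ^(1/2))` in terms of the variable `μ = 1 / λ` (and `0` for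
`μ ≤ 0`). -/
def cosineFun (t μ : ℝ) : ℝ := √μ ^ 2 * Real.cos (t / √μ)

theorem continuous_cosineFun (t : ℝ) : Continuous (cosineFun t) := by
  rw [continuous_iff_continuousAt]
  intro x
  rcases lt_or_ge 0 x with hx | hx
  · have h : √x ≠ 0 := (Real.sqrt_pos.2 hx).ne'
    unfold cosineFun
    fun_prop (disch := assumption)
  · have h0 : √x = 0 := Real.sqrt_eq_zero_of_nonpos hx
    have h1 : cosineFun t x = 0 := by simp [cosineFun, h0]
    rw [ContinuousAt, h1]
    refine squeeze_zero_norm (a := fun y => √y ^ 2) (fun y => ?_) ?_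
    · rw [cosineFun, norm_mul, Real.norm_of_nonneg (by positivity)]
      exact mul_le_of_le_one_right (by positivity) (Real.abs_cos_le_one _)
    · simpa [h0] using (Real.continuous_sqrt.tendsto x).pow 2

/-- The `t`-derivative of `μ ↦ μ * sineFun t μ` is `cosineFun t`. The factor `μ = 1 / λ` makes the
remainder bounded on bounded sets of `μ`. -/
theorem abs_sineFun_mul_remainder_le (t h μ : ℝ) :
    |sineFun (t + h) μ * μ - sineFun t μ * μ - h * cosineFun t μ| ≤ √μ * h ^ 2 := by
  rcases (Real.sqrt_nonneg μ).eq_or_lt' with h0 | h0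
  · simp [sineFun, cosineFun, h0]
  · have hμ : μ = √μ ^ 2 := (Real.sq_sqrt (Real.sqrt_pos.1 h0).le).symm
    generalize √μ = r at *
    have key := abs_sin_add_sub_sub_le (t / r) (h / r)
    rw [sineFun, sineFun, cosineFun, hμ, Real.sqrt_sq h0.le]
    have e : r * Real.sin ((t + h) / r) * r ^ 2 - r * Real.sin (t / r) * r ^ 2 -
        h * (r ^ 2 * Real.cos (t / r)) =
        r ^ 3 * (Real.sin (t / r + h / r) - Real.sin (t / r) - h / r * Real.cos (t / r)) := by
      rw [← add_div]
      field_simp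
    rw [e, abs_mul, abs_of_pos (by positivity)]
    refine (mul_le_mul_of_nonneg_left key (by positivity)).trans_eq ?_
    field_simp

theorem abs_cosineFun_remainder_le (t h μ : ℝ) :
    |cosineFun (t + h) μ - cosineFun t μ - h * -sineFun t μ| ≤ h ^ 2 := by
  rcases (Real.sqrt_nonneg μ).eq_or_lt' with h0 | h0
  · simpa [sineFun, cosineFun, h0] using sq_nonneg h
  · generalize hr : √μ = r at *
    have key := abs_cos_add_sub_add_le (t / r) (h / r)
    rw [cosineFun, cosineFun, sineFun, hr]
    have e : r ^ 2 * Real.cos ((t + h) / r) - r ^ 2 * Real.cos (t / r) -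
        h * -(r * Real.sin (t / r)) =
        r ^ 2 * (Real.cos (t / r + h / r) - Real.cos (t / r) + h / r * Real.sin (t / r)) := by
      rw [← add_div]
      field_simp
      ring
    rw [e, abs_mul, abs_of_pos (by positivity)]
    refine (mul_le_mul_of_nonneg_left key (by positivity)).trans_eq ?_
    field_simp

theorem hasDerivAt_apply {H : Type*} [NormedAddCommGroup H] [InnerProductSpace ℂ H]
    {T : ℝ → H →L[ℂ] H} {T' : H →L[ℂ] H} {x : ℝ → H} {x' : H} {t : ℝ}
    (hT : HasDerivAt T T' t) (hx : HasDerivAt x x' t) :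
    HasDerivAt (fun t => T t (x t)) (T' (x t) + T t x') t :=
  ((ContinuousLinearMap.restrictScalarsL ℂ H H ℝ ℝ).hasFDerivAt.comp_hasDerivAt t hT).clm_apply hx

variable {H : Type*} [NormedAddCommGroup H] [InnerProductSpace ℂ H] [CompleteSpace H]

/-- Differentiation of a functional calculus with respect to a parameter, under a uniform bound of
the remainder on the spectrum. -/
theorem hasDerivAt_cfc {B : H →L[ℂ] H} {F F' : ℝ → ℝ → ℝ}
    (hF : ∀ t, Continuous (F t)) (hF' : ∀ t, Continuous (F' t)) {C : ℝ} (hC : 0 ≤ C)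
    (h : ∀ t h, ∀ μ ∈ spectrum ℝ B, |F (t + h) μ - F t μ - h * F' t μ| ≤ C * h ^ 2) (t : ℝ) :
    HasDerivAt (fun t => cfc (F t) B) (cfc (F' t) B) t := by
  rw [hasDerivAt_iff_isLittleO_nhds_zero]
  have hO : (fun s : ℝ => cfc (F (t + s)) B - cfc (F t) B - s • cfc (F' t) B) =O[𝓝 0]
      fun s : ℝ => s ^ 2 := by
    refine Asymptotics.IsBigO.of_bound C (Eventually.of_forall fun s => ?_)
    rw [← cfc_smul s (F' t) B (hF' t).continuousOn, ← cfc_sub (F (t + s)) (F t) B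
      (hF _).continuousOn (hF _).continuousOn,
      ← cfc_sub (fun x => F (t + s) x - F t x) (fun x => s • F' t x) B
      ((hF _).sub (hF _)).continuousOn ((hF' _).const_smul s).continuousOn,
      Real.norm_of_nonneg (sq_nonneg s)]
    exact norm_cfc_le (by positivity) fun μ hμ => h t s μ hμ
  exact hO.trans_isLittleO (by
    simpa using Asymptotics.isLittleO_pow_id (𝕜 := ℝ) one_lt_two)

/-- The bounded operator `L⁻¹ cos (t L^(1/2))`. -/
def cosineOp (L : H →ₗ.[ℂ] H) (t : ℝ) : H →L[ℂ] H := cfc (cosineFun t) (boundedInverse L)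

variable {L : H →ₗ.[ℂ] H}

theorem isSelfAdjoint_sineOp (L : H →ₗ.[ℂ] H) (t : ℝ) : IsSelfAdjoint (sineOp L t) :=
  cfc_predicate _ _

theorem inner_sineOp_left (L : H →ₗ.[ℂ] H) (t : ℝ) (x y : H) :
    inner ℂ (sineOp L t x) y = inner ℂ x (sineOp L t y) :=
  (ContinuousLinearMap.isSelfAdjoint_iff_isSymmetric.1 (isSelfAdjoint_sineOp L t)) x y

theorem sineOp_zero (L : H →ₗ.[ℂ] H) : sineOp L 0 = 0 := by
  have : sineFun 0 = fun _ => 0 := by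
    funext μ
    simp [sineFun]
  rw [sineOp, this, cfc_const_zero]

theorem sineOp_neg (L : H →ₗ.[ℂ] H) (t : ℝ) : sineOp L (-t) = -sineOp L t := by
  have : sineFun (-t) = fun μ => -sineFun t μ := by
    funext μ
    simp [sineFun, neg_div]
  rw [sineOp, this, cfc_neg, sineOp]

theorem hasDerivAt_cosineOp (L : H →ₗ.[ℂ] H) (t : ℝ) :
    HasDerivAt (cosineOp L) (-sineOp L t) t := by
  have := hasDerivAt_cfc (B := boundedInverse L) (F := cosineFun)
    (F' := fun t μ => -sineFun t μ) continuous_cosineFun (fun t => (continuous_sineFun t).neg)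
    zero_le_one (fun t h μ _ => by
      simpa using abs_cosineFun_remainder_le t h μ) t
  rwa [cfc_neg] at this

theorem hasDerivAt_sineOp_comp (hB : 0 ≤ boundedInverse L) (t : ℝ) :
    HasDerivAt (fun t => sineOp L t ∘L boundedInverse L) (cosineOp L t) t := by
  have hsa : IsSelfAdjoint (boundedInverse L) := IsSelfAdjoint.of_nonneg hB
  have := hasDerivAt_cfc (B := boundedInverse L) (F := fun t μ => sineFun t μ * μ)
    (F' := cosineFun) (fun t => (continuous_sineFun t).mul continuous_id) continuous_cosineFun
    (C := 1 + ‖boundedInverse L‖) (by positivity) (fun t h μ hμ => by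
      refine (abs_sineFun_mul_remainder_le t h μ).trans ?_
      refine mul_le_mul_of_nonneg_right ?_ (sq_nonneg h)
      have h0 := spectrum_nonneg_of_nonneg hB hμ
      have h1 : μ ≤ ‖boundedInverse L‖ := (le_abs_self μ).trans (by
        have := norm_apply_le_norm_cfc (fun x : ℝ => x) (boundedInverse L) hμ
        rwa [cfc_id' ℝ (boundedInverse L)] at this)
      nlinarith [Real.sq_sqrt h0, sq_nonneg (√μ - 1), Real.sqrt_nonneg μ]) t
  refine this.congr_of_eventuallyEq (Eventually.of_forall fun s => ?_)
  simp only
  rw [cfc_mul (sineFun s) (fun μ => μ) _ (continuous_sineFun s).continuousOn continuousOn_id,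
    cfc_id' ℝ (boundedInverse L)]
  rfl

/-- On the spectrum of `L⁻¹`, which is nonnegative, `√μ ^ 2 = μ`. -/
theorem cosineOp_zero (hB : 0 ≤ boundedInverse L) : cosineOp L 0 = boundedInverse L := by
  have hsa : IsSelfAdjoint (boundedInverse L) := IsSelfAdjoint.of_nonneg hB
  conv_rhs => rw [← cfc_id' ℝ (boundedInverse L)]
  refine cfc_congr fun μ hμ => ?_
  simp [cosineFun, Real.sq_sqrt (spectrum_nonneg_of_nonneg hB hμ)]

/-- Duhamel's principle: with `Φ = L⁻¹ Ψ`, the function `S(t) (Φ'' + L Φ)(t)`, where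
`S(t) = L^(-1/2) sin (t L^(1/2))`, is the derivative of `S(t) Φ'(t) - cos (t L^(1/2)) Φ(t)`. -/
theorem integral_sineOp_duhamel (hB : 0 ≤ boundedInverse L) {Ψ Ψ₁ Ψ₂ : ℝ → H}
    (h1 : ∀ t, HasDerivAt Ψ (Ψ₁ t) t) (h2 : ∀ t, HasDerivAt Ψ₁ (Ψ₂ t) t) (hc : Continuous Ψ₂)
    (a b : ℝ) :
    ∫ t in a..b, sineOp L t (boundedInverse L (Ψ₂ t) + Ψ t) =
      (sineOp L b (boundedInverse L (Ψ₁ b)) - cosineOp L b (Ψ b)) -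
        (sineOp L a (boundedInverse L (Ψ₁ a)) - cosineOp L a (Ψ a)) := by
  have hΨ : Continuous Ψ := continuous_iff_continuousAt.2 fun t => (h1 t).continuousAt
  refine intervalIntegral.integral_eq_sub_of_hasDerivAt
    (f := fun t => sineOp L t (boundedInverse L (Ψ₁ t)) - cosineOp L t (Ψ t)) (fun t _ => ?_) ?_
  · have e1 := hasDerivAt_apply (hasDerivAt_sineOp_comp hB t) (h2 t)
    have e2 := hasDerivAt_apply (hasDerivAt_cosineOp L t) (h1 t)
    refine (e1.sub e2).congr_deriv ?_
    simp only [ContinuousLinearMap.comp_apply, neg_apply, map_add]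
    abel
  · refine Continuous.intervalIntegrable ?_ _ _
    exact (continuous_sineOp L).clm_apply (by fun_prop)

end Duhamel

/-! ### The Goursat problem in characteristic coordinates -/

section Goursat

/-- The directional derivative of a function on the plane. -/
def dirDeriv (v : ℝ × ℝ) (f : ℝ × ℝ → ℝ) (p : ℝ × ℝ) : ℝ := fderiv ℝ f p v

theorem ContDiff.dirDeriv {f : ℝ × ℝ → ℝ} (hf : ContDiff ℝ ∞ f) (v : ℝ × ℝ) :
    ContDiff ℝ ∞ (dirDeriv v f) :=
  (hf.fderiv_right (m := ∞) (by simp)).clm_apply contDiff_const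

theorem HasCompactSupport.dirDeriv {f : ℝ × ℝ → ℝ} (hf : HasCompactSupport f) (v : ℝ × ℝ) :
    HasCompactSupport (dirDeriv v f) :=
  hf.fderiv_apply ℝ v

theorem tsupport_dirDeriv_subset (f : ℝ × ℝ → ℝ) (v : ℝ × ℝ) :
    tsupport (dirDeriv v f) ⊆ tsupport f := tsupport_fderiv_apply_subset ℝ v

theorem _root_.Filter.EventuallyEq.dirDeriv {f g : ℝ × ℝ → ℝ} {p : ℝ × ℝ} (h : f =ᶠ[𝓝 p] g)
    (v : ℝ × ℝ) : dirDeriv v f =ᶠ[𝓝 p] dirDeriv v g :=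
  h.fderiv.mono fun x hx => by rw [WaveIsotony.dirDeriv, hx, WaveIsotony.dirDeriv]

/-- The mixed second derivative `∂₁ ∂₂`, that is, the wave operator in characteristic
coordinates. -/
def mixedDeriv (f : ℝ × ℝ → ℝ) : ℝ × ℝ → ℝ := dirDeriv (0, 1) (dirDeriv (1, 0) f)

/-- The indicator function of the quadrant `ξ ≤ 0`, `η ≤ 0`. -/
def quadrantKernel : ℝ × ℝ → ℝ := (Iic 0 ×ˢ Iic 0).indicator fun _ => 1

theorem locallyIntegrable_quadrantKernel : LocallyIntegrable quadrantKernel :=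
  (locallyIntegrable_const 1).indicator (measurableSet_Iic.prod measurableSet_Iic)

open scoped Convolution in
/-- The integral of `θ` over the quadrant `ξ ≥ p.1`, `η ≥ p.2` with the vertex `p`. It is written as
a convolution, so that the smoothness comes from the theory of convolutions. -/
def quadrantIntegral (θ : ℝ × ℝ → ℝ) : ℝ × ℝ → ℝ :=
  quadrantKernel ⋆[ContinuousLinearMap.lsmul ℝ ℝ] θ

theorem quadrantIntegral_eq (θ : ℝ × ℝ → ℝ) (p : ℝ × ℝ) :
    quadrantIntegral θ p = ∫ v in Iic (0 : ℝ) ×ˢ Iic (0 : ℝ), θ (p - v) := by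
  rw [quadrantIntegral, convolution_def,
    ← integral_indicator (measurableSet_Iic.prod measurableSet_Iic)]
  refine integral_congr_ae (Eventually.of_forall fun v => ?_)
  by_cases hv : v ∈ Iic (0 : ℝ) ×ˢ Iic (0 : ℝ)
  · simp only [quadrantKernel, indicator_of_mem hv, ContinuousLinearMap.lsmul_apply, one_smul]
  · simp only [quadrantKernel, indicator_of_notMem hv, ContinuousLinearMap.lsmul_apply, zero_smul]

theorem contDiff_quadrantIntegral {θ : ℝ × ℝ → ℝ} (hθ : ContDiff ℝ ∞ θ)
    (hc : HasCompactSupport θ) : ContDiff ℝ ∞ (quadrantIntegral θ) :=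
  hc.contDiff_convolution_right (n := ⊤) _ locallyIntegrable_quadrantKernel hθ

theorem dirDeriv_quadrantIntegral {θ : ℝ × ℝ → ℝ} (hθ : ContDiff ℝ ∞ θ)
    (hc : HasCompactSupport θ) (v : ℝ × ℝ) :
    dirDeriv v (quadrantIntegral θ) = quadrantIntegral (dirDeriv v θ) := by
  funext p
  have h := hc.hasFDerivAt_convolution_right (ContinuousLinearMap.lsmul ℝ ℝ)
    locallyIntegrable_quadrantKernel (hθ.of_le (by simp)) p
  rw [dirDeriv, quadrantIntegral, h.fderiv]
  exact convolution_precompR_apply _ locallyIntegrable_quadrantKernel (hc.fderiv ℝ)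
    (hθ.continuous_fderiv (by simp)) p v

theorem integral_Iic_dirDeriv {θ : ℝ × ℝ → ℝ} (hθ : ContDiff ℝ ∞ θ) (hc : HasCompactSupport θ)
    (p : ℝ × ℝ) {v : ℝ × ℝ} (hv : v ≠ 0) :
    ∫ b in Iic (0 : ℝ), dirDeriv v θ (p - b • v) = -θ p := by
  have h1 : ContDiff ℝ 1 fun b : ℝ => θ (p - b • v) := (hθ.of_le (by simp)).comp (by fun_prop)
  have h2 : HasCompactSupport fun b : ℝ => θ (p - b • v) := by
    refine hc.comp_isClosedEmbedding (g := fun b : ℝ => p - b • v) ?_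
    have h3 : Topology.IsClosedEmbedding fun b : ℝ => b • v :=
      isClosedEmbedding_smul_left hv
    exact ((Homeomorph.subLeft p).isClosedEmbedding).comp h3
  have h3 : ∀ b : ℝ, deriv (fun b : ℝ => θ (p - b • v)) b = -dirDeriv v θ (p - b • v) := fun b => by
    have e1 : HasDerivAt (fun b : ℝ => p - b • v) (-v) b := by
      simpa using ((hasDerivAt_id b).smul_const v).const_sub p
    have e2 := ((hθ.differentiable (by simp) (p - b • v)).hasFDerivAt).comp_hasDerivAt b e1
    rw [map_neg] at e2
    exact e2.deriv
  have h4 := HasCompactSupport.integral_Iic_deriv_eq h1 h2 0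
  simp only [h3, integral_neg, zero_smul, sub_zero] at h4
  linarith

/-- The quadrant integral inverts the mixed derivative. -/
theorem mixedDeriv_quadrantIntegral {θ : ℝ × ℝ → ℝ} (hθ : ContDiff ℝ ∞ θ)
    (hc : HasCompactSupport θ) : mixedDeriv (quadrantIntegral θ) = θ := by
  rw [mixedDeriv, dirDeriv_quadrantIntegral hθ hc, dirDeriv_quadrantIntegral
    (ContDiff.dirDeriv hθ _) (HasCompactSupport.dirDeriv hc _)]
  funext p
  have hθ1 := ContDiff.dirDeriv hθ (1, 0)
  have hc1 := HasCompactSupport.dirDeriv hc (1, 0)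
  have hθ2 := ContDiff.dirDeriv hθ1 (0, 1)
  have hc2 := HasCompactSupport.dirDeriv hc1 (0, 1)
  have hi : Integrable fun v : ℝ × ℝ => dirDeriv (0, 1) (dirDeriv (1, 0) θ) (p - v) :=
    (hθ2.continuous.integrable_of_hasCompactSupport hc2).comp_sub_left p
  rw [quadrantIntegral_eq, Measure.volume_eq_prod, setIntegral_prod _ hi.integrableOn]
  have e : ∀ a b : ℝ, p - (a, b) = (p - a • ((1, 0) : ℝ × ℝ)) - b • ((0, 1) : ℝ × ℝ) := fun a b => by
    ext <;> simp
  have e' : ∀ a : ℝ, ∫ b in Iic (0 : ℝ), dirDeriv (0, 1) (dirDeriv (1, 0) θ) (p - (a, b)) =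
      -dirDeriv (1, 0) θ (p - a • ((1, 0) : ℝ × ℝ)) := fun a =>
    (congrArg _ (funext fun b => congrArg _ (e a b))).trans
      (integral_Iic_dirDeriv hθ1 hc1 _ (show ((0, 1) : ℝ × ℝ) ≠ 0 by simp))
  rw [integral_congr_ae (Eventually.of_forall e'), integral_neg,
    integral_Iic_dirDeriv hθ hc _ (show ((1, 0) : ℝ × ℝ) ≠ 0 by simp), neg_neg]

theorem quadrantIntegral_eq_zero {θ : ℝ × ℝ → ℝ} {p : ℝ × ℝ}
    (h : ∀ p', p.1 ≤ p'.1 → p.2 ≤ p'.2 → θ p' = 0) : quadrantIntegral θ p = 0 := by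
  rw [quadrantIntegral_eq]
  refine setIntegral_eq_zero_of_forall_eq_zero fun v hv => h _ ?_ ?_
  · simpa using hv.1
  · simpa using hv.2

theorem abs_quadrantIntegral_le {θ : ℝ × ℝ → ℝ} {c lam : ℝ} (hl : 0 < lam)
    (h : ∀ p : ℝ × ℝ, 0 ≤ p.1 + p.2 → |θ p| ≤ c * Real.exp (-lam * (p.1 + p.2)))
    {p : ℝ × ℝ} (hp : 0 ≤ p.1 + p.2) :
    |quadrantIntegral θ p| ≤ c / lam ^ 2 * Real.exp (-lam * (p.1 + p.2)) := by
  have h1 : IntegrableOn (fun v : ℝ × ℝ => c * Real.exp (-lam * (p.1 + p.2)) *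
      (Real.exp (lam * v.1) * Real.exp (lam * v.2))) (Iic (0 : ℝ) ×ˢ Iic (0 : ℝ)) := by
    have h2 : IntegrableOn (fun v : ℝ × ℝ => Real.exp (lam * v.1) * Real.exp (lam * v.2))
        (Iic (0 : ℝ) ×ˢ Iic (0 : ℝ)) := by
      rw [IntegrableOn, Measure.volume_eq_prod, ← Measure.prod_restrict]
      exact (integrableOn_exp_mul_Iic hl 0).mul_prod (integrableOn_exp_mul_Iic hl 0)
    exact h2.const_mul _
  rw [quadrantIntegral_eq, ← Real.norm_eq_abs]
  refine (norm_integral_le_of_norm_le h1 ?_).trans_eq ?_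
  · refine (ae_restrict_iff' (measurableSet_Iic.prod measurableSet_Iic)).2
      (Eventually.of_forall fun v hv => ?_)
    have hv1 : v.1 ≤ 0 := hv.1
    have hv2 : v.2 ≤ 0 := hv.2
    refine (h (p - v) ?_).trans_eq ?_
    · simp only [Prod.fst_sub, Prod.snd_sub]
      linarith
    · rw [mul_assoc, ← Real.exp_add, ← Real.exp_add]
      congr 2
      simp only [Prod.fst_sub, Prod.snd_sub]
      ring
  · rw [integral_const_mul, Measure.volume_eq_prod, setIntegral_prod_mul
      (fun x : ℝ => Real.exp (lam * x)) (fun x : ℝ => Real.exp (lam * x)), integral_exp_mul_Iic hl]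
    simp only [mul_zero, Real.exp_zero]
    field_simp

/-- The trapezoid `-δ < ξ + η < S`, `ξ < R`, `η < R` in characteristic coordinates. -/
def trapezoid (δ S R : ℝ) : Set (ℝ × ℝ) := {p | -δ < p.1 + p.2 ∧ p.1 + p.2 < S ∧ p.1 < R ∧ p.2 < R}

/-- The continuous real functions whose support is a compact subset of `Ω`. -/
structure IsTest (Ω : Set (ℝ × ℝ)) (θ : ℝ × ℝ → ℝ) : Prop where
  continuous : Continuous θ
  hasCompactSupport : HasCompactSupport θ
  tsupport_subset : tsupport θ ⊆ Ω

theorem IsTest.sub {Ω : Set (ℝ × ℝ)} {θ θ' : ℝ × ℝ → ℝ} (h : IsTest Ω θ) (h' : IsTest Ω θ') :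
    IsTest Ω fun p => θ p - θ' p where
  continuous := h.continuous.sub h'.continuous
  hasCompactSupport := h.hasCompactSupport.sub h'.hasCompactSupport
  tsupport_subset := (tsupport_sub θ θ').trans (union_subset h.tsupport_subset h'.tsupport_subset)

theorem IsTest.mono {Ω Ω' : Set (ℝ × ℝ)} {θ : ℝ × ℝ → ℝ} (h : IsTest Ω θ) (hΩ : Ω ⊆ Ω') :
    IsTest Ω' θ := ⟨h.1, h.2, h.3.trans hΩ⟩

/-- A function with a test function `θ` as the source can be solved for in the trapezoid: the
quadrant integral of `θ`, cut off below the line `ξ + η = 0`, is again a test function. -/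
theorem exists_mixedDeriv_eq {δ S R : ℝ} (hδ : 0 < δ) {θ : ℝ × ℝ → ℝ}
    (h : IsTest (trapezoid δ S R) θ) (hθ : ContDiff ℝ ∞ θ) :
    ∃ Φ : ℝ × ℝ → ℝ, IsTest (trapezoid δ S R) Φ ∧ ContDiff ℝ ∞ Φ ∧
      (∀ p : ℝ × ℝ, 0 ≤ p.1 + p.2 → mixedDeriv Φ p = θ p) ∧
      ∀ p : ℝ × ℝ, 0 ≤ p.1 + p.2 → Φ p = quadrantIntegral θ p := by
  obtain ⟨S', R', hS', hR', hsupp⟩ : ∃ S' R', S' < S ∧ R' < R ∧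
      ∀ p ∈ tsupport θ, p.1 + p.2 ≤ S' ∧ p.1 ≤ R' ∧ p.2 ≤ R' := by
    have hK : IsCompact (tsupport θ) := h.hasCompactSupport
    rcases (tsupport θ).eq_empty_or_nonempty with he | hne
    · exact ⟨S - 1, R - 1, by linarith, by linarith, by simp [he]⟩
    · obtain ⟨a, ha, hamax⟩ := hK.exists_isMaxOn hne
        (f := fun p : ℝ × ℝ => p.1 + p.2) (by fun_prop)
      obtain ⟨b, hb, hbmax⟩ := hK.exists_isMaxOn hne
        (f := fun p : ℝ × ℝ => max p.1 p.2) (by fun_prop)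
      refine ⟨a.1 + a.2, max b.1 b.2, (h.tsupport_subset ha).2.1,
        max_lt (h.tsupport_subset hb).2.2.1 (h.tsupport_subset hb).2.2.2, fun p hp => ⟨hamax hp, ?_, ?_⟩⟩
      · exact (le_max_left _ _).trans (hbmax hp)
      · exact (le_max_right _ _).trans (hbmax hp)
  have hφ := contDiff_quadrantIntegral hθ h.hasCompactSupport
  have hχ : ContDiff ℝ ∞ fun p : ℝ × ℝ => Real.smoothTransition (3 * (p.1 + p.2) / δ + 2) :=
    (Real.smoothTransition.contDiff (n := ⊤)).comp (by fun_prop)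
  set χ : ℝ × ℝ → ℝ := fun p => Real.smoothTransition (3 * (p.1 + p.2) / δ + 2) with hχdef
  have hχ1 : ∀ p : ℝ × ℝ, -δ / 3 ≤ p.1 + p.2 → χ p = 1 := fun p hp => by
    refine Real.smoothTransition.one_of_one_le ?_
    have : -1 ≤ 3 * (p.1 + p.2) / δ := by
      rw [le_div_iff₀ hδ]
      linarith
    linarith
  set K : Set (ℝ × ℝ) := {p | -2 * δ / 3 ≤ p.1 + p.2 ∧ p.1 + p.2 ≤ S' ∧ p.1 ≤ R' ∧ p.2 ≤ R'} with hK
  have hKc : IsClosed K := by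
    have hs : Continuous fun p : ℝ × ℝ => p.1 + p.2 := by fun_prop
    exact (isClosed_le continuous_const hs).inter ((isClosed_le hs continuous_const).inter
      ((isClosed_le continuous_fst continuous_const).inter
        (isClosed_le continuous_snd continuous_const)))
  have hKcpt : IsCompact K := by
    refine (isCompact_Icc (a := (-2 * δ / 3 - R', -2 * δ / 3 - R')) (b := (R', R'))).of_isClosed_subset
      hKc fun p hp => ?_
    obtain ⟨h1, h2, h3, h4⟩ := hp
    exact ⟨⟨by simp only; linarith, by simp only; linarith⟩, ⟨h3, h4⟩⟩
  have hsub : Function.support (fun p => χ p * quadrantIntegral θ p) ⊆ K := by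
    intro p hp
    rw [Function.mem_support] at hp
    have h1 : -2 * δ / 3 ≤ p.1 + p.2 := by
      by_contra hlt
      refine hp (mul_eq_zero_of_left (Real.smoothTransition.zero_of_nonpos ?_) _)
      have : 3 * (p.1 + p.2) / δ ≤ -2 := by
        rw [div_le_iff₀ hδ]
        linarith
      linarith
    have h2 : ∃ p', p.1 ≤ p'.1 ∧ p.2 ≤ p'.2 ∧ θ p' ≠ 0 := by
      by_contra! hne
      exact hp (mul_eq_zero_of_right _ (quadrantIntegral_eq_zero hne))
    obtain ⟨p', e1, e2, e3⟩ := h2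
    obtain ⟨f1, f2, f3⟩ := hsupp p' (subset_tsupport _ e3)
    exact ⟨h1, by linarith, by linarith, by linarith⟩
  have hts : tsupport (fun p => χ p * quadrantIntegral θ p) ⊆ K := closure_minimal hsub hKc
  refine ⟨fun p => χ p * quadrantIntegral θ p, ⟨(hχ.mul hφ).continuous,
    HasCompactSupport.of_support_subset_isCompact hKcpt hsub, hts.trans fun p hp => ?_⟩,
    hχ.mul hφ, fun p hp => ?_, fun p hp => ?_⟩
  · obtain ⟨h1, h2, h3, h4⟩ := hp
    exact ⟨by linarith, by linarith, by linarith, by linarith⟩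
  · have hev : (fun p => χ p * quadrantIntegral θ p) =ᶠ[𝓝 p] quadrantIntegral θ := by
      have : ∀ᶠ p' : ℝ × ℝ in 𝓝 p, -δ / 3 < p'.1 + p'.2 :=
        (isOpen_lt continuous_const (by fun_prop)).mem_nhds (show -δ / 3 < p.1 + p.2 by linarith)
      filter_upwards [this] with p' hp'
      rw [hχ1 p' hp'.le, one_mul]
    have := ((hev.dirDeriv (1, 0)).dirDeriv (0, 1)).self_of_nhds
    rw [mixedDeriv, this]
    exact congr_fun (mixedDeriv_quadrantIntegral hθ h.hasCompactSupport) p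
  · simp only
    rw [hχ1 p (by linarith), one_mul]

/-- Uniqueness for the Goursat problem `∂₁ ∂₂ w = P w` in the trapezoid with zero data for
`ξ + η < 0`, for a functional `ℓ` (the pairing with `w`) on the test functions. -/
theorem eq_zero_of_weak_solution {δ S R M : ℝ} (hδ : 0 < δ)
    {P : ℝ × ℝ → ℝ} (hP : Continuous P) {ℓ : (ℝ × ℝ → ℝ) → ℂ}
    (hsub : ∀ θ θ', IsTest (trapezoid δ S R) θ → IsTest (trapezoid δ S R) θ' →
      ℓ (fun p => θ p - θ' p) = ℓ θ - ℓ θ')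
    (hbd : ∀ θ c, IsTest (trapezoid δ S R) θ → 0 ≤ c →
      (∀ p : ℝ × ℝ, 0 ≤ p.1 + p.2 → |θ p| ≤ c) → ‖ℓ θ‖ ≤ M * c)
    (hweak : ∀ Φ, IsTest (trapezoid δ S R) Φ → ContDiff ℝ ∞ Φ →
      ℓ (mixedDeriv Φ) = ℓ fun p => P p * Φ p)
    {θ : ℝ × ℝ → ℝ} (hθ : IsTest (trapezoid δ S R) θ) : ℓ θ = 0 := by
  obtain ⟨C, hC0, hC⟩ : ∃ C, 0 ≤ C ∧ ∀ p ∈ trapezoid δ S R, 0 ≤ p.1 + p.2 → |P p| ≤ C := by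
    obtain ⟨C, hC⟩ := (isCompact_Icc (a := (-R, -R)) (b := (R, R))).exists_bound_of_continuousOn
      hP.continuousOn
    refine ⟨|C|, abs_nonneg _, fun p ⟨_, _, h3, h4⟩ h0 => (hC p ?_).trans (le_abs_self _)⟩
    exact ⟨⟨by simp only; linarith, by simp only; linarith⟩, ⟨h3.le, h4.le⟩⟩
  -- The weight `exp (-lam * (ξ + η))` makes the solution operator a contraction.
  set lam : ℝ := √(2 * C + 1) with hlam
  have hlam0 : 0 < lam := Real.sqrt_pos.2 (by linarith)
  have hlam2 : lam ^ 2 = 2 * C + 1 := Real.sq_sqrt (by linarith)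
  have hexp : ∀ p ∈ trapezoid δ S R, Real.exp (-lam * (2 * R)) ≤ Real.exp (-lam * (p.1 + p.2)) := by
    rintro p ⟨_, _, h3, h4⟩
    rw [Real.exp_le_exp]
    nlinarith
  have hexp1 : Real.exp (lam * (2 * R)) * Real.exp (-lam * (2 * R)) = 1 := by
    rw [← Real.exp_add]
    simp
  have key : ∀ n : ℕ, ∀ θ c, IsTest (trapezoid δ S R) θ → 0 ≤ c →
      (∀ p : ℝ × ℝ, 0 ≤ p.1 + p.2 → |θ p| ≤ c * Real.exp (-lam * (p.1 + p.2))) →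
      ‖ℓ θ‖ ≤ M * (c / 2 ^ n) := by
    intro n
    induction n with
    | zero =>
      intro θ c hθ hc h
      rw [pow_zero, div_one]
      refine hbd θ c hθ hc fun p hp => (h p hp).trans ?_
      refine mul_le_of_le_one_right hc (Real.exp_le_one_iff.2 ?_)
      nlinarith
    | succ n ih =>
      intro θ c hθ hc h
      have hε : ∀ ε > 0, ‖ℓ θ‖ ≤ M * ε + M * ((c + ε * Real.exp (lam * (2 * R))) / 2 ^ (n + 1)) := by
        intro ε hε
        obtain ⟨θ', hθ's, hθ'd, hθ'supp⟩ := hθ.continuous.exists_contDiff_approx ⊤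
          (ε := fun _ => ε) continuous_const (fun _ => hε)
        have hθ' : IsTest (trapezoid δ S R) θ' := ⟨hθ's.continuous, hθ.hasCompactSupport.mono hθ'supp,
          (closure_mono hθ'supp).trans hθ.tsupport_subset⟩
        have hdist : ∀ p, |θ p - θ' p| ≤ ε := fun p => by
          rw [abs_sub_comm]
          exact (hθ'd p).le
        set c' := c + ε * Real.exp (lam * (2 * R)) with hc'
        have hc'0 : 0 ≤ c' := by positivity
        have hθ'b : ∀ p : ℝ × ℝ, 0 ≤ p.1 + p.2 → |θ' p| ≤ c' * Real.exp (-lam * (p.1 + p.2)) := by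
          intro p hp
          by_cases hpΩ : p ∈ trapezoid δ S R
          · have e1 : |θ' p| ≤ |θ p| + ε := by
              have := (abs_sub_abs_le_abs_sub (θ' p) (θ p)).trans (abs_sub_comm (θ' p) (θ p)).le
              linarith [hdist p]
            have e2 := mul_le_mul_of_nonneg_left (hexp p hpΩ)
              (mul_nonneg hε.le (Real.exp_nonneg (lam * (2 * R))))
            rw [mul_assoc, hexp1, mul_one] at e2
            rw [hc', add_mul]
            linarith [h p hp]
          · have : θ' p = 0 := image_eq_zero_of_notMem_tsupport fun hp' =>
              hpΩ (hθ'.tsupport_subset hp')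
            rw [this, abs_zero]
            positivity
        obtain ⟨Φ, hΦ, hΦs, hΦm, hΦq⟩ := exists_mixedDeriv_eq hδ hθ' hθ's
        have hPΦ : IsTest (trapezoid δ S R) fun p => P p * Φ p :=
          ⟨hP.mul hΦ.continuous, hΦ.hasCompactSupport.mul_left,
            (tsupport_mul_subset_right).trans hΦ.tsupport_subset⟩
        have hmΦ : IsTest (trapezoid δ S R) (mixedDeriv Φ) :=
          ⟨(ContDiff.dirDeriv (ContDiff.dirDeriv hΦs _) _).continuous,
            HasCompactSupport.dirDeriv (HasCompactSupport.dirDeriv hΦ.hasCompactSupport _) _,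
            (tsupport_dirDeriv_subset _ _).trans ((tsupport_dirDeriv_subset _ _).trans
              hΦ.tsupport_subset)⟩
        have s1 : ‖ℓ θ - ℓ θ'‖ ≤ M * ε := by
          rw [← hsub θ θ' hθ hθ']
          exact hbd _ ε (hθ.sub hθ') hε.le fun p _ => hdist p
        have s2 : ℓ θ' = ℓ (mixedDeriv Φ) := by
          have := hbd _ 0 (hθ'.sub hmΦ) le_rfl fun p hp => by rw [hΦm p hp, sub_self, abs_zero]
          rw [hsub _ _ hθ' hmΦ, mul_zero] at this
          exact sub_eq_zero.1 (norm_le_zero_iff.1 this)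
        have s3 : ‖ℓ fun p => P p * Φ p‖ ≤ M * (c' / 2 ^ (n + 1)) := by
          have := ih _ (c' / 2) hPΦ (by positivity) fun p hp => ?_
          · rwa [div_div, ← pow_succ'] at this
          · by_cases hpΩ : p ∈ trapezoid δ S R
            · have e1 := abs_quadrantIntegral_le hlam0 hθ'b hp
              rw [abs_mul, hΦq p hp]
              refine (mul_le_mul (hC p hpΩ hp) e1 (abs_nonneg _) hC0).trans ?_
              rw [← mul_assoc]
              refine mul_le_mul_of_nonneg_right ?_ (Real.exp_nonneg _)
              rw [hlam2, mul_div_assoc', div_le_div_iff₀ (by linarith) two_pos]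
              nlinarith
            · have : Φ p = 0 := image_eq_zero_of_notMem_tsupport fun hp' =>
                hpΩ (hΦ.tsupport_subset hp')
              rw [this, mul_zero, abs_zero]
              positivity
        calc ‖ℓ θ‖ = ‖(ℓ θ - ℓ θ') + ℓ fun p => P p * Φ p‖ := by
              rw [← hweak Φ hΦ hΦs, ← s2, sub_add_cancel]
          _ ≤ _ := (norm_add_le _ _).trans (add_le_add s1 s3)
      have hlim : Tendsto (fun ε : ℝ => M * ε + M * ((c + ε * Real.exp (lam * (2 * R))) / 2 ^ (n + 1)))
          (𝓝[>] 0) (𝓝 (M * 0 + M * ((c + 0 * Real.exp (lam * (2 * R))) / 2 ^ (n + 1)))) :=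
        Continuous.tendsto' (by fun_prop) _ _ rfl |>.mono_left nhdsWithin_le_nhds
      have := ge_of_tendsto hlim (eventually_mem_nhdsWithin.mono hε)
      simpa using this
  obtain ⟨C₀, hC₀⟩ := hθ.continuous.bounded_above_of_compact_support hθ.hasCompactSupport
  have hC₀0 : 0 ≤ C₀ := (norm_nonneg _).trans (hC₀ 0)
  have hb : ∀ p : ℝ × ℝ, 0 ≤ p.1 + p.2 →
      |θ p| ≤ C₀ * Real.exp (lam * (2 * R)) * Real.exp (-lam * (p.1 + p.2)) := fun p _ => by
    by_cases hpΩ : p ∈ trapezoid δ S R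
    · refine (hC₀ p).trans ?_
      have := mul_le_mul_of_nonneg_left (hexp p hpΩ)
        (mul_nonneg hC₀0 (Real.exp_nonneg (lam * (2 * R))))
      rwa [mul_assoc C₀, hexp1, mul_one] at this
    · have : θ p = 0 := image_eq_zero_of_notMem_tsupport fun hp' => hpΩ (hθ.tsupport_subset hp')
      rw [this, abs_zero]
      positivity
  have hlim : Tendsto (fun n : ℕ => M * (C₀ * Real.exp (lam * (2 * R)) / 2 ^ n)) atTop (𝓝 (M * 0)) :=
    ((tendsto_const_nhds.div_atTop (tendsto_pow_atTop_atTop_of_one_lt one_lt_two)).const_mul M)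
  have := ge_of_tendsto' hlim fun n => key n θ _ hθ (by positivity) hb
  rw [mul_zero] at this
  exact norm_le_zero_iff.1 this

end Goursat

/-! ### Real functions as elements of `L₂(0, ∞)` -/

section RealFunctions

open Classical in
/-- The element of `L₂(0, ∞)` given by a real function (and `0` if it is not square integrable). -/
def toL2 (h : ℝ → ℝ) : L2HalfLine :=
  if hh : MemLp (fun x => (h x : ℂ)) 2 halfLine then hh.toLp else 0

theorem memLp_ofReal {h : ℝ → ℝ} (hc : Continuous h) (hs : HasCompactSupport h) :
    MemLp (fun x => (h x : ℂ)) 2 halfLine :=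
  ((Complex.continuous_ofReal.comp hc).memLp_of_hasCompactSupport
    (hs.comp_left Complex.ofReal_zero)).restrict _

theorem coeFn_toL2 {h : ℝ → ℝ} (hc : Continuous h) (hs : HasCompactSupport h) :
    toL2 h =ᵐ[halfLine] fun x => (h x : ℂ) := by
  rw [toL2, dif_pos (memLp_ofReal hc hs)]
  exact MemLp.coeFn_toLp _

theorem toL2_sub {h k : ℝ → ℝ} (hc : Continuous h) (hs : HasCompactSupport h)
    (kc : Continuous k) (ks : HasCompactSupport k) :
    toL2 (fun x => h x - k x) = toL2 h - toL2 k := by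
  apply Lp.ext
  filter_upwards [coeFn_toL2 (h := fun x => h x - k x) (hc.sub kc) (hs.sub ks),
    coeFn_toL2 hc hs, coeFn_toL2 kc ks,
    Lp.coeFn_sub (toL2 h) (toL2 k)] with x h1 h2 h3 h4
  rw [h1, h4, Pi.sub_apply, h2, h3, Complex.ofReal_sub]

theorem toL2_add {h k : ℝ → ℝ} (hc : Continuous h) (hs : HasCompactSupport h)
    (kc : Continuous k) (ks : HasCompactSupport k) :
    toL2 (fun x => h x + k x) = toL2 h + toL2 k := by
  apply Lp.ext
  filter_upwards [coeFn_toL2 (h := fun x => h x + k x) (hc.add kc) (hs.add ks),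
    coeFn_toL2 hc hs, coeFn_toL2 kc ks,
    Lp.coeFn_add (toL2 h) (toL2 k)] with x h1 h2 h3 h4
  rw [h1, h4, Pi.add_apply, h2, h3, Complex.ofReal_add]

theorem toL2_smul {h : ℝ → ℝ} (hc : Continuous h) (hs : HasCompactSupport h) (c : ℝ) :
    toL2 (fun x => c * h x) = c • toL2 h := by
  apply Lp.ext
  filter_upwards [coeFn_toL2 (h := fun x => c * h x) (continuous_const.mul hc)
    (hs.mul_left (f := fun _ => c)),
    coeFn_toL2 hc hs, Lp.coeFn_smul c (toL2 h)] with x h1 h2 h4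
  rw [h1, h4, Pi.smul_apply, h2, Complex.ofReal_mul, Complex.real_smul]

theorem inner_toL2_right {h : ℝ → ℝ} (hc : Continuous h) (hs : HasCompactSupport h)
    (y : L2HalfLine) :
    inner ℂ y (toL2 h) = ∫ x in Ioi (0 : ℝ), (h x : ℂ) * (starRingEnd ℂ) (y x) := by
  rw [L2.inner_def]
  refine integral_congr_ae ?_
  filter_upwards [coeFn_toL2 hc hs] with x hx
  rw [hx]
  rfl

theorem inner_toL2_left {h : ℝ → ℝ} (hc : Continuous h) (hs : HasCompactSupport h)
    (y : L2HalfLine) :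
    inner ℂ (toL2 h) y = ∫ x in Ioi (0 : ℝ), (h x : ℂ) * y x := by
  rw [L2.inner_def]
  refine integral_congr_ae ?_
  filter_upwards [coeFn_toL2 hc hs] with x hx
  rw [hx]
  simp [mul_comm]

theorem norm_toL2_le {h : ℝ → ℝ} (hc : Continuous h) (hs : HasCompactSupport h) {X c : ℝ}
    (hX : 0 ≤ X) (hc0 : 0 ≤ c) (hX0 : ∀ x, X < x → h x = 0) (hb : ∀ x, 0 < x → |h x| ≤ c) :
    ‖toL2 h‖ ≤ √X * c := by
  have h1 : ‖toL2 h‖ ^ 2 ≤ X * c ^ 2 := by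
    have e : ((‖toL2 h‖ ^ 2 : ℝ) : ℂ) = ((∫ x in Ioi (0 : ℝ), h x * h x : ℝ) : ℂ) := by
      have e1 := inner_self_eq_norm_sq_to_K (𝕜 := ℂ) (toL2 h)
      rw [inner_toL2_left hc hs] at e1
      rw [← integral_complex_ofReal]
      push_cast
      refine e1.symm.trans (integral_congr_ae ?_)
      filter_upwards [coeFn_toL2 hc hs] with x hx
      rw [hx]
    rw [Complex.ofReal_inj.1 e]
    have hi : Integrable (fun x => h x * h x) (volume.restrict (Ioi 0)) :=
      ((hc.mul hc).integrable_of_hasCompactSupport hs.mul_left).integrableOn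
    calc ∫ x in Ioi (0 : ℝ), h x * h x
        ≤ ∫ x in Ioi (0 : ℝ), (Ioc 0 X).indicator (fun _ => c ^ 2) x := by
          refine setIntegral_mono_on hi ?_ measurableSet_Ioi fun x hx => ?_
          · exact ((integrable_indicator_iff measurableSet_Ioc).2 (by simp)).integrableOn
          · rcases le_or_gt x X with hxX | hxX
            · rw [indicator_of_mem (show x ∈ Ioc 0 X from ⟨hx, hxX⟩), ← abs_mul_abs_self, ← pow_two]
              exact pow_le_pow_left₀ (abs_nonneg _) (hb x hx) 2
            · rw [hX0 x hxX, mul_zero]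
              exact indicator_nonneg (fun _ _ => sq_nonneg c) x
      _ = X * c ^ 2 := by
          rw [setIntegral_indicator measurableSet_Ioc,
            inter_eq_self_of_subset_right Ioc_subset_Ioi_self, setIntegral_const]
          simp [hX]
  refine le_of_sq_le_sq ?_ (by positivity)
  rwa [mul_pow, Real.sq_sqrt hX]

/-- Functions that pair to zero with all the smooth functions with compact support in an open
set `U` vanish almost everywhere in `U`. -/
theorem ae_eq_zero_of_inner_toL2 {U : Set ℝ} (hU : IsOpen U) {y : L2HalfLine}
    (h : ∀ φ : ℝ → ℝ, ContDiff ℝ ∞ φ → HasCompactSupport φ → tsupport φ ⊆ U →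
      inner ℂ (toL2 φ) y = 0) : ∀ᵐ x ∂halfLine, x ∈ U → y x = 0 := by
  refine hU.ae_eq_zero_of_integral_contDiff_smul_eq_zero ?_ fun g g1 g2 g3 => ?_
  · exact ((Lp.memLp y).locallyIntegrable one_le_two).locallyIntegrableOn _
  · have := h g g1 g2 g3
    rw [inner_toL2_left g1.continuous g2] at this
    simpa only [Complex.real_smul] using this

/-- The odd part (doubled) `x ↦ θ(t, x) - θ(t, -x)` of the restriction of a function of `(t, x)`
to the time `t`. -/
def oddSlice (θ : ℝ × ℝ → ℝ) (t x : ℝ) : ℝ := θ (t, x) - θ (t, -x)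

/-- The odd part (doubled) of the restriction of a function to the time `t`, as an element of
`L₂(0, ∞)`. It satisfies the Dirichlet condition at the origin, whatever the support of `θ`. -/
def slice (θ : ℝ × ℝ → ℝ) (t : ℝ) : L2HalfLine := toL2 (oddSlice θ t)

variable {θ θ₁ : ℝ × ℝ → ℝ}

theorem exists_eq_zero_of_lt_abs (hs : HasCompactSupport θ) :
    ∃ X : ℝ, 0 ≤ X ∧ ∀ t x, X < |x| → θ (t, x) = 0 := by
  obtain ⟨X, hX⟩ := hs.isCompact.isBounded.subset_closedBall 0
  refine ⟨max X 0, le_max_right _ _, fun t x hx => ?_⟩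
  by_contra hne
  have h1 := hX (subset_tsupport θ hne)
  rw [mem_closedBall_zero_iff] at h1
  have h2 : |x| ≤ ‖((t, x) : ℝ × ℝ)‖ := norm_snd_le ((t, x) : ℝ × ℝ)
  linarith [le_max_left X 0]

theorem continuous_oddSlice (hc : Continuous θ) (t : ℝ) : Continuous (oddSlice θ t) := by
  unfold oddSlice
  fun_prop

theorem hasCompactSupport_oddSlice (hs : HasCompactSupport θ) (t : ℝ) :
    HasCompactSupport (oddSlice θ t) := by
  obtain ⟨X, hX0, hX⟩ := exists_eq_zero_of_lt_abs hs
  refine HasCompactSupport.of_support_subset_isCompact (isCompact_Icc (a := -X) (b := X)) fun x hx => ?_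
  by_contra hx'
  rw [mem_Icc, ← abs_le, not_le] at hx'
  exact hx (by rw [oddSlice, hX t x hx', hX t (-x) (by rwa [abs_neg]), sub_zero])

theorem slice_sub (hc : Continuous θ) (hs : HasCompactSupport θ) (hc₁ : Continuous θ₁)
    (hs₁ : HasCompactSupport θ₁) (t : ℝ) :
    slice (fun p => θ p - θ₁ p) t = slice θ t - slice θ₁ t := by
  rw [slice, slice, slice, ← toL2_sub (continuous_oddSlice hc t) (hasCompactSupport_oddSlice hs t)
    (continuous_oddSlice hc₁ t) (hasCompactSupport_oddSlice hs₁ t)]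
  congr 1
  funext x
  simp only [oddSlice]
  ring

theorem slice_add (hc : Continuous θ) (hs : HasCompactSupport θ) (hc₁ : Continuous θ₁)
    (hs₁ : HasCompactSupport θ₁) (t : ℝ) :
    slice (fun p => θ p + θ₁ p) t = slice θ t + slice θ₁ t := by
  rw [slice, slice, slice, ← toL2_add (continuous_oddSlice hc t) (hasCompactSupport_oddSlice hs t)
    (continuous_oddSlice hc₁ t) (hasCompactSupport_oddSlice hs₁ t)]
  congr 1
  funext x
  simp only [oddSlice]
  ring

theorem norm_slice_le (hc : Continuous θ) (hs : HasCompactSupport θ) {X : ℝ} (hX : 0 ≤ X)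
    (hX0 : ∀ t x, X < |x| → θ (t, x) = 0) {t c : ℝ} (hc0 : 0 ≤ c)
    (hb : ∀ x, |θ (t, x)| ≤ c) : ‖slice θ t‖ ≤ √X * (2 * c) := by
  refine norm_toL2_le (continuous_oddSlice hc t) (hasCompactSupport_oddSlice hs t) hX
    (by positivity) (fun x hx => ?_) fun x _ => ?_
  · have : X < |x| := hx.trans_le (le_abs_self x)
    rw [oddSlice, hX0 t x this, hX0 t (-x) (by rwa [abs_neg]), sub_zero]
  · exact (abs_sub _ _).trans (by linarith [hb x, hb (-x)])

theorem continuous_slice (hc : Continuous θ) (hs : HasCompactSupport θ) :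
    Continuous (slice θ) := by
  obtain ⟨X, hX0, hX⟩ := exists_eq_zero_of_lt_abs hs
  have hu := Metric.uniformContinuous_iff.1 (hs.uniformContinuous_of_continuous hc)
  refine Metric.continuous_iff.2 fun t ε hε => ?_
  obtain ⟨δ, hδ, h⟩ := hu (ε / (2 * (√X + 1))) (by positivity)
  refine ⟨δ, hδ, fun r hr => ?_⟩
  set τ : ℝ × ℝ → ℝ := fun p => θ (p.1 + (r - t), p.2) with hτ
  have hτc : Continuous τ := by fun_prop
  have hτs : HasCompactSupport τ := by
    have : τ = θ ∘ Homeomorph.addRight ((r - t, 0) : ℝ × ℝ) := by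
      funext p
      simp only [hτ, Function.comp_apply, Homeomorph.coe_addRight]
      congr 1
      ext <;> simp
    rw [this]
    exact hs.comp_homeomorph _
  have e : slice θ r = slice τ t := by
    simp only [slice, hτ]
    congr 1
    funext x
    simp [oddSlice]
  rw [dist_eq_norm, e, ← slice_sub hτc hτs hc hs]
  refine (norm_slice_le (θ := fun p => τ p - θ p) (hτc.sub hc) (hτs.sub hs) hX0 (fun s x hx => ?_)
    (c := ε / (2 * (√X + 1))) (by positivity) fun x => ?_).trans_lt ?_
  · simp only [hτ]
    rw [hX _ _ hx, hX _ _ hx, sub_zero]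
  · have := @h (t + (r - t), x) (t, x) (by
      rw [Prod.dist_eq]
      simpa [hδ] using hr)
    exact this.le
  · rw [show √X * (2 * (ε / (2 * (√X + 1)))) = ε * (√X / (√X + 1)) by field_simp]
    refine mul_lt_of_lt_one_right hε ?_
    rw [div_lt_one (by positivity)]
    linarith

theorem slice_smul (hc : Continuous θ) (hs : HasCompactSupport θ) (t c : ℝ) :
    slice (fun p => c * θ p) t = c • slice θ t := by
  rw [slice, slice, ← toL2_smul (continuous_oddSlice hc t) (hasCompactSupport_oddSlice hs t)]
  congr 1
  funext x
  simp only [oddSlice]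
  ring

/-- The pointwise derivative in `t` is also the derivative in `L₂(0, ∞)`. -/
theorem hasDerivAt_slice (hc : Continuous θ) (hs : HasCompactSupport θ) (hc₁ : Continuous θ₁)
    (hs₁ : HasCompactSupport θ₁) (h : ∀ t x, HasDerivAt (fun t => θ (t, x)) (θ₁ (t, x)) t) (t : ℝ) :
    HasDerivAt (slice θ) (slice θ₁ t) t := by
  obtain ⟨X, hX0, hX⟩ := exists_eq_zero_of_lt_abs hs
  obtain ⟨X₁, hX₁0, hX₁⟩ := exists_eq_zero_of_lt_abs hs₁
  set Y := max X X₁ with hY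
  have hY0 : 0 ≤ Y := hX0.trans (le_max_left _ _)
  have hu := Metric.uniformContinuous_iff.1 (hs₁.uniformContinuous_of_continuous hc₁)
  rw [hasDerivAt_iff_isLittleO_nhds_zero, Asymptotics.isLittleO_iff]
  intro ε hε
  obtain ⟨δ, hδ, hu⟩ := hu (ε / (2 * (√Y + 1))) (by positivity)
  filter_upwards [Metric.ball_mem_nhds (0 : ℝ) hδ] with r hr
  rw [mem_ball_zero_iff, Real.norm_eq_abs] at hr
  set τ : ℝ × ℝ → ℝ := fun p => θ (p.1 + r, p.2) with hτ
  have hτc : Continuous τ := by fun_prop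
  have hτs : HasCompactSupport τ := by
    have : τ = θ ∘ Homeomorph.addRight ((r, 0) : ℝ × ℝ) := by
      funext p
      simp only [hτ, Function.comp_apply, Homeomorph.coe_addRight]
      congr 1
      ext <;> simp
    rw [this]
    exact hs.comp_homeomorph _
  have e : slice θ (t + r) = slice τ t := by
    simp only [slice, hτ]
    congr 1
  have hrc : Continuous fun p => r * θ₁ p := continuous_const.mul hc₁
  have hrs : HasCompactSupport fun p => r * θ₁ p := hs₁.mul_left
  have hdc : Continuous fun p => τ p - θ p := hτc.sub hc
  have hds : HasCompactSupport fun p => τ p - θ p := hτs.sub hs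
  rw [e, ← slice_smul hc₁ hs₁, ← slice_sub hτc hτs hc hs,
    ← slice_sub hdc hds hrc hrs]
  refine (norm_slice_le (θ := fun p => τ p - θ p - r * θ₁ p) (hdc.sub hrc) (hds.sub hrs) hY0
    (fun s x hx => ?_) (c := ε / (2 * (√Y + 1)) * |r|) (by positivity) fun x => ?_).trans ?_
  · simp only [hτ]
    rw [hX _ _ ((le_max_left _ _).trans_lt hx), hX _ _ ((le_max_left _ _).trans_lt hx),
      hX₁ _ _ ((le_max_right _ _).trans_lt hx)]
    simp
  · have hd : ∀ s ∈ uIcc 0 r, HasDerivWithinAt (fun s => θ (t + s, x) - s * θ₁ (t, x))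
        (θ₁ (t + s, x) - θ₁ (t, x)) (uIcc 0 r) s := fun s _ => by
      have h1 := ((h (t + s) x).comp_const_add t s).fun_sub
        ((hasDerivAt_id' s).mul_const (θ₁ (t, x)))
      rw [one_mul] at h1
      exact h1.hasDerivWithinAt
    have hb : ∀ s ∈ uIcc 0 r, ‖θ₁ (t + s, x) - θ₁ (t, x)‖ ≤ ε / (2 * (√Y + 1)) := fun s hsr => by
      have hs' : |s| ≤ |r| := by simpa using abs_sub_left_of_mem_uIcc hsr
      have := @hu (t + s, x) (t, x) (by
        rw [Prod.dist_eq]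
        simpa [hδ, Real.dist_eq] using hs'.trans_lt hr)
      exact this.le
    have := (convex_uIcc 0 r).norm_image_sub_le_of_norm_hasDerivWithin_le hd hb left_mem_uIcc
      right_mem_uIcc
    rw [Real.norm_eq_abs, Real.norm_eq_abs, sub_zero] at this
    refine le_of_eq_of_le ?_ this
    congr 1
    simp only [hτ]
    simp
    ring
  · rw [Real.norm_eq_abs, show √Y * (2 * (ε / (2 * (√Y + 1)) * |r|)) = (√Y / (√Y + 1)) * (ε * |r|) by
      field_simp]
    refine mul_le_of_le_one_left (by positivity) ?_
    rw [div_le_one (by positivity)]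
    linarith

end RealFunctions

/-! ### Smooth functions in the domain of the Friedrichs extension -/

section MinimalOperator

/-- The differential expression `-φ'' + q φ`, with `q` extended evenly to the real line. -/
def sturmLiouville (q φ : ℝ → ℝ) (x : ℝ) : ℝ := -deriv (deriv φ) x + q |x| * φ x

variable {q : ℝ → ℝ}

theorem continuous_evenExtension (hq : ContinuousOn q (Ici 0)) : Continuous fun x : ℝ => q |x| :=
  hq.comp_continuous continuous_abs fun x => abs_nonneg x

theorem contDiff_deriv {φ : ℝ → ℝ} (hφ : ContDiff ℝ ∞ φ) : ContDiff ℝ ∞ (deriv φ) :=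
  (contDiff_infty_iff_deriv.1 hφ).2

theorem hasDerivAt_of_contDiff {φ : ℝ → ℝ} (hφ : ContDiff ℝ ∞ φ) (x : ℝ) :
    HasDerivAt φ (deriv φ x) x :=
  (hφ.differentiable (by simp) x).hasDerivAt

theorem continuous_sturmLiouville (hq : ContinuousOn q (Ici 0)) {φ : ℝ → ℝ} (hφ : ContDiff ℝ ∞ φ) :
    Continuous (sturmLiouville q φ) :=
  (contDiff_deriv (contDiff_deriv hφ)).continuous.neg.add
    ((continuous_evenExtension hq).mul hφ.continuous)

theorem hasCompactSupport_sturmLiouville (q : ℝ → ℝ) {φ : ℝ → ℝ} (hs : HasCompactSupport φ) :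
    HasCompactSupport (sturmLiouville q φ) :=
  hs.deriv.deriv.neg.add hs.mul_left

theorem isH2Loc_ofReal {φ : ℝ → ℝ} (hφ : ContDiff ℝ ∞ φ) :
    IsH2Loc (fun x => (φ x : ℂ)) (fun x => ((deriv φ x : ℝ) : ℂ))
      (fun x => ((deriv (deriv φ) x : ℝ) : ℂ)) where
  memLp R := by
    have hc : Continuous fun x => ((deriv (deriv φ) x : ℝ) : ℂ) :=
      Complex.continuous_ofReal.comp (contDiff_deriv (contDiff_deriv hφ)).continuous
    obtain ⟨C, hC⟩ := (isCompact_Icc (a := (0 : ℝ)) (b := R)).exists_bound_of_continuousOn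
      hc.continuousOn
    exact MemLp.of_bound hc.aestronglyMeasurable C
      (ae_restrict_of_forall_mem measurableSet_Ioc fun x hx => hC x (Ioc_subset_Icc_self hx))
  eq_integral x _ := by
    rw [intervalIntegral.integral_ofReal, intervalIntegral.integral_deriv_eq_sub
      (fun y _ => (hasDerivAt_of_contDiff hφ y).differentiableAt)
      ((contDiff_deriv hφ).continuous.intervalIntegrable _ _)]
    push_cast
    ring
  deriv_eq_integral x _ := by
    rw [intervalIntegral.integral_ofReal, intervalIntegral.integral_deriv_eq_sub
      (fun y _ => (hasDerivAt_of_contDiff (contDiff_deriv hφ) y).differentiableAt)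
      ((contDiff_deriv (contDiff_deriv hφ)).continuous.intervalIntegrable _ _)]
    push_cast
    ring

theorem toL2_mem_minimalGraph (hq : ContinuousOn q (Ici 0)) {φ : ℝ → ℝ} (hφ : ContDiff ℝ ∞ φ)
    (hs : HasCompactSupport φ) (h0 : φ 0 = 0) (h1 : deriv φ 0 = 0) :
    (toL2 φ, toL2 (sturmLiouville q φ)) ∈ minimalGraph q := by
  refine ⟨_, _, _, isH2Loc_ofReal hφ, by simp [h0], by simp [h1], coeFn_toL2 hφ.continuous hs, ?_⟩
  filter_upwards [coeFn_toL2 (continuous_sturmLiouville hq hφ) (hasCompactSupport_sturmLiouville q hs),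
    ae_restrict_mem measurableSet_Ioi] with x hx hx0
  rw [hx, sturmLiouville, abs_of_pos hx0]
  push_cast
  ring

theorem exists_domain_eq_toL2 (hq : ContinuousOn q (Ici 0)) {φ : ℝ → ℝ} (hφ : ContDiff ℝ ∞ φ)
    (hs : HasCompactSupport φ) (h0 : φ 0 = 0) (h1 : deriv φ 0 = 0) :
    ∃ y : (minimalOperator q).domain, (y : L2HalfLine) = toL2 φ ∧
      minimalOperator q y = toL2 (sturmLiouville q φ) := by
  have := toL2_mem_minimalGraph hq hφ hs h0 h1
  rwa [← graph_minimalOperator, LinearPMap.mem_graph_iff] at this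

theorem dense_domain_minimalOperator (hq : ContinuousOn q (Ici 0)) :
    Dense ((minimalOperator q).domain : Set L2HalfLine) := by
  rw [Submodule.dense_iff_topologicalClosure_eq_top, Submodule.topologicalClosure_eq_top_iff,
    Submodule.eq_bot_iff]
  intro y hy
  rw [Lp.eq_zero_iff_ae_eq_zero]
  have := ae_eq_zero_of_inner_toL2 (isOpen_Ioi (a := (0 : ℝ))) (y := y) fun φ hφ hs hsupp => ?_
  · filter_upwards [this, ae_restrict_mem measurableSet_Ioi] with x h1 h2 using h1 h2
  · have hz : ∀ᶠ x in 𝓝 (0 : ℝ), φ x = 0 := by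
      have : (tsupport φ)ᶜ ∈ 𝓝 (0 : ℝ) := (isClosed_tsupport φ).isOpen_compl.mem_nhds fun h0 =>
        lt_irrefl (0 : ℝ) (hsupp h0)
      filter_upwards [this] with x hx using image_eq_zero_of_notMem_tsupport hx
    have h1 : deriv φ 0 = 0 := by
      have : φ =ᶠ[𝓝 0] fun _ => 0 := hz
      rw [this.deriv_eq, deriv_const]
    obtain ⟨z, hz1, -⟩ := exists_domain_eq_toL2 hq hφ hs hz.self_of_nhds h1
    rw [← hz1]
    exact (Submodule.mem_orthogonal _ _).1 hy _ z.2

/-- Integration by parts, where one of the factors is only absolutely continuous. -/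
theorem integral_mul_of_primitive {φ φ' : ℝ → ℝ} (hφ : ∀ x, HasDerivAt φ (φ' x) x)
    (hc : Continuous φ') {X : ℝ} (hX : 0 ≤ X) (hφX : φ X = 0) {g G : ℝ → ℂ}
    (hg : IntervalIntegrable g volume 0 X) (hG : ∀ x, 0 ≤ x → G x = ∫ s in (0 : ℝ)..x, g s) :
    ∫ x in (0 : ℝ)..X, (φ x : ℂ) * g x = -∫ x in (0 : ℝ)..X, (φ' x : ℂ) * G x := by
  set μ : Measure ℝ := volume.restrict (Ioc 0 X) with hμ
  have hg' : Integrable g μ := (intervalIntegrable_iff_integrableOn_Ioc_of_le hX).1 hg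
  have hcc : Continuous fun x => (φ' x : ℂ) := Complex.continuous_ofReal.comp hc
  have hφ'i : Integrable (fun x => (φ' x : ℂ)) μ :=
    (intervalIntegrable_iff_integrableOn_Ioc_of_le hX).1 (hcc.intervalIntegrable _ _)
  set D : Set (ℝ × ℝ) := {p | p.1 ≤ p.2} with hD
  have hDm : MeasurableSet D := measurableSet_le measurable_fst measurable_snd
  have hF : Integrable (Function.uncurry fun x s => D.indicator (fun p => g p.1 * (φ' p.2 : ℂ)) (x, s))
      (μ.prod μ) := (hg'.mul_prod hφ'i).indicator hDm
  have hswap := integral_integral_swap hF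
  have e1 : ∀ x ∈ Ioc 0 X, ∫ s, D.indicator (fun p => g p.1 * (φ' p.2 : ℂ)) (x, s) ∂μ =
      -((φ x : ℂ) * g x) := fun x hx => by
    have : (fun s => D.indicator (fun p => g p.1 * (φ' p.2 : ℂ)) (x, s)) =
        (Ici x).indicator fun s => g x * (φ' s : ℂ) := by
      funext s
      by_cases h : x ≤ s <;> simp [D, indicator, h]
    rw [this, integral_indicator measurableSet_Ici, hμ, Measure.restrict_restrict measurableSet_Ici,
      integral_const_mul]
    have hset : Ici x ∩ Ioc 0 X = Icc x X := by
      ext s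
      simp only [mem_inter_iff, mem_Ici, mem_Ioc, mem_Icc]
      exact ⟨fun h => ⟨h.1, h.2.2⟩, fun h => ⟨h.1, hx.1.trans_le h.1, h.2⟩⟩
    rw [hset, integral_Icc_eq_integral_Ioc, ← intervalIntegral.integral_of_le hx.2,
      intervalIntegral.integral_ofReal, intervalIntegral.integral_eq_sub_of_hasDerivAt
        (fun y _ => hφ y) (hc.intervalIntegrable _ _), hφX]
    push_cast
    ring
  have e2 : ∀ s ∈ Ioc 0 X, ∫ x, D.indicator (fun p => g p.1 * (φ' p.2 : ℂ)) (x, s) ∂μ =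
      (φ' s : ℂ) * G s := fun s hs => by
    have : (fun x => D.indicator (fun p => g p.1 * (φ' p.2 : ℂ)) (x, s)) =
        (Iic s).indicator fun x => g x * (φ' s : ℂ) := by
      funext x
      by_cases h : x ≤ s <;> simp [D, indicator, h]
    have hset : Iic s ∩ Ioc 0 X = Ioc 0 s := by
      ext x
      simp only [mem_inter_iff, mem_Iic, mem_Ioc]
      exact ⟨fun h => ⟨h.2.1, h.1⟩, fun h => ⟨h.2, h.1, h.2.trans hs.2⟩⟩
    rw [this, integral_indicator measurableSet_Iic, hμ, Measure.restrict_restrict measurableSet_Iic,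
      integral_mul_const, hset, hG s hs.1.le, intervalIntegral.integral_of_le hs.1.le, mul_comm]
  rw [intervalIntegral.integral_of_le hX, intervalIntegral.integral_of_le hX,
    ← setIntegral_congr_fun measurableSet_Ioc e2, ← hswap, setIntegral_congr_fun measurableSet_Ioc e1,
    integral_neg, neg_neg]

/-- The functions with compact support that vanish at the origin satisfy the identity which defines
the adjoint of the minimal operator. -/
theorem inner_sturmLiouville_left (hq : ContinuousOn q (Ici 0)) {φ : ℝ → ℝ} (hφ : ContDiff ℝ ∞ φ)
    (hs : HasCompactSupport φ) (y : (minimalOperator q).domain) :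
    inner ℂ (toL2 (sturmLiouville q φ)) (y : L2HalfLine) =
      inner ℂ (toL2 φ) (minimalOperator q y) := by
  have hmem := (minimalOperator q).mem_graph y
  rw [graph_minimalOperator] at hmem
  obtain ⟨u, u₁, u₂, hu, hu0, hu10, hy, hz⟩ := hmem
  obtain ⟨X₀, hX₀⟩ := hs.isCompact.isBounded.subset_closedBall 0
  set X := max X₀ 0 + 1 with hXdef
  have hX : 0 ≤ X := by positivity
  have hφ0 : ∀ x, X ≤ x → φ x = 0 := fun x hx => by
    by_contra hne
    have h1 := hX₀ (subset_tsupport φ hne)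
    rw [mem_closedBall_zero_iff, Real.norm_eq_abs] at h1
    linarith [le_max_left X₀ 0, le_abs_self x]
  have hev : ∀ x, X ≤ x → φ =ᶠ[𝓝 x] 0 := fun x hx => by
    have : (tsupport φ)ᶜ ∈ 𝓝 x := (isClosed_tsupport φ).isOpen_compl.mem_nhds fun h1 => by
      have h1 := hX₀ h1
      rw [mem_closedBall_zero_iff, Real.norm_eq_abs] at h1
      linarith [le_max_left X₀ 0, le_abs_self x]
    filter_upwards [this] with z hz using image_eq_zero_of_notMem_tsupport hz
  have hφ1 : ∀ x, X ≤ x → deriv φ x = 0 := fun x hx => by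
    rw [(hev x hx).deriv_eq]
    simp
  have hφ2 : ∀ x, X ≤ x → deriv (deriv φ) x = 0 := fun x hx => by
    rw [(hev x hx).deriv.deriv_eq]
    simp
  have red : ∀ f : ℝ → ℂ, (∀ x, X ≤ x → f x = 0) →
      ∫ x in Ioi (0 : ℝ), f x = ∫ x in (0 : ℝ)..X, f x := fun f hf => by
    rw [intervalIntegral.integral_of_le hX]
    refine (setIntegral_eq_of_subset_of_forall_sdiff_eq_zero measurableSet_Ioi Ioc_subset_Ioi_self
      fun x hx => hf x ?_)
    by_contra hlt
    exact hx.2 ⟨hx.1, (not_le.1 hlt).le⟩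
  have cR : ∀ {f : ℝ → ℝ}, Continuous f → Continuous fun x => (f x : ℂ) := fun h =>
    Complex.continuous_ofReal.comp h
  have iu : IntervalIntegrable u volume 0 X := by
    refine (hu.continuousOn.mono ?_).intervalIntegrable
    rw [uIcc_of_le hX]
    exact Icc_subset_Ici_self
  have i1 : IntervalIntegrable (fun x => ((deriv (deriv φ) x : ℝ) : ℂ) * u x) volume 0 X :=
    iu.continuousOn_mul (cR (contDiff_deriv (contDiff_deriv hφ)).continuous).continuousOn
  have i2 : IntervalIntegrable (fun x => (φ x : ℂ) * u₂ x) volume 0 X :=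
    (hu.intervalIntegrable₂ hX).continuousOn_mul (cR hφ.continuous).continuousOn
  have i1n : IntervalIntegrable (fun x => -(((deriv (deriv φ) x : ℝ) : ℂ) * u x)) volume 0 X := i1.neg
  have i2n : IntervalIntegrable (fun x => -((φ x : ℂ) * u₂ x)) volume 0 X := i2.neg
  have i3 : IntervalIntegrable (fun x => ((q |x| * φ x : ℝ) : ℂ) * u x) volume 0 X :=
    iu.continuousOn_mul (cR ((continuous_evenExtension hq).mul hφ.continuous)).continuousOn
  have p1 := integral_mul_of_primitive (hasDerivAt_of_contDiff hφ) (contDiff_deriv hφ).continuous hX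
    (hφ0 X le_rfl) (hu.intervalIntegrable₂ hX) (G := u₁) fun x hx => by
      rw [hu.deriv_eq_integral x hx, hu10, zero_add]
  have p2 := integral_mul_of_primitive (hasDerivAt_of_contDiff (contDiff_deriv hφ))
    (contDiff_deriv (contDiff_deriv hφ)).continuous hX
    (hφ1 X le_rfl) (hu.intervalIntegrable₁ hX) (G := u) fun x hx => by
      rw [hu.eq_integral x hx, hu0, zero_add]
  rw [inner_toL2_left (continuous_sturmLiouville hq hφ) (hasCompactSupport_sturmLiouville q hs),
    inner_toL2_left hφ.continuous hs]
  have l1 : ∫ x in Ioi (0 : ℝ), ((sturmLiouville q φ x : ℝ) : ℂ) * (y : L2HalfLine) x =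
      ∫ x in Ioi (0 : ℝ), (-(((deriv (deriv φ) x : ℝ) : ℂ) * u x) + ((q |x| * φ x : ℝ) : ℂ) * u x) := by
    refine integral_congr_ae ?_
    filter_upwards [hy] with x hx
    rw [hx, sturmLiouville]
    push_cast
    ring
  have l2 : ∫ x in Ioi (0 : ℝ), (φ x : ℂ) * (minimalOperator q y) x =
      ∫ x in Ioi (0 : ℝ), (-((φ x : ℂ) * u₂ x) + ((q |x| * φ x : ℝ) : ℂ) * u x) := by
    refine integral_congr_ae ?_
    filter_upwards [hz, ae_restrict_mem measurableSet_Ioi] with x hx hx0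
    rw [hx, abs_of_pos hx0]
    push_cast
    ring
  rw [l1, l2, red _ fun x hx => by simp [hφ0 x hx, hφ2 x hx], red _ fun x hx => by simp [hφ0 x hx],
    intervalIntegral.integral_add i1n i3, intervalIntegral.integral_add i2n i3,
    intervalIntegral.integral_neg, intervalIntegral.integral_neg, p1, p2, neg_neg]

/-- A bound for the energy `∫ (φ'² + q φ²)` of a function `φ` with `φ(0) = 0` that vanishes on
`[ε, ∞)`. -/
theorem quadForm_minimalOperator_le (hq : ContinuousOn q (Ici 0)) {φ : ℝ → ℝ} (hφ : ContDiff ℝ ∞ φ)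
    (hs : HasCompactSupport φ) (h0 : φ 0 = 0) {y : (minimalOperator q).domain}
    (hy : (y : L2HalfLine) = toL2 φ) (hAy : minimalOperator q y = toL2 (sturmLiouville q φ))
    {ε C C₁ Q : ℝ} (hε : 0 ≤ ε) (hz : ∀ x, ε ≤ x → φ x = 0) (hC : ∀ x, |φ x| ≤ C)
    (hC₁ : ∀ x, |deriv φ x| ≤ C₁) (hQ : ∀ x ∈ Ioc 0 ε, |q x| ≤ Q) :
    quadForm (minimalOperator q) y ≤ ε * (C₁ ^ 2 + Q * C ^ 2) := by
  have e : quadForm (minimalOperator q) y =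
      ∫ x in Ioi (0 : ℝ), sturmLiouville q φ x * φ x := by
    rw [quadForm, hy, hAy, inner_toL2_left (continuous_sturmLiouville hq hφ)
      (hasCompactSupport_sturmLiouville q hs), ← Complex.ofReal_re (∫ x in Ioi (0 : ℝ), _),
      ← integral_complex_ofReal]
    congr 1
    refine integral_congr_ae ?_
    filter_upwards [coeFn_toL2 hφ.continuous hs] with x hx
    rw [hx]
    push_cast
    ring
  have hf : ContDiff ℝ 1 fun x => φ x * deriv φ x := (hφ.mul (contDiff_deriv hφ)).of_le (by simp)
  have hfs : HasCompactSupport fun x => φ x * deriv φ x := hs.mul_right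
  have hfd : ∀ x, deriv (fun x => φ x * deriv φ x) x =
      deriv φ x * deriv φ x + φ x * deriv (deriv φ) x := fun x =>
    ((hasDerivAt_of_contDiff hφ x).mul (hasDerivAt_of_contDiff (contDiff_deriv hφ) x)).deriv
  have hint := HasCompactSupport.integral_Ioi_deriv_eq hf hfs 0
  simp only [h0, zero_mul, neg_zero] at hint
  have hi1 : Integrable (deriv fun x => φ x * deriv φ x) (volume.restrict (Ioi 0)) :=
    ((hf.continuous_deriv le_rfl).integrable_of_hasCompactSupport hfs.deriv).integrableOn
  have hi2 : Integrable (fun x => sturmLiouville q φ x * φ x) (volume.restrict (Ioi 0)) :=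
    (((continuous_sturmLiouville hq hφ).mul hφ.continuous).integrable_of_hasCompactSupport
      hs.mul_left).integrableOn
  rw [e]
  calc ∫ x in Ioi (0 : ℝ), sturmLiouville q φ x * φ x
      = ∫ x in Ioi (0 : ℝ), (sturmLiouville q φ x * φ x + deriv (fun x => φ x * deriv φ x) x) := by
        rw [integral_add hi2 hi1, hint, add_zero]
    _ ≤ ∫ x in Ioi (0 : ℝ), (Ioc 0 ε).indicator (fun _ => C₁ ^ 2 + Q * C ^ 2) x := by
        refine setIntegral_mono_on (hi2.add hi1) ?_ measurableSet_Ioi fun x hx => ?_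
        · exact ((integrable_indicator_iff measurableSet_Ioc).2 (by simp)).integrableOn
        · have hx0 : (0 : ℝ) < x := hx
          have e1 : sturmLiouville q φ x * φ x + deriv (fun x => φ x * deriv φ x) x =
              deriv φ x ^ 2 + q x * φ x ^ 2 := by
            rw [hfd, sturmLiouville, abs_of_pos hx0]
            ring
          rw [e1]
          rcases le_or_gt x ε with hxe | hxe
          · rw [indicator_of_mem (show x ∈ Ioc 0 ε from ⟨hx, hxe⟩)]
            have b1 : deriv φ x ^ 2 ≤ C₁ ^ 2 := sq_le_sq' (abs_le.1 (hC₁ x)).1 (abs_le.1 (hC₁ x)).2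
            have b2 : φ x ^ 2 ≤ C ^ 2 := sq_le_sq' (abs_le.1 (hC x)).1 (abs_le.1 (hC x)).2
            have b3 := hQ x ⟨hx, hxe⟩
            have b4 : q x * φ x ^ 2 ≤ Q * C ^ 2 :=
              (mul_le_mul_of_nonneg_right ((le_abs_self _).trans b3) (sq_nonneg _)).trans
                (mul_le_mul_of_nonneg_left b2 ((abs_nonneg _).trans b3))
            exact add_le_add b1 b4
          · have hev : φ =ᶠ[𝓝 x] 0 := by
              filter_upwards [Ioi_mem_nhds hxe] with z hz' using hz z (le_of_lt hz')
            rw [indicator_of_notMem fun h => (not_le.2 hxe) h.2, hz x hxe.le, hev.deriv_eq]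
            simp
    _ = ε * (C₁ ^ 2 + Q * C ^ 2) := by
        rw [setIntegral_indicator measurableSet_Ioc,
          inter_eq_self_of_subset_right Ioc_subset_Ioi_self, setIntegral_const]
        simp [hε]

theorem exists_abs_mul_deriv_smoothTransition_le :
    ∃ C, 0 ≤ C ∧ ∀ x, |x * deriv Real.smoothTransition x| ≤ C := by
  have hsm : ContDiff ℝ ∞ Real.smoothTransition := Real.smoothTransition.contDiff (n := ⊤)
  obtain ⟨C, hC⟩ := (isCompact_Icc (a := (0 : ℝ)) (b := 1)).exists_bound_of_continuousOn
    (f := fun x => x * deriv Real.smoothTransition x)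
    (continuous_id.mul (contDiff_deriv hsm).continuous).continuousOn
  refine ⟨|C|, abs_nonneg _, fun x => ?_⟩
  rcases lt_or_ge x 0 with h | h
  · have : Real.smoothTransition =ᶠ[𝓝 x] fun _ => 0 := by
      filter_upwards [Iio_mem_nhds h] with z hz
      exact Real.smoothTransition.zero_of_nonpos (le_of_lt hz)
    rw [this.deriv_eq]
    simp
  rcases lt_or_ge 1 x with h1 | h1
  · have : Real.smoothTransition =ᶠ[𝓝 x] fun _ => 1 := by
      filter_upwards [Ioi_mem_nhds h1] with z hz
      exact Real.smoothTransition.one_of_one_le (le_of_lt hz)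
    rw [this.deriv_eq]
    simp
  · exact (hC x ⟨h, h1⟩).trans (le_abs_self _)

/-- The smooth functions with compact support that vanish at the origin belong to the form domain.
They are approximated by their products with `smoothTransition (n x)`; the linear decay at the
origin makes up for the large derivative of the cutoff. -/
theorem toL2_mem_formDomain (hq : ContinuousOn q (Ici 0))
    (hpos : IsPositiveDefinite (minimalOperator q)) {φ : ℝ → ℝ} (hφ : ContDiff ℝ ∞ φ)
    (hs : HasCompactSupport φ) (h0 : φ 0 = 0) :
    toL2 φ ∈ formDomain (minimalOperator q) hpos := by
  obtain ⟨C₀, hC₀⟩ := hφ.continuous.bounded_above_of_compact_support hs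
  obtain ⟨C₁, hC₁⟩ := (contDiff_deriv hφ).continuous.bounded_above_of_compact_support hs.deriv
  simp only [Real.norm_eq_abs] at hC₀ hC₁
  have hC₀0 : 0 ≤ C₀ := (abs_nonneg _).trans (hC₀ 0)
  have hC₁0 : 0 ≤ C₁ := (abs_nonneg _).trans (hC₁ 0)
  obtain ⟨Cσ, hCσ0, hCσ⟩ := exists_abs_mul_deriv_smoothTransition_le
  obtain ⟨Q, hQ⟩ := (isCompact_Icc (a := (0 : ℝ)) (b := 1)).exists_bound_of_continuousOn
    (hq.mono Icc_subset_Ici_self)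
  have hlin : ∀ x, |φ x| ≤ C₁ * |x| := fun x => by
    have := (convex_univ (𝕜 := ℝ) (E := ℝ)).norm_image_sub_le_of_norm_hasDerivWithin_le
      (fun y _ => (hasDerivAt_of_contDiff hφ y).hasDerivWithinAt) (fun y _ => hC₁ y)
      (mem_univ 0) (mem_univ x)
    simpa [h0] using this
  set σ : ℕ → ℝ → ℝ := fun n x => Real.smoothTransition ((n + 1) * x) with hσ
  have hsm : ContDiff ℝ ∞ Real.smoothTransition := Real.smoothTransition.contDiff (n := ⊤)
  have hσs : ∀ n, ContDiff ℝ ∞ (σ n) := fun n => hsm.comp (by fun_prop)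
  have hσd : ∀ n x, HasDerivAt (σ n) ((n + 1) * deriv Real.smoothTransition ((n + 1) * x)) x :=
    fun n x => by
      have h1 : HasDerivAt (fun x : ℝ => ((n : ℝ) + 1) * x) ((n : ℝ) + 1) x := by
        simpa using (hasDerivAt_id x).const_mul ((n : ℝ) + 1)
      have h2 := (hasDerivAt_of_contDiff hsm (((n : ℝ) + 1) * x)).comp x h1
      rw [mul_comm] at h2
      exact h2
  have hσ1 : ∀ (n : ℕ) (x : ℝ), 1 / ((n : ℝ) + 1) ≤ x → σ n x = 1 := fun n x hx => by
    refine Real.smoothTransition.one_of_one_le ?_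
    rwa [div_le_iff₀' (by positivity)] at hx
  have hσb : ∀ n x, |σ n x| ≤ 1 := fun n x => by
    rw [abs_of_nonneg (Real.smoothTransition.nonneg _)]
    exact Real.smoothTransition.le_one _
  set η : ℕ → ℝ → ℝ := fun n x => φ x * σ n x with hη
  have hηs : ∀ n, ContDiff ℝ ∞ (η n) := fun n => hφ.mul (hσs n)
  have hηc : ∀ n, HasCompactSupport (η n) := fun n => hs.mul_right
  have hηd : ∀ n x, deriv (η n) x =
      deriv φ x * σ n x + φ x * ((n + 1) * deriv Real.smoothTransition ((n + 1) * x)) := fun n x =>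
    ((hasDerivAt_of_contDiff hφ x).mul (hσd n x)).deriv
  have hηb : ∀ n x, |η n x| ≤ C₀ := fun n x => by
    rw [hη, abs_mul]
    exact (mul_le_mul (hC₀ x) (hσb n x) (abs_nonneg _) hC₀0).trans_eq (mul_one _)
  have hηdb : ∀ n x, |deriv (η n) x| ≤ C₁ + C₁ * Cσ := fun n x => by
    rw [hηd]
    refine (abs_add_le _ _).trans (add_le_add ?_ ?_)
    · rw [abs_mul]
      exact (mul_le_mul (hC₁ x) (hσb n x) (abs_nonneg _) hC₁0).trans_eq (mul_one _)
    · rw [abs_mul, abs_mul]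
      refine (mul_le_mul_of_nonneg_right (hlin x) (by positivity)).trans ?_
      rw [mul_assoc, ← mul_assoc |x|, ← abs_mul x, ← abs_mul, mul_comm x]
      exact mul_le_mul_of_nonneg_left (hCσ _) hC₁0
  have hη0 : ∀ n, η n 0 = 0 := fun n => by simp [hη, h0]
  have hη1 : ∀ n, deriv (η n) 0 = 0 := fun n => by simp [hηd, h0, hσ]
  choose s hs1 hs2 using fun n => exists_domain_eq_toL2 hq (hηs n) (hηc n) (hη0 n) (hη1 n)
  have hinv : Tendsto (fun n : ℕ => 1 / ((n : ℝ) + 1)) atTop (𝓝 0) :=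
    tendsto_one_div_add_atTop_nhds_zero_nat
  refine ⟨s, ?_, ?_⟩
  · rw [tendsto_iff_norm_sub_tendsto_zero]
    have hlim : Tendsto (fun n : ℕ => √(1 / ((n : ℝ) + 1)) * (2 * C₀)) atTop (𝓝 0) := by
      simpa using hinv.sqrt.mul_const (2 * C₀)
    refine squeeze_zero (fun n => norm_nonneg _) (fun n => ?_) hlim
    rw [hs1, ← toL2_sub (hηs n).continuous (hηc n) hφ.continuous hs]
    refine norm_toL2_le (h := fun x => η n x - φ x) ((hηs n).continuous.sub hφ.continuous)
      ((hηc n).sub hs) (by positivity) (by positivity) (fun x hx => ?_) fun x _ => ?_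
    · simp [hη, hσ1 n x hx.le]
    · exact (abs_sub _ _).trans (by linarith [hηb n x, hC₀ x])
  · have hlim : Tendsto (fun p : ℕ × ℕ => max (1 / ((p.1 : ℝ) + 1)) (1 / ((p.2 : ℝ) + 1)) *
        ((2 * (C₁ + C₁ * Cσ)) ^ 2 + Q * (2 * C₀) ^ 2)) atTop (𝓝 0) := by
      rw [← prod_atTop_atTop_eq]
      have := ((hinv.comp tendsto_fst).max (hinv.comp tendsto_snd)).mul_const
        ((2 * (C₁ + C₁ * Cσ)) ^ 2 + Q * (2 * C₀) ^ 2)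
      simpa using! this
    refine squeeze_zero (fun p => quadForm_nonneg hpos _) (fun p => ?_) hlim
    have hd : ∀ x, deriv (fun x => η p.1 x - η p.2 x) x = deriv (η p.1) x - deriv (η p.2) x :=
      fun x => ((hasDerivAt_of_contDiff (hηs p.1) x).sub (hasDerivAt_of_contDiff (hηs p.2) x)).deriv
    refine quadForm_minimalOperator_le hq (φ := fun x => η p.1 x - η p.2 x)
      ((hηs p.1).sub (hηs p.2)) ((hηc p.1).sub (hηc p.2)) (by simp [hη0]) ?_ ?_ ?_ (fun x hx => ?_)
      (fun x => ?_) (fun x => ?_) fun x hx => hQ x ⟨hx.1.le, hx.2.trans ?_⟩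
    · rw [Submodule.coe_sub, hs1, hs1, toL2_sub (hηs _).continuous (hηc _) (hηs _).continuous (hηc _)]
    · rw [LinearPMap.map_sub, hs2, hs2, ← toL2_sub (continuous_sturmLiouville hq (hηs _))
        (hasCompactSupport_sturmLiouville q (hηc _)) (continuous_sturmLiouville hq (hηs _))
        (hasCompactSupport_sturmLiouville q (hηc _))]
      congr 1
      funext x
      have e1 : deriv (deriv fun x => η p.1 x - η p.2 x) x =
          deriv (deriv (η p.1)) x - deriv (deriv (η p.2)) x := by
        rw [funext hd]
        exact ((hasDerivAt_of_contDiff (contDiff_deriv (hηs p.1)) x).sub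
          (hasDerivAt_of_contDiff (contDiff_deriv (hηs p.2)) x)).deriv
      simp only [sturmLiouville, e1]
      ring
    · positivity
    · simp only [hη]
      rw [hσ1 p.1 x ((le_max_left _ _).trans hx), hσ1 p.2 x ((le_max_right _ _).trans hx), sub_self]
    · exact (abs_sub _ _).trans (by linarith [hηb p.1 x, hηb p.2 x])
    · rw [hd]
      exact (abs_sub _ _).trans (by linarith [hηdb p.1 x, hηdb p.2 x])
    · have hle : ∀ n : ℕ, 1 / ((n : ℝ) + 1) ≤ 1 := fun n => by
        rw [div_le_one (by positivity)]
        linarith [Nat.cast_nonneg (α := ℝ) n]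
      exact max_le (hle _) (hle _)

/-- The smooth functions with compact support that vanish at the origin belong to the domain of the
Friedrichs extension: it is given by the Dirichlet condition at the origin. -/
theorem toL2_mem_graph_friedrichs (hq : ContinuousOn q (Ici 0))
    (hpos : IsPositiveDefinite (minimalOperator q)) {φ : ℝ → ℝ} (hφ : ContDiff ℝ ∞ φ)
    (hs : HasCompactSupport φ) (h0 : φ 0 = 0) :
    (toL2 φ, toL2 (sturmLiouville q φ)) ∈ (friedrichs (minimalOperator q) hpos).graph :=
  (mem_graph_friedrichs hpos (dense_domain_minimalOperator hq)).2
    ⟨toL2_mem_formDomain hq hpos hφ hs h0, inner_sturmLiouville_left hq hφ hs⟩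

end MinimalOperator

/-! ### The wave equation in the weak form -/

section WeakEquation

theorem dirDeriv_comm {f : ℝ × ℝ → ℝ} (hf : ContDiff ℝ ∞ f) (v w : ℝ × ℝ) :
    dirDeriv v (dirDeriv w f) = dirDeriv w (dirDeriv v f) := by
  have h2 : ∀ (v w p : ℝ × ℝ), dirDeriv v (dirDeriv w f) p = fderiv ℝ (fderiv ℝ f) p v w := by
    intro v w p
    have hd : DifferentiableAt ℝ (fderiv ℝ f) p :=
      ((hf.fderiv_right (m := ∞) (by simp)).differentiable (by simp)) p
    have := (hd.hasFDerivAt.clm_apply (hasFDerivAt_const w p)).fderiv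
    change fderiv ℝ (fun p => fderiv ℝ f p w) p v = _
    rw [this]
    simp
  funext p
  rw [h2, h2]
  exact (hf.contDiffAt.isSymmSndFDerivAt (by
    simpa using WithTop.coe_le_coe.2 (le_top : (2 : ℕ∞) ≤ ⊤))).eq v w

theorem hasDerivAt_fst_dirDeriv {f : ℝ × ℝ → ℝ} (hf : ContDiff ℝ ∞ f) (t x : ℝ) :
    HasDerivAt (fun t => f (t, x)) (dirDeriv (1, 0) f (t, x)) t :=
  (hf.differentiable (by simp) (t, x)).hasFDerivAt.comp_hasDerivAt t
    ((hasDerivAt_id t).prodMk (hasDerivAt_const t x))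

theorem hasDerivAt_snd_dirDeriv {f : ℝ × ℝ → ℝ} (hf : ContDiff ℝ ∞ f) (t x : ℝ) :
    HasDerivAt (fun x => f (t, x)) (dirDeriv (0, 1) f (t, x)) x :=
  (hf.differentiable (by simp) (t, x)).hasFDerivAt.comp_hasDerivAt x
    ((hasDerivAt_const x t).prodMk (hasDerivAt_id x))

/-- The expression `-Φ_xx + q Φ` for a function `Φ` of `(t, x)`, with `q` extended evenly. -/
def spatialExpr (q : ℝ → ℝ) (Φ : ℝ × ℝ → ℝ) (p : ℝ × ℝ) : ℝ :=
  -dirDeriv (0, 1) (dirDeriv (0, 1) Φ) p + q |p.2| * Φ p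

/-- The expression `Φ_tt - Φ_xx + q Φ` for a function `Φ` of `(t, x)`, with `q` extended evenly. -/
def waveExpr (q : ℝ → ℝ) (Φ : ℝ × ℝ → ℝ) (p : ℝ × ℝ) : ℝ :=
  dirDeriv (1, 0) (dirDeriv (1, 0) Φ) p + spatialExpr q Φ p

variable {q : ℝ → ℝ} {Φ : ℝ × ℝ → ℝ}

theorem continuous_spatialExpr (hq : ContinuousOn q (Ici 0)) (hΦ : ContDiff ℝ ∞ Φ) :
    Continuous (spatialExpr q Φ) :=
  (ContDiff.dirDeriv (ContDiff.dirDeriv hΦ _) _).continuous.neg.add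
    (((continuous_evenExtension hq).comp continuous_snd).mul hΦ.continuous)

theorem hasCompactSupport_spatialExpr (q : ℝ → ℝ) (hs : HasCompactSupport Φ) :
    HasCompactSupport (spatialExpr q Φ) :=
  (HasCompactSupport.dirDeriv (HasCompactSupport.dirDeriv hs _) _).neg.add hs.mul_left

theorem spatialExpr_eq_zero (q : ℝ → ℝ) {p : ℝ × ℝ} (hp : p ∉ tsupport Φ) :
    spatialExpr q Φ p = 0 := by
  have h : p ∉ tsupport (dirDeriv (0, 1) (dirDeriv (0, 1) Φ)) := fun h =>
    hp (tsupport_dirDeriv_subset _ _ (tsupport_dirDeriv_subset _ _ h))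
  rw [spatialExpr, image_eq_zero_of_notMem_tsupport h, image_eq_zero_of_notMem_tsupport hp]
  simp

theorem contDiff_oddSlice (hΦ : ContDiff ℝ ∞ Φ) (t : ℝ) : ContDiff ℝ ∞ (oddSlice Φ t) :=
  (hΦ.comp (by fun_prop : ContDiff ℝ ∞ fun x : ℝ => (t, x))).sub
    (hΦ.comp (by fun_prop : ContDiff ℝ ∞ fun x : ℝ => (t, -x)))

theorem sturmLiouville_oddSlice (q : ℝ → ℝ) (hΦ : ContDiff ℝ ∞ Φ) (t : ℝ) :
    sturmLiouville q (oddSlice Φ t) = oddSlice (spatialExpr q Φ) t := by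
  have hneg : ∀ {f : ℝ × ℝ → ℝ}, ContDiff ℝ ∞ f → ∀ x,
      HasDerivAt (fun x => f (t, -x)) (-dirDeriv (0, 1) f (t, -x)) x := fun hf x => by
    have := (hasDerivAt_snd_dirDeriv hf t (-x)).comp x (hasDerivAt_neg x)
    rw [mul_neg_one] at this
    exact this
  have hΦ1 := ContDiff.dirDeriv hΦ (0, 1)
  have d1 : deriv (oddSlice Φ t) =
      fun x => dirDeriv (0, 1) Φ (t, x) + dirDeriv (0, 1) Φ (t, -x) := by
    funext x
    have := ((hasDerivAt_snd_dirDeriv hΦ t x).sub (hneg hΦ x)).deriv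
    rw [sub_neg_eq_add] at this
    exact this
  have d2 : deriv (deriv (oddSlice Φ t)) =
      fun x => dirDeriv (0, 1) (dirDeriv (0, 1) Φ) (t, x) -
        dirDeriv (0, 1) (dirDeriv (0, 1) Φ) (t, -x) := by
    funext x
    rw [d1]
    have := ((hasDerivAt_snd_dirDeriv hΦ1 t x).add (hneg hΦ1 x)).deriv
    rw [← sub_eq_add_neg] at this
    exact this
  funext x
  rw [sturmLiouville, d2]
  simp only [oddSlice, spatialExpr, abs_neg]
  ring

/-- Slices are in the domain of `L`; stated in terms of `L⁻¹`. -/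
theorem boundedInverse_slice (hq : ContinuousOn q (Ici 0))
    (hpos : IsPositiveDefinite (minimalOperator q)) (hΦ : ContDiff ℝ ∞ Φ)
    (hs : HasCompactSupport Φ) (t : ℝ) :
    boundedInverse (friedrichs (minimalOperator q) hpos) (slice (spatialExpr q Φ) t) = slice Φ t := by
  rw [isBoundedInverse_friedrichs hpos (dense_domain_minimalOperator hq), slice, slice,
    ← sturmLiouville_oddSlice q hΦ]
  exact toL2_mem_graph_friedrichs hq hpos (contDiff_oddSlice hΦ t) (hasCompactSupport_oddSlice hs t)
    (by simp [oddSlice])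

theorem hasDerivAt_slice_spatialExpr (hq : ContinuousOn q (Ici 0)) (hΦ : ContDiff ℝ ∞ Φ)
    (hs : HasCompactSupport Φ) (t : ℝ) :
    HasDerivAt (slice (spatialExpr q Φ)) (slice (spatialExpr q (dirDeriv (1, 0) Φ)) t) t := by
  have hΦ1 := ContDiff.dirDeriv hΦ (1, 0)
  have hs1 := HasCompactSupport.dirDeriv hs (1, 0)
  refine hasDerivAt_slice (continuous_spatialExpr hq hΦ) (hasCompactSupport_spatialExpr q hs)
    (continuous_spatialExpr hq hΦ1) (hasCompactSupport_spatialExpr q hs1) (fun t x => ?_) t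
  have e1 := (hasDerivAt_fst_dirDeriv (ContDiff.dirDeriv (ContDiff.dirDeriv hΦ (0, 1)) (0, 1)) t x)
  rw [dirDeriv_comm (ContDiff.dirDeriv hΦ (0, 1)) (1, 0), dirDeriv_comm hΦ (1, 0)] at e1
  exact e1.neg.add ((hasDerivAt_fst_dirDeriv hΦ t x).const_mul (q |x|))

theorem slice_eq_zero {θ : ℝ × ℝ → ℝ} {t : ℝ} (h : ∀ x, θ (t, x) = 0) : slice θ t = 0 := by
  have e : oddSlice θ t = fun _ => 0 := by
    funext x
    simp [oddSlice, h]
  have h0 : HasCompactSupport fun _ : ℝ => (0 : ℝ) := HasCompactSupport.zero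
  rw [slice, e, Lp.eq_zero_iff_ae_eq_zero]
  refine (coeFn_toL2 continuous_const h0).trans ?_
  simp
  rfl

theorem slice_waveExpr (hq : ContinuousOn q (Ici 0)) (hΦ : ContDiff ℝ ∞ Φ)
    (hs : HasCompactSupport Φ) (t : ℝ) : slice (waveExpr q Φ) t =
      slice (dirDeriv (1, 0) (dirDeriv (1, 0) Φ)) t + slice (spatialExpr q Φ) t :=
  slice_add (ContDiff.dirDeriv (ContDiff.dirDeriv hΦ _) _).continuous
    (HasCompactSupport.dirDeriv (HasCompactSupport.dirDeriv hs _) _)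
    (continuous_spatialExpr hq hΦ) (hasCompactSupport_spatialExpr q hs) t

/-- Duhamel's principle for the slices of a smooth function with compact support. -/
theorem integral_sineOp_slice_waveExpr (hq : ContinuousOn q (Ici 0))
    (hpos : IsPositiveDefinite (minimalOperator q)) (hΦ : ContDiff ℝ ∞ Φ)
    (hs : HasCompactSupport Φ) (a b : ℝ) :
    ∫ t in a..b, sineOp (friedrichs (minimalOperator q) hpos) t (slice (waveExpr q Φ) t) =
      (sineOp (friedrichs (minimalOperator q) hpos) b (slice (dirDeriv (1, 0) Φ) b) -
          cosineOp (friedrichs (minimalOperator q) hpos) b (slice (spatialExpr q Φ) b)) -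
        (sineOp (friedrichs (minimalOperator q) hpos) a (slice (dirDeriv (1, 0) Φ) a) -
          cosineOp (friedrichs (minimalOperator q) hpos) a (slice (spatialExpr q Φ) a)) := by
  have hΦ1 := ContDiff.dirDeriv hΦ (1, 0)
  have hs1 := HasCompactSupport.dirDeriv hs (1, 0)
  have hΦ2 := ContDiff.dirDeriv hΦ1 (1, 0)
  have hs2 := HasCompactSupport.dirDeriv hs1 (1, 0)
  have := integral_sineOp_duhamel
    (boundedInverse_friedrichs_nonneg hpos (dense_domain_minimalOperator hq))
    (hasDerivAt_slice_spatialExpr hq hΦ hs) (hasDerivAt_slice_spatialExpr hq hΦ1 hs1)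
    (continuous_slice (continuous_spatialExpr hq hΦ2) (hasCompactSupport_spatialExpr q hs2)) a b
  simp only [boundedInverse_slice hq hpos hΦ1 hs1, boundedInverse_slice hq hpos hΦ2 hs2] at this
  rw [← this]
  refine intervalIntegral.integral_congr fun t _ => ?_
  simp only [slice_waveExpr hq hΦ hs]

theorem continuous_waveExpr (hq : ContinuousOn q (Ici 0)) (hΦ : ContDiff ℝ ∞ Φ) :
    Continuous (waveExpr q Φ) :=
  (ContDiff.dirDeriv (ContDiff.dirDeriv hΦ _) _).continuous.add (continuous_spatialExpr hq hΦ)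

theorem hasCompactSupport_waveExpr (q : ℝ → ℝ) (hs : HasCompactSupport Φ) :
    HasCompactSupport (waveExpr q Φ) :=
  (HasCompactSupport.dirDeriv (HasCompactSupport.dirDeriv hs _) _).add
    (hasCompactSupport_spatialExpr q hs)

theorem integral_inner_sineOp (L : L2HalfLine →ₗ.[ℂ] L2HalfLine) {θ : ℝ × ℝ → ℝ}
    (hc : Continuous θ) (hs : HasCompactSupport θ) (y : L2HalfLine) (a b : ℝ) :
    ∫ t in a..b, inner ℂ (sineOp L t y) (slice θ t) =
      inner ℂ y (∫ t in a..b, sineOp L t (slice θ t)) := by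
  have hi : IntervalIntegrable (fun t => sineOp L t (slice θ t)) volume a b :=
    ((continuous_sineOp L).clm_apply (continuous_slice hc hs)).intervalIntegrable _ _
  rw [← innerSL_apply_apply ℂ y, ← ContinuousLinearMap.intervalIntegral_comp_comm _ hi]
  simp only [inner_sineOp_left, innerSL_apply_apply]

/-- The weak form of `v_tt + L v = 0`, `v(0) = 0`, `v_t(0) = y`, tested on `[0, R]`. -/
theorem integral_inner_waveExpr_of_nonneg (hq : ContinuousOn q (Ici 0))
    (hpos : IsPositiveDefinite (minimalOperator q)) (hΦ : ContDiff ℝ ∞ Φ)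
    (hs : HasCompactSupport Φ) {R : ℝ} (hR : ∀ x, (R, x) ∉ tsupport Φ) (y : L2HalfLine) :
    ∫ t in (0 : ℝ)..R, inner ℂ (sineOp (friedrichs (minimalOperator q) hpos) t y)
      (slice (waveExpr q Φ) t) = inner ℂ y (slice Φ 0) := by
  have h1 : slice (dirDeriv (1, 0) Φ) R = 0 := slice_eq_zero fun x =>
    image_eq_zero_of_notMem_tsupport fun h => hR x (tsupport_dirDeriv_subset _ _ h)
  have h2 : slice (spatialExpr q Φ) R = 0 := slice_eq_zero fun x => spatialExpr_eq_zero q (hR x)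
  rw [integral_inner_sineOp _ (continuous_waveExpr hq hΦ) (hasCompactSupport_waveExpr q hs),
    integral_sineOp_slice_waveExpr hq hpos hΦ hs, h1, h2, sineOp_zero, cosineOp_zero
    (boundedInverse_friedrichs_nonneg hpos (dense_domain_minimalOperator hq)),
    boundedInverse_slice hq hpos hΦ hs]
  simp

/-- The weak form of `v_tt + L v = 0`, tested on `[-R, R]`. -/
theorem integral_inner_waveExpr_symm (hq : ContinuousOn q (Ici 0))
    (hpos : IsPositiveDefinite (minimalOperator q)) (hΦ : ContDiff ℝ ∞ Φ)
    (hs : HasCompactSupport Φ) {R : ℝ} (hR : ∀ x, (R, x) ∉ tsupport Φ)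
    (hR' : ∀ x, (-R, x) ∉ tsupport Φ) (y : L2HalfLine) :
    ∫ t in -R..R, inner ℂ (sineOp (friedrichs (minimalOperator q) hpos) t y)
      (slice (waveExpr q Φ) t) = 0 := by
  have h1 : ∀ {r : ℝ}, (∀ x, (r, x) ∉ tsupport Φ) → slice (dirDeriv (1, 0) Φ) r = 0 := fun hr =>
    slice_eq_zero fun x =>
      image_eq_zero_of_notMem_tsupport fun h => hr x (tsupport_dirDeriv_subset _ _ h)
  have h2 : ∀ {r : ℝ}, (∀ x, (r, x) ∉ tsupport Φ) → slice (spatialExpr q Φ) r = 0 := fun hr =>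
    slice_eq_zero fun x => spatialExpr_eq_zero q (hr x)
  rw [integral_inner_sineOp _ (continuous_waveExpr hq hΦ) (hasCompactSupport_waveExpr q hs),
    integral_sineOp_slice_waveExpr hq hpos hΦ hs, h1 hR, h2 hR, h1 hR', h2 hR']
  simp

end WeakEquation

/-! ### Passage to characteristic coordinates -/

section Propagation

/-- The passage to characteristic coordinates centred at `(0, c)`:
`(t, x) ↦ (t + β (x - c), -β δ t + δ (x - c))` with signs `β`, `δ`. The sum of the two new
coordinates is `2 t` for `β = 1`, `δ = -1`, and `2 σ (x - c)` for `β = δ = σ`, so that the choice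
of the signs singles out which of the variables plays the role of time. -/
def charCoord (c : ℝ) {β δ : ℝ} (hβ : β * β = 1) (hδ : δ * δ = 1) : ℝ × ℝ ≃ₜ ℝ × ℝ where
  toFun p := (p.1 + β * (p.2 - c), -(β * δ) * p.1 + δ * (p.2 - c))
  invFun p := ((p.1 - β * δ * p.2) / 2, c + (β * p.1 + δ * p.2) / 2)
  left_inv p := by
    ext
    · simp only
      linear_combination (1 / 2 * (δ * δ) * p.1) * hβ + (p.1 / 2 - β * (p.2 - c) / 2) * hδ
    · simp only
      linear_combination (p.2 - c) / 2 * hβ + (-β * p.1 / 2 + (p.2 - c) / 2) * hδ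
  right_inv p := by
    ext
    · simp only
      linear_combination p.1 / 2 * hβ
    · simp only
      linear_combination p.2 * hδ + δ * δ * p.2 / 2 * hβ
  continuous_toFun := by fun_prop
  continuous_invFun := by fun_prop

variable {c β δ : ℝ} {hβ : β * β = 1} {hδ : δ * δ = 1}

theorem charCoord_apply (p : ℝ × ℝ) :
    charCoord c hβ hδ p = (p.1 + β * (p.2 - c), -(β * δ) * p.1 + δ * (p.2 - c)) := rfl

theorem contDiff_charCoord : ContDiff ℝ ∞ (charCoord c hβ hδ) := by
  have : (charCoord c hβ hδ : ℝ × ℝ → ℝ × ℝ) =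
    fun p => (p.1 + β * (p.2 - c), -(β * δ) * p.1 + δ * (p.2 - c)) := rfl
  rw [this]
  fun_prop

theorem hasFDerivAt_charCoord (p : ℝ × ℝ) : ∃ A : ℝ × ℝ →L[ℝ] ℝ × ℝ,
    HasFDerivAt (charCoord c hβ hδ) A p ∧ A (1, 0) = (1, -(β * δ)) ∧ A (0, 1) = (β, δ) := by
  have h1 : HasFDerivAt (fun p : ℝ × ℝ => p.1) (ContinuousLinearMap.fst ℝ ℝ ℝ) p := hasFDerivAt_fst
  have h2 : HasFDerivAt (fun p : ℝ × ℝ => p.2 - c) (ContinuousLinearMap.snd ℝ ℝ ℝ) p :=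
    hasFDerivAt_snd.sub_const c
  refine ⟨_, (h1.add (h2.const_mul β)).prodMk ((h1.const_mul (-(β * δ))).add (h2.const_mul δ)), ?_, ?_⟩
  · ext <;> simp
  · ext <;> simp

theorem dirDeriv_eq (f : ℝ × ℝ → ℝ) (p : ℝ × ℝ) (a b : ℝ) :
    dirDeriv (a, b) f p = a * dirDeriv (1, 0) f p + b * dirDeriv (0, 1) f p := by
  have : ((a, b) : ℝ × ℝ) = a • ((1, 0) : ℝ × ℝ) + b • ((0, 1) : ℝ × ℝ) := by ext <;> simp
  rw [dirDeriv, this, map_add, map_smul, map_smul]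
  rfl

theorem dirDeriv_comp_charCoord {f : ℝ × ℝ → ℝ} (hf : ContDiff ℝ ∞ f) :
    dirDeriv (1, 0) (f ∘ charCoord c hβ hδ) = dirDeriv (1, -(β * δ)) f ∘ charCoord c hβ hδ ∧
    dirDeriv (0, 1) (f ∘ charCoord c hβ hδ) = dirDeriv (β, δ) f ∘ charCoord c hβ hδ := by
  constructor <;> funext p <;>
    obtain ⟨A, hA, h1, h2⟩ := hasFDerivAt_charCoord (c := c) (hβ := hβ) (hδ := hδ) p
  all_goals
    have := ((hf.differentiable (by simp) (charCoord c hβ hδ p)).hasFDerivAt.comp p hA).fderiv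
    rw [dirDeriv, this, ContinuousLinearMap.comp_apply]
  · rw [h1]
    rfl
  · rw [h2]
    rfl

theorem dirDeriv_dirDeriv_eq {f : ℝ × ℝ → ℝ} (hf : ContDiff ℝ ∞ f) (p : ℝ × ℝ) (a b : ℝ) :
    dirDeriv (a, b) (dirDeriv (a, b) f) p = a * a * dirDeriv (1, 0) (dirDeriv (1, 0) f) p +
      2 * (a * b) * mixedDeriv f p + b * b * dirDeriv (0, 1) (dirDeriv (0, 1) f) p := by
  have h1 : ∀ v, dirDeriv (a, b) (dirDeriv v f) p =
      a * dirDeriv v (dirDeriv (1, 0) f) p + b * dirDeriv v (dirDeriv (0, 1) f) p := fun v => by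
    rw [dirDeriv_eq, dirDeriv_comm hf (1, 0) v, dirDeriv_comm hf (0, 1) v]
  have h2 : dirDeriv (a, b) (dirDeriv (a, b) f) p =
      a * dirDeriv (a, b) (dirDeriv (1, 0) f) p + b * dirDeriv (a, b) (dirDeriv (0, 1) f) p := h1 _
  rw [h2, h1, h1, dirDeriv_comm hf (1, 0) (0, 1), mixedDeriv]
  ring

/-- In characteristic coordinates the wave operator is a multiple of the mixed derivative. -/
theorem waveExpr_comp_charCoord (q : ℝ → ℝ) {f : ℝ × ℝ → ℝ} (hf : ContDiff ℝ ∞ f) (p : ℝ × ℝ) :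
    waveExpr q (f ∘ charCoord c hβ hδ) p =
      -(4 * (β * δ)) * mixedDeriv f (charCoord c hβ hδ p) + q |p.2| * f (charCoord c hβ hδ p) := by
  rw [waveExpr, spatialExpr, (dirDeriv_comp_charCoord hf).1, (dirDeriv_comp_charCoord hf).2,
    (dirDeriv_comp_charCoord (ContDiff.dirDeriv hf _)).1,
    (dirDeriv_comp_charCoord (ContDiff.dirDeriv hf _)).2]
  simp only [Function.comp_apply]
  rw [dirDeriv_dirDeriv_eq hf _ 1 (-(β * δ)), dirDeriv_dirDeriv_eq hf _ β δ]
  linear_combination (dirDeriv (0, 1) (dirDeriv (0, 1) f) (charCoord c hβ hδ p) * (δ * δ) -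
    dirDeriv (1, 0) (dirDeriv (1, 0) f) (charCoord c hβ hδ p)) * hβ

theorem IsTest.comp_homeomorph {Ω : Set (ℝ × ℝ)} {θ : ℝ × ℝ → ℝ} (h : IsTest Ω θ)
    (κ : ℝ × ℝ ≃ₜ ℝ × ℝ) : IsTest (κ ⁻¹' Ω) (θ ∘ κ) where
  continuous := h.continuous.comp κ.continuous
  hasCompactSupport := h.hasCompactSupport.comp_homeomorph κ
  tsupport_subset := by
    rw [tsupport_comp_eq_preimage θ κ]
    exact preimage_mono h.tsupport_subset

/-- The bound `|⟨w, h⟩| ≤ (X + ‖w‖²) C`, where `|h| ≤ C` is needed only where `w` is not zero. -/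
theorem norm_inner_toL2_le {w : L2HalfLine} {h : ℝ → ℝ} (hc : Continuous h)
    (hs : HasCompactSupport h) {X C : ℝ} (hX : 0 ≤ X) (hC : 0 ≤ C) (hX0 : ∀ x, X < x → h x = 0)
    (hb : ∀ᵐ x ∂halfLine, w x = 0 ∨ |h x| ≤ C) :
    ‖inner ℂ w (toL2 h)‖ ≤ (X + ‖w‖ ^ 2) * C := by
  have hw : Integrable (fun x => ‖w x‖ ^ 2) halfLine := (Lp.memLp w).integrable_norm_pow two_ne_zero
  have hnorm : ‖w‖ ^ 2 = ∫ x, ‖w x‖ ^ 2 ∂halfLine := by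
    have h1 := inner_self_eq_norm_sq_to_K (𝕜 := ℂ) w
    rw [L2.inner_def] at h1
    have h2 : ((∫ x, ‖w x‖ ^ 2 ∂halfLine : ℝ) : ℂ) = ((‖w‖ ^ 2 : ℝ) : ℂ) := by
      rw [← integral_complex_ofReal]
      push_cast
      refine Eq.trans (integral_congr_ae (Eventually.of_forall fun x => ?_)) h1
      simp only
      rw [inner_self_eq_norm_sq_to_K]
      rfl
    exact (Complex.ofReal_inj.1 h2).symm
  have hI : Integrable ((Ioc 0 X).indicator fun _ => (1 : ℝ)) halfLine :=
    ((integrable_indicator_iff measurableSet_Ioc).2 (by simp)).integrableOn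
  rw [inner_toL2_right hc hs]
  refine (norm_integral_le_of_norm_le ((hI.add hw).mul_const C) ?_).trans_eq ?_
  · filter_upwards [hb, ae_restrict_mem measurableSet_Ioi] with x hx hx0
    rw [norm_mul, RCLike.norm_conj, Complex.norm_real, Real.norm_eq_abs]
    rcases le_or_gt x X with hxX | hxX
    · rw [Pi.add_apply, indicator_of_mem (show x ∈ Ioc 0 X from ⟨hx0, hxX⟩)]
      rcases hx with h0 | h0
      · rw [h0]
        simpa using hC
      · rw [mul_comm]
        -- `‖w‖ ≤ 1 + ‖w‖²`
        refine mul_le_mul ?_ h0 (abs_nonneg _) (by positivity)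
        nlinarith [sq_nonneg (‖w x‖ - 1)]
    · rw [hX0 x hxX, abs_zero, zero_mul, Pi.add_apply]
      exact mul_nonneg (add_nonneg (indicator_nonneg (fun _ _ => zero_le_one) x) (sq_nonneg _)) hC
  · rw [integral_mul_const, integral_add' hI hw, hnorm, setIntegral_indicator measurableSet_Ioc,
      inter_eq_self_of_subset_right Ioc_subset_Ioi_self, setIntegral_const]
    simp [hX]

theorem isOpen_trapezoid (ε S R : ℝ) : IsOpen (trapezoid ε S R) := by
  have hs : Continuous fun p : ℝ × ℝ => p.1 + p.2 := by fun_prop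
  exact (isOpen_lt continuous_const hs).inter ((isOpen_lt hs continuous_const).inter
      ((isOpen_lt continuous_fst continuous_const).inter
        (isOpen_lt continuous_snd continuous_const)))

variable {q : ℝ → ℝ}

/-- Uniqueness for the wave equation in a trapezoid in characteristic coordinates, tested against
continuous functions. The hypothesis `hz` says that `v(t, x) = (L^(-1/2) sin (t L^(1/2)) y) (x)`
vanishes in the part of the trapezoid where the sum of the characteristic coordinates is
negative, and `hw` is the weak form of the wave equation. -/
theorem integral_inner_slice_eq_zero (hq : ContinuousOn q (Ici 0))
    {L : L2HalfLine →ₗ.[ℂ] L2HalfLine} {y : L2HalfLine} {a b ε S R : ℝ} (hab : a ≤ b) (hε : 0 < ε)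
    (hz : ∀ t ∈ Icc a b, ∀ᵐ x ∂halfLine, sineOp L t y x = 0 ∨
      (charCoord c hβ hδ (t, x) ∈ trapezoid ε S R →
        0 ≤ (charCoord c hβ hδ (t, x)).1 + (charCoord c hβ hδ (t, x)).2) ∧
      (charCoord c hβ hδ (t, -x) ∈ trapezoid ε S R →
        0 ≤ (charCoord c hβ hδ (t, -x)).1 + (charCoord c hβ hδ (t, -x)).2))
    (hw : ∀ Φ, IsTest (charCoord c hβ hδ ⁻¹' trapezoid ε S R) Φ → ContDiff ℝ ∞ Φ →
      ∫ t in a..b, inner ℂ (sineOp L t y) (slice (waveExpr q Φ) t) = 0)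
    {θ : ℝ × ℝ → ℝ} (hθ : IsTest (charCoord c hβ hδ ⁻¹' trapezoid ε S R) θ) :
    ∫ t in a..b, inner ℂ (sineOp L t y) (slice θ t) = 0 := by
  set κ := charCoord c hβ hδ with hκ
  have hint : ∀ {θ : ℝ × ℝ → ℝ}, Continuous θ → HasCompactSupport θ →
      IntervalIntegrable (fun t => inner ℂ (sineOp L t y) (slice θ t)) volume a b := fun hc hs =>
    Continuous.intervalIntegrable (Continuous.inner
      ((continuous_sineOp L).clm_apply continuous_const) (continuous_slice hc hs)) _ _
  obtain ⟨X, hX0, hX⟩ : ∃ X, 0 ≤ X ∧ ∀ t x, κ (t, x) ∈ trapezoid ε S R → |x| ≤ X := by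
    refine ⟨|c| + (|R| + ε), by positivity, fun t x ⟨h1, _, h3, h4⟩ => ?_⟩
    have e : x - c = (β * (κ (t, x)).1 + δ * (κ (t, x)).2) / 2 := by
      simp only [hκ, charCoord_apply]
      linear_combination (-(x - c) / 2) * hβ - ((x - c) / 2 - β * t / 2) * hδ
    have hsgn : ∀ {b : ℝ}, b * b = 1 → |b| = 1 := fun {b} hb => by
      rw [← abs_one, ← sq_eq_sq_iff_abs_eq_abs]
      linarith
    have b1 : |(κ (t, x)).1| ≤ |R| + ε := abs_le.2 ⟨by linarith [le_abs_self R], by linarith [le_abs_self R]⟩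
    have b2 : |(κ (t, x)).2| ≤ |R| + ε := abs_le.2 ⟨by linarith [le_abs_self R], by linarith [le_abs_self R]⟩
    have b3 : |x - c| ≤ |R| + ε := by
      rw [e, abs_div, abs_two, div_le_iff₀ two_pos]
      refine (abs_add_le _ _).trans ?_
      rw [abs_mul, abs_mul, hsgn hβ, hsgn hδ]
      linarith
    have := abs_add_le c (x - c)
    rw [add_sub_cancel] at this
    linarith
  set P : ℝ × ℝ → ℝ := fun p => β * δ / 4 * q |(κ.symm p).2| with hP
  have hPc : Continuous P := continuous_const.mul ((continuous_evenExtension hq).comp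
    (continuous_snd.comp κ.symm.continuous))
  set ℓ : (ℝ × ℝ → ℝ) → ℂ := fun τ => ∫ t in a..b, inner ℂ (sineOp L t y) (slice (τ ∘ κ) t) with hℓ
  set N : ℝ := max |a| |b| * ‖y‖ with hN
  have hN0 : 0 ≤ N := mul_nonneg ((abs_nonneg a).trans (le_max_left _ _)) (norm_nonneg y)
  have hsub : ∀ τ τ', IsTest (trapezoid ε S R) τ → IsTest (trapezoid ε S R) τ' →
      ℓ (fun p => τ p - τ' p) = ℓ τ - ℓ τ' := fun τ τ' h h' => by
    have k := h.comp_homeomorph κ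
    have k' := h'.comp_homeomorph κ
    simp only [hℓ]
    rw [← intervalIntegral.integral_sub (hint k.continuous k.hasCompactSupport)
      (hint k'.continuous k'.hasCompactSupport)]
    refine intervalIntegral.integral_congr fun t _ => ?_
    rw [← inner_sub_right, ← slice_sub k.continuous k.hasCompactSupport k'.continuous
      k'.hasCompactSupport]
    rfl
  have hbd : ∀ τ C, IsTest (trapezoid ε S R) τ → 0 ≤ C →
      (∀ p : ℝ × ℝ, 0 ≤ p.1 + p.2 → |τ p| ≤ C) → ‖ℓ τ‖ ≤ (X + N ^ 2) * 2 * |b - a| * C := by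
    intro τ C h hC hτ
    have k := h.comp_homeomorph κ
    have k0 : ∀ t x, X < |x| → (τ ∘ κ) (t, x) = 0 := fun t x hx => by
      by_contra hne
      have hm := hX t x (k.tsupport_subset (subset_tsupport _ hne))
      linarith
    have kb : ∀ t x, (κ (t, x) ∈ trapezoid ε S R → 0 ≤ (κ (t, x)).1 + (κ (t, x)).2) →
        |τ (κ (t, x))| ≤ C := fun t x hx => by
      by_cases hm : κ (t, x) ∈ trapezoid ε S R
      · exact hτ _ (hx hm)
      · rw [image_eq_zero_of_notMem_tsupport fun hm' => hm (h.tsupport_subset hm'), abs_zero]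
        exact hC
    have key : ∀ t ∈ uIoc a b, ‖inner ℂ (sineOp L t y) (slice (τ ∘ κ) t)‖ ≤
        (X + N ^ 2) * (2 * C) := fun t ht => by
      rw [uIoc_of_le hab] at ht
      have hyN : ‖sineOp L t y‖ ≤ N := by
        refine (ContinuousLinearMap.le_opNorm _ _).trans ?_
        refine mul_le_mul_of_nonneg_right ((norm_sineOp_le L t).trans ?_) (norm_nonneg y)
        exact abs_le_max_abs_abs ht.1.le ht.2
      refine (norm_inner_toL2_le (continuous_oddSlice k.continuous t)
        (hasCompactSupport_oddSlice k.hasCompactSupport t) hX0 (by positivity : 0 ≤ 2 * C)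
        (fun x hx => ?_) ?_).trans ?_
      · have : X < |x| := hx.trans_le (le_abs_self x)
        rw [oddSlice, k0 t x this, k0 t (-x) (by rwa [abs_neg]), sub_zero]
      · filter_upwards [hz t (Ioc_subset_Icc_self ht)] with x hx
        refine hx.imp id fun ⟨h1, h2⟩ => ?_
        refine (abs_sub _ _).trans ?_
        have := kb t x h1
        have := kb t (-x) h2
        simp only [Function.comp_apply]
        linarith
      · gcongr
    refine (intervalIntegral.norm_integral_le_of_norm_le_const key).trans_eq ?_
    ring
  have hweak : ∀ Φ, IsTest (trapezoid ε S R) Φ → ContDiff ℝ ∞ Φ →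
      ℓ (mixedDeriv Φ) = ℓ fun p => P p * Φ p := by
    intro Φ hΦ hΦs
    have k := hΦ.comp_homeomorph κ
    have hks : ContDiff ℝ ∞ (Φ ∘ κ) := hΦs.comp contDiff_charCoord
    have e1 := hw _ k hks
    have hPΦ : IsTest (trapezoid ε S R) fun p => P p * Φ p :=
      ⟨hPc.mul hΦ.continuous, hΦ.hasCompactSupport.mul_left,
        (tsupport_mul_subset_right).trans hΦ.tsupport_subset⟩
    have hmΦ : IsTest (trapezoid ε S R) (mixedDeriv Φ) :=
      ⟨(ContDiff.dirDeriv (ContDiff.dirDeriv hΦs _) _).continuous,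
        HasCompactSupport.dirDeriv (HasCompactSupport.dirDeriv hΦ.hasCompactSupport _) _,
        (tsupport_dirDeriv_subset _ _).trans ((tsupport_dirDeriv_subset _ _).trans
          hΦ.tsupport_subset)⟩
    rw [← sub_eq_zero, ← hsub _ _ hmΦ hPΦ]
    have e2 : (fun p => mixedDeriv Φ p - P p * Φ p) ∘ κ =
        fun p => -(β * δ) / 4 * waveExpr q (Φ ∘ κ) p := by
      funext p
      have := waveExpr_comp_charCoord (c := c) (hβ := hβ) (hδ := hδ) q hΦs p
      rw [← hκ] at this
      simp only [Function.comp_apply, hP, this, Homeomorph.symm_apply_apply]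
      linear_combination (-mixedDeriv Φ (κ p)) * hβ + (-(β * β) * mixedDeriv Φ (κ p)) * hδ
    simp only [hℓ, e2]
    have e3 : ∀ t, inner ℂ (sineOp L t y) (slice (fun p => -(β * δ) / 4 * waveExpr q (Φ ∘ κ) p) t) =
        ((-(β * δ) / 4 : ℝ) : ℂ) * inner ℂ (sineOp L t y) (slice (waveExpr q (Φ ∘ κ)) t) := fun t => by
      rw [slice_smul (continuous_waveExpr hq hks) (hasCompactSupport_waveExpr q k.hasCompactSupport),
        inner_smul_right_eq_smul, Complex.real_smul]
    simp only [e3]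
    rw [intervalIntegral.integral_const_mul, e1, mul_zero]
  have hθ' : IsTest (trapezoid ε S R) (θ ∘ κ.symm) :=
    (hθ.comp_homeomorph κ.symm).mono (by
      rw [← preimage_comp]
      simp)
  have := eq_zero_of_weak_solution hε hPc hsub hbd hweak hθ'
  simp only [hℓ, Function.comp_assoc] at this
  simpa using this

end Propagation

/-! ### Propagation of supports -/

section Support

theorem ae_imp_of_locally {μ : Measure ℝ} {p : ℝ → Prop} {U : Set ℝ}
    (h : ∀ x ∈ U, ∃ V, IsOpen V ∧ x ∈ V ∧ ∀ᵐ z ∂μ, z ∈ V → p z) : ∀ᵐ z ∂μ, z ∈ U → p z := by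
  rw [ae_iff]
  refine measure_null_of_locally_null _ fun x hx => ?_
  obtain ⟨V, hV, hxV, hp⟩ := h x (by by_contra hU; exact hx fun h' => absurd h' hU)
  refine ⟨_, inter_mem_nhdsWithin _ (hV.mem_nhds hxV), measure_mono_null ?_ (ae_iff.1 hp)⟩
  exact fun z hz hz' => hz.1 fun _ => hz' hz.2

/-- The passage from space-time to the separate times: if `S(s) y` is zero as a distribution in an
open subset of space-time, then it vanishes almost everywhere on the sections of this set. -/
theorem ae_eq_zero_of_integral_inner_slice {L : L2HalfLine →ₗ.[ℂ] L2HalfLine} {y : L2HalfLine}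
    {a b t : ℝ} {Ω : Set (ℝ × ℝ)} (hΩ : IsOpen Ω)
    (h : ∀ θ, IsTest Ω θ → ∫ s in a..b, inner ℂ (sineOp L s y) (slice θ s) = 0)
    (ht : t ∈ Ioo a b) {V : Set ℝ} (hV : IsOpen V) (hV0 : V ⊆ Ioi 0)
    (hVΩ : ∀ x ∈ V, (t, x) ∈ Ω) : ∀ᵐ x ∂halfLine, x ∈ V → sineOp L t y x = 0 := by
  refine ae_eq_zero_of_inner_toL2 hV fun φ hφ hs hsub => ?_
  obtain ⟨U, W, hU, -, htU, hφW, hUW⟩ := generalized_tube_lemma (isCompact_singleton (x := t))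
    hs hΩ (by
      rintro ⟨s, x⟩ ⟨hs, hx⟩
      obtain rfl : s = t := hs
      exact hVΩ x (hsub hx))
  set F : ℝ → ℂ := fun s => inner ℂ (sineOp L s y) (toL2 φ) with hF
  have hFc : Continuous F :=
    Continuous.inner ((continuous_sineOp L).clm_apply continuous_const) continuous_const
  have hO : IsOpen (U ∩ Ioo a b) := hU.inter isOpen_Ioo
  have key : ∀ᵐ s, s ∈ U ∩ Ioo a b → F s = 0 := by
    refine hO.ae_eq_zero_of_integral_contDiff_smul_eq_zero
      (hFc.locallyIntegrable.locallyIntegrableOn _) fun α hα hαs hαU => ?_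
    have hts : tsupport (fun p : ℝ × ℝ => α p.1 * φ p.2) ⊆ tsupport α ×ˢ tsupport φ := by
      refine closure_minimal (fun p hp => ⟨subset_tsupport _ (left_ne_zero_of_mul hp),
        subset_tsupport _ (right_ne_zero_of_mul hp)⟩) ((isClosed_tsupport _).prod (isClosed_tsupport _))
    have e := h (fun p => α p.1 * φ p.2) ⟨by
        have := hα.continuous
        have := hφ.continuous
        fun_prop, (hαs.prod hs).of_isClosed_subset (isClosed_tsupport _) hts, fun p hp =>
        hUW ⟨(hαU (hts hp).1).1, hφW (hts hp).2⟩⟩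
    have e1 : ∀ s, inner ℂ (sineOp L s y) (slice (fun p => α p.1 * φ p.2) s) = α s • F s := fun s => by
      have hsl : slice (fun p => α p.1 * φ p.2) s = α s • toL2 φ := by
        rw [← toL2_smul hφ.continuous hs]
        refine Lp.ext ?_
        have k : Continuous fun x => α s * φ x := continuous_const.mul hφ.continuous
        have k1 : Continuous (oddSlice (fun p : ℝ × ℝ => α p.1 * φ p.2) s) :=
          k.sub (k.comp continuous_neg)
        have k2 : HasCompactSupport (oddSlice (fun p : ℝ × ℝ => α p.1 * φ p.2) s) :=
          (hs.mul_left (f := fun _ => α s)).sub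
            ((hs.mul_left (f := fun _ => α s)).comp_homeomorph (Homeomorph.neg ℝ))
        filter_upwards [coeFn_toL2 k1 k2, coeFn_toL2 k hs.mul_left,
          ae_restrict_mem measurableSet_Ioi] with x h1 h2 hx
        have hx' : φ (-x) = 0 := image_eq_zero_of_notMem_tsupport fun hm => by
          have h3 : (0 : ℝ) < -x := hV0 (hsub hm)
          have h4 : (0 : ℝ) < x := hx
          linarith
        rw [slice, h1, h2, oddSlice]
        simp [hx']
      rw [hsl, inner_smul_right_eq_smul]
    simp only [e1] at e
    rwa [intervalIntegral.integral_of_le (ht.1.trans ht.2).le,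
      setIntegral_eq_integral_of_forall_compl_eq_zero fun s hs' => by
        rw [image_eq_zero_of_notMem_tsupport fun hm => hs' (Ioo_subset_Ioc_self (hαU hm).2),
          zero_smul]] at e
  have : EqOn F 0 (U ∩ Ioo a b) := Measure.eqOn_open_of_ae_eq
    ((ae_restrict_iff' hO.measurableSet).2 key) hO hFc.continuousOn continuousOn_const
  rw [← inner_conj_symm]
  rw [show inner ℂ (sineOp L t y) (toL2 φ) = 0 from this ⟨htU rfl, ht⟩, map_zero]

variable {q : ℝ → ℝ}

/-- Finite speed of propagation: if `f` vanishes in `(c - T, c + T)`, then `S(t) f` vanishes in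
`(c - T + t, c + T - t)`. -/
theorem sineOp_ae_eq_zero (hq : ContinuousOn q (Ici 0))
    (hpos : IsPositiveDefinite (minimalOperator q)) {c t T : ℝ} (hc : 0 ≤ c) (ht : 0 ≤ t)
    (htT : t < T) {f : L2HalfLine} (hf : ∀ᵐ x ∂halfLine, x ∈ Metric.ball c T → f x = 0) :
    ∀ᵐ x ∂halfLine, x ∈ Metric.ball c (T - t) →
      sineOp (friedrichs (minimalOperator q) hpos) t f x = 0 := by
  rcases ht.eq_or_lt with rfl | ht0
  · rw [sineOp_zero]
    filter_upwards [Lp.coeFn_zero ℂ 2 halfLine] with x hx _ using hx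
  have h1 : (1 : ℝ) * 1 = 1 := by norm_num
  have h2 : (-1 : ℝ) * -1 = 1 := by norm_num
  have hmem : ∀ s x : ℝ, charCoord c h1 h2 (s, x) ∈ trapezoid 1 (2 * T) T ↔
      -1 < 2 * s ∧ s < T ∧ s + |x - c| < T := fun s x => by
    simp only [charCoord_apply, trapezoid, mem_ofPred_eq]
    rw [← lt_sub_iff_add_lt' (a := s) (b := |x - c|), abs_lt]
    constructor
    · rintro ⟨k1, k2, k3, k4⟩
      exact ⟨by linarith, by linarith, by linarith, by linarith⟩
    · rintro ⟨k1, k2, k3, k4⟩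
      exact ⟨by linarith, by linarith, by linarith, by linarith⟩
  have key := fun θ hθ => integral_inner_slice_eq_zero (θ := θ) (c := c) (hβ := h1) (hδ := h2)
    (L := friedrichs (minimalOperator q) hpos) (y := f) (a := 0) (b := T) (ε := 1) (S := 2 * T)
    (R := T) hq (ht.trans htT.le) one_pos (fun s hs => Eventually.of_forall fun x => Or.inr (by
      simp only [charCoord_apply]
      exact ⟨fun _ => by linarith [hs.1], fun _ => by linarith [hs.1]⟩)) (fun Φ hΦ hΦs => by
      rw [integral_inner_waveExpr_of_nonneg hq hpos hΦs hΦ.hasCompactSupport (fun x hx => by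
        have := ((hmem T x).1 (hΦ.tsupport_subset hx)).2.1
        linarith), slice, inner_toL2_right (continuous_oddSlice hΦ.continuous 0)
        (hasCompactSupport_oddSlice hΦ.hasCompactSupport 0)]
      have hΦ0 : ∀ x, T ≤ |x - c| → Φ (0, x) = 0 := fun x hx =>
        image_eq_zero_of_notMem_tsupport fun hm => by
          have := ((hmem 0 x).1 (hΦ.tsupport_subset hm)).2.2
          linarith
      refine integral_eq_zero_of_ae ?_
      filter_upwards [hf, ae_restrict_mem measurableSet_Ioi] with x hx hx0
      rcases lt_or_ge (|x - c|) T with hxT | hxT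
      · rw [hx (by rwa [Metric.mem_ball, Real.dist_eq])]
        simp
      · -- since `c ≥ 0`, the reflected point is farther away from `c`
        have h3 : |x - c| ≤ |-x - c| := by
          have hx0' : 0 < x := hx0
          rw [abs_of_nonpos (by linarith : -x - c ≤ 0)]
          exact abs_le.2 ⟨by linarith, by linarith⟩
        simp [oddSlice, hΦ0 x hxT, hΦ0 (-x) (hxT.trans h3)]) (hθ := hθ)
  have := ae_eq_zero_of_integral_inner_slice ((isOpen_trapezoid 1 (2 * T) T).preimage
    (charCoord c h1 h2).continuous) key (t := t) ⟨ht0, htT⟩ (V := Metric.ball c (T - t) ∩ Ioi 0)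
    (Metric.isOpen_ball.inter isOpen_Ioi) inter_subset_right (fun x hx => by
      have hx1 := hx.1
      rw [Metric.mem_ball, Real.dist_eq] at hx1
      exact (hmem t x).2 ⟨by linarith, htT, by linarith⟩)
  filter_upwards [this, ae_restrict_mem measurableSet_Ioi] with x hx hx0 hxb using hx ⟨hxb, hx0⟩

/-- The datum `y` is recovered from `S(t) y`, `S(t) = L^(-1/2) sin (t L^(1/2))`, as the derivative
at `t = 0`. -/
theorem ae_eq_zero_of_forall_sineOp (hq : ContinuousOn q (Ici 0))
    (hpos : IsPositiveDefinite (minimalOperator q)) {τ : ℝ} (hτ : 0 < τ) {V : Set ℝ}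
    (hV : IsOpen V) (hV0 : V ⊆ Ioi 0) {y : L2HalfLine}
    (h : ∀ t ∈ Ioo (-τ) τ, ∀ᵐ x ∂halfLine, x ∈ V →
      sineOp (friedrichs (minimalOperator q) hpos) t y x = 0) :
    ∀ᵐ x ∂halfLine, x ∈ V → y x = 0 := by
  refine ae_eq_zero_of_inner_toL2 hV fun φ hφ hs hsub => ?_
  set L := friedrichs (minimalOperator q) hpos with hL
  have hd := dense_domain_minimalOperator hq
  have hB := boundedInverse_friedrichs_nonneg hpos hd
  have hφ0 : φ 0 = 0 := image_eq_zero_of_notMem_tsupport fun hm => lt_irrefl (0 : ℝ) (hV0 (hsub hm))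
  set ψ := toL2 (sturmLiouville q φ) with hψ
  have hBψ : boundedInverse L ψ = toL2 φ :=
    (isBoundedInverse_friedrichs hpos hd _ _).2 (toL2_mem_graph_friedrichs hq hpos hφ hs hφ0)
  have e1 : HasDerivAt (fun t => inner ℂ (sineOp L t (boundedInverse L ψ)) y)
      (inner ℂ (toL2 φ) y) 0 := by
    have k := (hasDerivAt_apply (hasDerivAt_sineOp_comp hB 0) (hasDerivAt_const 0 ψ)).inner ℂ
      (hasDerivAt_const 0 y)
    rw [← hBψ]
    simpa [cosineOp_zero hB] using k
  have e2 : (fun t => inner ℂ (sineOp L t (boundedInverse L ψ)) y) =ᶠ[𝓝 0] fun _ => (0 : ℂ) := by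
    filter_upwards [Ioo_mem_nhds (neg_lt_zero.2 hτ) hτ] with t ht
    rw [hBψ, inner_sineOp_left, inner_toL2_left hφ.continuous hs]
    refine integral_eq_zero_of_ae ?_
    filter_upwards [h t ht] with x hx
    by_cases hxV : x ∈ V
    · rw [hx hxV, mul_zero, Pi.zero_apply]
    · rw [image_eq_zero_of_notMem_tsupport fun hm => hxV (hsub hm)]
      simp
  exact e1.unique ((hasDerivAt_const 0 (0 : ℂ)).congr_of_eventuallyEq e2)

/-- One-sided form of `ae_eq_zero_of_sineOp_ae_eq_zero`; `σ = ± 1` gives the direction. -/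
theorem ae_eq_zero_of_sineOp_ae_eq_zero_aux (hq : ContinuousOn q (Ici 0))
    (hpos : IsPositiveDefinite (minimalOperator q)) {c r T σ ρ τ : ℝ} (hrc : r ≤ c)
    (hσ : σ = 1 ∨ σ = -1) (hρ : 0 < ρ) (hρr : ρ ≤ r) (hτ : 0 < τ) (hτT : τ ≤ T) {y : L2HalfLine}
    (h : ∀ t ∈ Icc (-T) T, ∀ᵐ x ∂halfLine, x ∈ Metric.ball c r →
      sineOp (friedrichs (minimalOperator q) hpos) t y x = 0) :
    ∀ᵐ x ∂halfLine, -ρ < σ * (x - c) ∧ σ * (x - c) < T - ρ - τ → y x = 0 := by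
  have h1 : σ * σ = 1 := by rcases hσ with rfl | rfl <;> norm_num
  have hmem : ∀ s x : ℝ, charCoord c h1 h1 (s, x) ∈ trapezoid (2 * ρ) (2 * T) (T - ρ) ↔
      -ρ < σ * (x - c) ∧ σ * (x - c) < T ∧ |s| < T - ρ - σ * (x - c) := fun s x => by
    simp only [charCoord_apply, trapezoid, mem_ofPred_eq, h1]
    rw [abs_lt]
    constructor
    · rintro ⟨k1, k2, k3, k4⟩
      exact ⟨by linarith, by linarith, by linarith, by linarith⟩
    · rintro ⟨k1, k2, k3, k4⟩
      exact ⟨by linarith, by linarith, by linarith, by linarith⟩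
  have hT : 0 < T := hτ.trans_le hτT
  have habs : |T| = T := abs_of_pos hT
  have key := fun θ hθ => integral_inner_slice_eq_zero (θ := θ) (c := c) (hβ := h1) (hδ := h1)
    (L := friedrichs (minimalOperator q) hpos) (y := y) (a := -T) (b := T) (ε := 2 * ρ)
    (S := 2 * T) (R := T - ρ) hq (by linarith) (by positivity) (fun s hs => by
      filter_upwards [h s hs, ae_restrict_mem measurableSet_Ioi] with x hx hx0
      have hx0' : 0 < x := hx0
      by_cases hxb : x ∈ Metric.ball c r
      · exact Or.inl (hx hxb)
      rw [Metric.mem_ball, Real.dist_eq, abs_lt, not_and_or, not_lt, not_lt] at hxb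
      refine Or.inr ⟨fun hm => ?_, fun hm => ?_⟩
      · have k := ((hmem s x).1 hm).1
        simp only [charCoord_apply, h1]
        rcases hσ with rfl | rfl <;> rcases hxb with hxb | hxb <;> linarith
      · -- For `σ = -1` the number `σ (-x - c) = x + c` is positive, and for `σ = 1` the bound
        -- `-x - c > -ρ ≥ -c` is impossible.
        have k := ((hmem s (-x)).1 hm).1
        simp only [charCoord_apply, h1]
        rcases hσ with rfl | rfl <;> linarith) (fun Φ hΦ hΦs => by
      refine integral_inner_waveExpr_symm hq hpos hΦs hΦ.hasCompactSupport (fun x hx => ?_)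
        (fun x hx => ?_) y
      · have := (hmem T x).1 (hΦ.tsupport_subset hx)
        linarith [this.1, this.2.2]
      · have := (hmem (-T) x).1 (hΦ.tsupport_subset hx)
        rw [abs_neg] at this
        linarith [this.1, this.2.2]) (hθ := hθ)
  set V : Set ℝ := {x | -ρ < σ * (x - c) ∧ σ * (x - c) < T - ρ - τ} ∩ Ioi 0 with hVdef
  have hV : IsOpen V := by
    have hc : Continuous fun x : ℝ => σ * (x - c) := by fun_prop
    exact ((isOpen_lt continuous_const hc).inter (isOpen_lt hc continuous_const)).inter isOpen_Ioi
  have hy := ae_eq_zero_of_forall_sineOp hq hpos hτ hV inter_subset_right (y := y) fun t ht =>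
    ae_eq_zero_of_integral_inner_slice ((isOpen_trapezoid (2 * ρ) (2 * T) (T - ρ)).preimage
    (charCoord c h1 h1).continuous) key (t := t) ⟨by linarith [ht.1], by linarith [ht.2]⟩ hV
      inter_subset_right fun x hx => (hmem t x).2 ⟨hx.1.1, by linarith [hx.1.2], by
        have := abs_lt.2 ht
        linarith [hx.1.2]⟩
  filter_upwards [hy, ae_restrict_mem measurableSet_Ioi] with x hx hx0 hxb using hx ⟨hxb, hx0⟩

/-- Unique continuation in the space variable: if the solution `S(t) y` of the wave equation
vanishes near `c` for all `t ∈ [-T, T]`, then its velocity `y` at `t = 0` vanishes at the distance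
less than `T` from `c`. -/
theorem ae_eq_zero_of_sineOp_ae_eq_zero (hq : ContinuousOn q (Ici 0))
    (hpos : IsPositiveDefinite (minimalOperator q)) {c r T : ℝ} (hr : 0 < r) (hrc : r ≤ c)
    {y : L2HalfLine} (h : ∀ t ∈ Icc (-T) T, ∀ᵐ x ∂halfLine, x ∈ Metric.ball c r →
      sineOp (friedrichs (minimalOperator q) hpos) t y x = 0) :
    ∀ᵐ x ∂halfLine, x ∈ Metric.ball c T → y x = 0 := by
  refine ae_imp_of_locally fun x hx => ?_
  rw [Metric.mem_ball, Real.dist_eq] at hx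
  obtain ⟨σ, hσ, hσx⟩ : ∃ σ : ℝ, (σ = 1 ∨ σ = -1) ∧ |x - c| = σ * (x - c) := by
    rcases abs_choice (x - c) with e | e
    · exact ⟨1, Or.inl rfl, by rw [e, one_mul]⟩
    · exact ⟨-1, Or.inr rfl, by rw [e, neg_one_mul]⟩
  have h0 := abs_nonneg (x - c)
  -- With `s = |x - c|`, the condition `s < T - ρ - τ` holds for `τ = (T - s) / 3` and `ρ ≤ τ`.
  set τ := (T - |x - c|) / 3 with hτ
  have hτ0 : 0 < τ := by rw [hτ]; linarith
  have hρ : 0 < min r τ := lt_min hr hτ0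
  have hρτ : min r τ ≤ τ := min_le_right _ _
  refine ⟨{x | -min r τ < σ * (x - c) ∧ σ * (x - c) < T - min r τ - τ}, ?_, ⟨?_, ?_⟩,
    ae_eq_zero_of_sineOp_ae_eq_zero_aux hq hpos hrc hσ hρ (min_le_left _ _) hτ0 (by linarith) h⟩
  · have hc : Continuous fun x : ℝ => σ * (x - c) := by fun_prop
    exact (isOpen_lt continuous_const hc).inter (isOpen_lt hc continuous_const)
  · rw [← hσx]
    linarith
  · rw [← hσx]
    linarith

end Support

/-! ### The wave isotony on the subspaces `L₂(E)` -/

section Isotony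

/-- A closed subspace containing the integrand contains the integral. -/
theorem wave_mem {H : Type*} [NormedAddCommGroup H] [InnerProductSpace ℂ H] [CompleteSpace H]
    {L : H →ₗ.[ℂ] H} {K : ClosedSubmodule ℂ H} {g : ℝ → H} {t : ℝ}
    (hg : ∀ R : ℝ, MemLp g 2 (volume.restrict (Ioc 0 R)))
    (h : ∀ᵐ s ∂(volume.restrict (Ioc 0 t)), sineOp L (t - s) (g s) ∈ K) : wave L g t ∈ K := by
  have hK : K.toSubmoduleᗮᗮ = K.toSubmodule :=
    (Submodule.orthogonal_orthogonal_eq_closure _).trans K.isClosed.submodule_topologicalClosure_eq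
  change wave L g t ∈ K.toSubmodule
  rw [← hK, Submodule.mem_orthogonal]
  intro z hz
  rw [wave, ← integral_inner (integrable_wave L hg t)]
  refine integral_eq_zero_of_ae ?_
  filter_upwards [h] with s hs
  exact Submodule.inner_left_of_mem_orthogonal hs hz

variable {q : ℝ → ℝ} {E : Set ℝ}

theorem sineOp_mem_L2On (hq : ContinuousOn q (Ici 0))
    (hpos : IsPositiveDefinite (minimalOperator q)) {t T : ℝ} (ht : 0 ≤ t) (htT : t < T)
    {f : L2HalfLine} (hf : f ∈ L2On E) :
    sineOp (friedrichs (minimalOperator q) hpos) t f ∈ L2On (nbhd T E) := by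
  have hf' : ∀ᵐ x ∂halfLine, x ∉ E → f x = 0 := hf
  have key : ∀ᵐ x ∂halfLine, x ∈ Ici 0 \ nbhd T E →
      sineOp (friedrichs (minimalOperator q) hpos) t f x = 0 := by
    refine ae_imp_of_locally fun x hx => ⟨Metric.ball x (T - t), Metric.isOpen_ball,
      Metric.mem_ball_self (sub_pos.2 htT), sineOp_ae_eq_zero hq hpos hx.1 ht htT ?_⟩
    filter_upwards [hf'] with z hz hzx
    refine hz fun hzE => hx.2 ⟨hx.1, Metric.mem_thickening_iff.2 ⟨z, hzE, ?_⟩⟩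
    rwa [dist_comm]
  change ∀ᵐ x ∂halfLine, x ∉ nbhd T E → _
  filter_upwards [key, ae_restrict_mem measurableSet_Ioi] with x hx hx0 hxN
  exact hx ⟨Ioi_subset_Ici_self hx0, hxN⟩

theorem reachable_le_L2On (hq : ContinuousOn q (Ici 0))
    (hpos : IsPositiveDefinite (minimalOperator q)) (T : ℝ) (E : Set ℝ) :
    reachable (friedrichs (minimalOperator q) hpos) T (L2On E) ≤ (L2On (nbhd T E)).toSubmodule := by
  rintro _ ⟨g, hg, rfl⟩
  refine wave_mem hg.1 ?_
  filter_upwards [ae_restrict_of_ae_restrict_of_subset Ioc_subset_Ioi_self hg.2,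
    ae_restrict_mem measurableSet_Ioc] with s hs hsT
  exact sineOp_mem_L2On hq hpos (by linarith [hsT.2]) (by linarith [hsT.1]) hs

/-- A vector orthogonal to the reachable states is orthogonal to `S(t) φ`, `φ ∈ G`, for `|t| ≤ T`:
the controls `g(s) = α(s) φ` with scalar test functions `α` suffice, and `S(t)` is continuous and
odd in `t`. -/
theorem inner_sineOp_eq_zero {H : Type*} [NormedAddCommGroup H] [InnerProductSpace ℂ H]
    [CompleteSpace H] {L : H →ₗ.[ℂ] H} {G : ClosedSubmodule ℂ H} {T t : ℝ} (hT : 0 < T)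
    {y φ : H} (hy : y ∈ (reachable L T G)ᗮ) (hφ : φ ∈ G) (ht : t ∈ Icc (-T) T) :
    inner ℂ y (sineOp L t φ) = 0 := by
  have hc : Continuous fun s => inner ℂ y (sineOp L (T - s) φ) :=
    Continuous.inner continuous_const (((continuous_sineOp L).comp (by fun_prop)).clm_apply
      continuous_const)
  have h1 : ∀ᵐ s, s ∈ Ioo 0 T → inner ℂ y (sineOp L (T - s) φ) = 0 := by
    refine isOpen_Ioo.ae_eq_zero_of_integral_contDiff_smul_eq_zero
      (hc.locallyIntegrable.locallyIntegrableOn _) fun α hα hαs hαU => ?_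
    have hg : IsControl G fun s => α s • φ :=
      ⟨fun R => ((hα.continuous.smul continuous_const).memLp_of_hasCompactSupport
        hαs.smul_right).restrict _, Eventually.of_forall fun s => by
          exact G.toSubmodule.smul_mem (α s : ℂ) hφ⟩
    have e := Submodule.inner_left_of_mem_orthogonal
      (show wave L (fun s => α s • φ) T ∈ reachable L T G from ⟨_, hg, rfl⟩) hy
    rw [wave, ← integral_inner (integrable_wave L hg.1 T)] at e
    rw [← setIntegral_eq_integral_of_forall_compl_eq_zero (s := Ioc 0 T) fun s hs' => by
      rw [image_eq_zero_of_notMem_tsupport fun hm => hs' (Ioo_subset_Ioc_self (hαU hm)),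
        zero_smul], ← e]
    refine integral_congr_ae (Eventually.of_forall fun s => ?_)
    simp only
    rw [ContinuousLinearMap.map_smul_of_tower, inner_smul_right_eq_smul]
  have h2 : EqOn (fun s => inner ℂ y (sineOp L (T - s) φ)) 0 (Ioo 0 T) :=
    Measure.eqOn_open_of_ae_eq ((ae_restrict_iff' measurableSet_Ioo).2 h1) isOpen_Ioo
      hc.continuousOn continuousOn_const
  have h3 : ∀ s ∈ Icc 0 T, inner ℂ y (sineOp L s φ) = 0 := fun s hs => by
    have h4 : closure (Ioo 0 T) ⊆ {s | inner ℂ y (sineOp L (T - s) φ) = 0} :=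
      (isClosed_eq hc continuous_const).closure_subset_iff.2 h2
    rw [closure_Ioo hT.ne] at h4
    have h5 := h4 (show T - s ∈ Icc 0 T from ⟨by linarith [hs.2], by linarith [hs.1]⟩)
    rwa [mem_ofPred_eq, sub_sub_cancel] at h5
  rcases le_total 0 t with h0 | h0
  · exact h3 t ⟨h0, ht.2⟩
  · have := h3 (-t) ⟨by linarith, by linarith [ht.1]⟩
    rwa [sineOp_neg, neg_apply, inner_neg_right, neg_eq_zero] at this

theorem ae_eq_zero_of_mem_orthogonal (hq : ContinuousOn q (Ici 0))
    (hpos : IsPositiveDefinite (minimalOperator q)) {T : ℝ} (hT : 0 < T) {y : L2HalfLine}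
    (hy : y ∈ (reachable (friedrichs (minimalOperator q) hpos) T (L2On E))ᗮ) :
    ∀ᵐ x ∂halfLine, x ∈ Metric.thickening T (interior E ∩ Ioi 0) → y x = 0 := by
  have hO : IsOpen (interior E ∩ Ioi (0 : ℝ)) := isOpen_interior.inter isOpen_Ioi
  have key : ∀ t ∈ Icc (-T) T, ∀ᵐ x ∂halfLine, x ∈ interior E ∩ Ioi 0 →
      sineOp (friedrichs (minimalOperator q) hpos) t y x = 0 := fun t ht => by
    refine ae_eq_zero_of_inner_toL2 hO fun φ hφ hs hsub => ?_
    have hφE : toL2 φ ∈ L2On E := by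
      change ∀ᵐ x ∂halfLine, x ∉ E → _
      filter_upwards [coeFn_toL2 hφ.continuous hs] with x hx hxE
      rw [hx, image_eq_zero_of_notMem_tsupport fun hm => hxE (interior_subset (hsub hm).1)]
      rfl
    rw [← inner_sineOp_left, ← inner_conj_symm, inner_sineOp_eq_zero hT hy hφE ht, map_zero]
  refine ae_imp_of_locally fun x hx => ?_
  obtain ⟨c, hc, hxc⟩ := Metric.mem_thickening_iff.1 hx
  obtain ⟨r, hr, hrc⟩ := Metric.isOpen_iff.1 hO c hc
  refine ⟨Metric.ball c T, Metric.isOpen_ball, hxc,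
    ae_eq_zero_of_sineOp_ae_eq_zero hq hpos (lt_min hr hc.2) (min_le_right r c) fun t ht => ?_⟩
  filter_upwards [key t ht] with z hz hzc
  exact hz (hrc (Metric.ball_subset_ball (min_le_left _ _) hzc))

/-- The wave isotony expands the supports with the speed one. The condition on `E` excludes
null sets: controls supported in a null set vanish, while the neighbourhoods of a null set have
positive measure. -/
theorem waveIsotony_L2On (hq : ContinuousOn q (Ici 0))
    (hpos : IsPositiveDefinite (minimalOperator q)) {T : ℝ} (hT : 0 < T)
    (hE : E ⊆ closure (interior E ∩ Ioi 0)) :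
    waveIsotony (friedrichs (minimalOperator q) hpos) T (L2On E) = L2On (nbhd T E) := by
  set R := reachable (friedrichs (minimalOperator q) hpos) T (L2On E) with hR
  have hle : R.topologicalClosure ≤ (L2On (nbhd T E)).toSubmodule :=
    R.topologicalClosure_minimal (reachable_le_L2On hq hpos T E) (L2On (nbhd T E)).isClosed
  rw [waveIsotony, if_neg hT.ne']
  refine le_antisymm hle fun z hz => ?_
  change z ∈ R.topologicalClosure
  obtain ⟨p, hp, y, hy, rfl⟩ := R.topologicalClosure.exists_add_mem_mem_orthogonal z
  have hyN : y ∈ (L2On (nbhd T E)).toSubmodule := by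
    simpa using sub_mem (show p + y ∈ (L2On (nbhd T E)).toSubmodule from hz) (hle hp)
  have hyN' : ∀ᵐ x ∂halfLine, x ∉ nbhd T E → y x = 0 := hyN
  rw [Submodule.orthogonal_closure] at hy
  have hy0 : y = 0 := by
    rw [Lp.eq_zero_iff_ae_eq_zero]
    filter_upwards [hyN', ae_eq_zero_of_mem_orthogonal hq hpos hT hy] with x h1 h2
    by_cases hx : x ∈ nbhd T E
    · refine h2 ?_
      rw [← Metric.thickening_closure]
      exact Metric.thickening_subset_of_subset T hE hx.2
    · exact h1 hx
  rwa [hy0, add_zero]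

theorem IsInterval.subset_closure {a : ℝ} {b : EReal} {Δ : Set ℝ} (h : IsInterval a b Δ)
    (ha : 0 ≤ a) (hab : (a : EReal) < b) : Δ ⊆ closure (interior Δ ∩ Ioi 0) := by
  have hI : ({x : ℝ | a < x ∧ (x : EReal) < b}) ⊆ interior Δ ∩ Ioi 0 := by
    refine subset_inter (interior_maximal ?_ ?_) fun x hx => ha.trans_lt hx.1
    · rintro x ⟨h1, h2⟩
      rcases h with rfl | rfl | rfl | rfl
      exacts [⟨h1, h2⟩, ⟨h1.le, h2⟩, ⟨h1, h2.le⟩, ⟨h1.le, h2.le⟩]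
    · exact (isOpen_lt continuous_const continuous_id).inter
        (isOpen_lt continuous_coe_real_ereal continuous_const)
  refine Subset.trans (fun x hx => ?_) (closure_mono hI)
  have hx' : a ≤ x ∧ (x : EReal) ≤ b := by
    rcases h with rfl | rfl | rfl | rfl
    exacts [⟨hx.1.le, hx.2.le⟩, ⟨hx.1, hx.2.le⟩, ⟨hx.1.le, hx.2⟩, hx]
  obtain ⟨m, ham, hmb⟩ := EReal.lt_iff_exists_real_btwn.1 hab
  rw [EReal.coe_lt_coe_iff] at ham
  rcases lt_trichotomy x m with hxm | rfl | hxm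
  · refine closure_mono (s := Ioo x m) (fun (z : ℝ) hz => And.intro (hx'.1.trans_lt hz.1)
      ((EReal.coe_lt_coe_iff.2 hz.2).trans hmb)) ?_
    rw [closure_Ioo hxm.ne]
    exact ⟨le_rfl, hxm.le⟩
  · exact _root_.subset_closure ⟨ham, hmb⟩
  · refine closure_mono (s := Ioo m x) (fun (z : ℝ) hz => And.intro (ham.trans hz.1)
      ((EReal.coe_lt_coe_iff.2 hz.2).trans_le hx'.2)) ?_
    rw [closure_Ioo hxm.ne]
    exact ⟨hxm.le, le_rfl⟩

theorem IsElementary.subset_closure (h : IsElementary E) : E ⊆ closure (interior E ∩ Ioi 0) := by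
  obtain ⟨n, a, b, Δ, ha, hab, -, hΔ, rfl⟩ := h
  refine iUnion_subset fun j => ((hΔ j).subset_closure (ha j) (hab j)).trans (closure_mono ?_)
  exact inter_subset_inter_left _ (interior_mono (subset_iUnion Δ j))

end Isotony

end WaveIsotony

end

/-- Action of the wave isotony of the Sturm–Liouville operator `L₀ = -d²/dx² + q` on the subspaces
`L₂(Δ)`, `Δ` an interval, and `L₂(E)`, `E` an elementary set. -/
theorem lemma2 (q : ℝ → ℝ) (hq : ContDiffOn ℝ ∞ q (Set.Ici 0))
    (hlp : WaveIsotony.LimitPointCase q)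
    (hpos : WaveIsotony.IsPositiveDefinite (WaveIsotony.minimalOperator q)) :
    (∀ (a : ℝ) (b : EReal) (Δ : Set ℝ) (T : ℝ), 0 ≤ a → (a : EReal) < b →
      WaveIsotony.IsInterval a b Δ → 0 < T →
      WaveIsotony.waveIsotony (WaveIsotony.friedrichs (WaveIsotony.minimalOperator q) hpos) T
          (WaveIsotony.L2On Δ) =
        WaveIsotony.L2On (WaveIsotony.nbhd T Δ)) ∧
    (∀ (E : Set ℝ) (T : ℝ), WaveIsotony.IsElementary E → 0 < T →
      WaveIsotony.waveIsotony (WaveIsotony.friedrichs (WaveIsotony.minimalOperator q) hpos) T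
          (WaveIsotony.L2On E) =
        WaveIsotony.L2On (WaveIsotony.nbhd T E)) := by
  have hq' : ContinuousOn q (Set.Ici 0) := hq.continuousOn
  exact ⟨fun a b Δ T ha hab hΔ hT => WaveIsotony.waveIsotony_L2On hq' hpos hT
      (hΔ.subset_closure ha hab),
    fun E T hE hT => WaveIsotony.waveIsotony_L2On hq' hpos hT hE.subset_closure⟩
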